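/- Let $M$ be a compact connected smooth manifold (without boundary), endowed with a continuous Riemannian metric and the associated distance $d$. Let $f\colon M\to M$ be a $C^1$ diffeomorphism and let $\mathcal O$ be a hyperbolic periodic orbit of $f$, i.e. the orbit of a point $p$ with $f^\tau(p)=p$, $\tau\ge 1$, such that no complex eigenvalue of $D_pf^\tau$ has modulus one. Let $W^s(\mathcal O)=\{x\in M : d(f^n(x),\mathcal O)\to 0 \text{ as } n\to+\infty\}$ be its stable manifold, with its intrinsic topology as an injectively immersed submanifold, and for $x\in W^s(\mathcal O)$ and $n\ge 1$ let $\mathrm{Jac}^s(f^n)(x)$ be the Jacobian of the map $T_xW^s(\mathcal O)\to T_{f^n(x)}W^s(\mathcal O)$ induced by $T_xf^n$. Suppose that $\mathcal O$ has the stable manifold unbounded distortion property: there is a dense set $\mathcal D\subset W^s(\mathcal O)$ such that for any $x\in\mathcal D$ and any $y\in W^s(\mathcal O)\setminus\mathcal O$ not in the same $f$-orbit, and for any $N\ge 1$, there exists $n\ge 1$ with $$\left|\log \mathrm{Jac}^s(f^n)(x)-\log \mathrm{Jac}^s(f^n)(y)\right|>N .$$ Then for every lipeomorphism $g$ of $M$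 (a homeomorphism such that $g$ and $g^{-1}$ are Lipschitz) with $g\circ f=f\circ g$ and $g(\mathcal O)=\mathcal O$, and for every connected component $W$ of $W^s(\mathcal O)\setminus\mathcal O$, there exists $i\in\mathbb Z$ such that $g=f^i$ on $W$. -/

import Mathlib

open Set Filter Manifold Topology Bundle
open scoped ContDiff

namespace StableDistortion

noncomputable section

/-- The Jacobian of a linear map `A : V → W` between finite-dimensional inner product spaces:
the factor `√det(A* A)` by which `A` multiplies `dim V`-dimensional volume. For injective `A` it is
`|det|` of the induced isomorphism `V → A(V)` in orthonormal bases of `V` and of `A(V)`. -/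
def jacobian {V W : Type*} [NormedAddCommGroup V] [InnerProductSpace ℝ V] [FiniteDimensional ℝ V]
    [NormedAddCommGroup W] [InnerProductSpace ℝ W] [FiniteDimensional ℝ W]
    (A : V →ₗ[ℝ] W) : ℝ :=
  Real.sqrt (LinearMap.det (LinearMap.adjoint A ∘ₗ A))

/-- The stable set of `O` under `f`: the points `x` whose forward iterates converge to `O`. -/
def stableSet {M : Type*} [MetricSpace M] (f : M → M) (O : Set M) : Set M :=
  {x | Tendsto (fun n : ℕ => Metric.infDist (f^[n] x) O) atTop (𝓝 0)}

/-- The stable manifold `W^s(O)`, as a type of its own: it does not carry the topology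
induced by `M`, but the intrinsic one declared below. -/
def StableManifold {M : Type*} [MetricSpace M] (f : M → M) (O : Set M) : Type _ :=
  {x : M // x ∈ stableSet f O}

/-- The local stable manifold `W^s_ε(x)` of a point `x` of `W^s(O)`. -/
def localStable {M : Type*} [MetricSpace M] (f : M → M) (O : Set M)
    (ε : ℝ) (x : StableManifold f O) : Set (StableManifold f O) :=
  {y | ∀ n : ℕ, dist (f^[n] x.1) (f^[n] y.1) ≤ ε}

/-- The intrinsic topology of the stable manifold: the local stable manifolds `W^s_ε(x)`, `ε > 0`,
form a basis of neighbourhoods of `x`. For a hyperbolic periodic orbit `O` of a diffeomorphism it is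
the topology of `W^s(O)` as an injectively immersed submanifold. -/
instance {M : Type*} [MetricSpace M] (f : M → M) (O : Set M) :
    TopologicalSpace (StableManifold f O) where
  IsOpen U := ∀ x ∈ U, ∃ ε > 0, localStable f O ε x ⊆ U
  isOpen_univ := fun _ _ => ⟨1, one_pos, subset_univ _⟩
  isOpen_inter := by
    intro U V hU hV x hx
    obtain ⟨a, ha, hUa⟩ := hU x hx.1
    obtain ⟨b, hb, hVb⟩ := hV x hx.2
    exact ⟨min a b, lt_min ha hb, fun y hy =>
      ⟨hUa fun n => (hy n).trans (min_le_left _ _), hVb fun n => (hy n).trans (min_le_right _ _)⟩⟩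
  isOpen_sUnion := by
    intro S hS x hx
    obtain ⟨U, hU, hxU⟩ := hx
    obtain ⟨a, ha, hUa⟩ := hS U hU x hxU
    exact ⟨a, ha, hUa.trans (subset_sUnion_of_mem hU)⟩

section Manifold

variable {m : ℕ} {M : Type*} [MetricSpace M] [ChartedSpace (EuclideanSpace ℝ (Fin m)) M]

/-- `D_p f^τ` as an endomorphism of `T_p M`, for a point with `f^τ(p) = p` (the tangent space at a
point is, in Mathlib, a copy of the model space, through the preferred chart at that point). -/
def returnDeriv (f : M → M) (p : M) (τ : ℕ) :
    EuclideanSpace ℝ (Fin m) →ₗ[ℝ] EuclideanSpace ℝ (Fin m) :=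
  ContinuousLinearMap.toLinearMap (M := EuclideanSpace ℝ (Fin m)) (M₂ := EuclideanSpace ℝ (Fin m))
    (mfderiv (𝓡 m) (𝓡 m) f^[τ] p)

/-- `O` is a hyperbolic periodic orbit of `f`: the orbit of a point `p` with `f^τ(p) = p`, `τ ≥ 1`,
such that no complex eigenvalue of `D_p f^τ : T_p M → T_p M` has modulus one. -/
def IsHyperbolicPeriodicOrbit (m : ℕ) {M : Type*} [MetricSpace M]
    [ChartedSpace (EuclideanSpace ℝ (Fin m)) M] (f : M → M) (O : Set M) : Prop :=
  ∃ (p : M) (τ : ℕ), 1 ≤ τ ∧ f^[τ] p = p ∧ O = range (fun n : ℕ => f^[n] p) ∧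
    ∀ z : ℂ, Polynomial.aeval z (returnDeriv (m := m) f p τ).charpoly = 0 → ‖z‖ ≠ 1

/-- The tangent space `T_x W^s(O) ⊆ T_x M`, spanned by the velocities at `x` of the `C^1` curves of
`M` that run in `W^s(O)` continuously for its intrinsic topology. -/
def stableTangent (f : M → M) (O : Set M) (x : StableManifold f O) :
    Submodule ℝ (TangentSpace (𝓡 m) x.1) :=
  Submodule.span ℝ {v | ∃ γ : ℝ → StableManifold f O, Continuous γ ∧
    ContMDiff 𝓘(ℝ, ℝ) (𝓡 m) 1 (fun t => (γ t).1) ∧ γ 0 = x ∧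
    v = mfderiv 𝓘(ℝ, ℝ) (𝓡 m) (fun t => (γ t).1) 0 (1 : ℝ)}

instance (x : M) : FiniteDimensional ℝ (TangentSpace (𝓡 m) x) :=
  inferInstanceAs (FiniteDimensional ℝ (EuclideanSpace ℝ (Fin m)))

variable [RiemannianBundle (fun x : M => TangentSpace (𝓡 m) x)]

/-- `Jac^s(h)(x)`: the Jacobian of the restriction of `T_x h` to `T_x W^s(O)`, for the inner products
of the Riemannian metric. It is used for the iterates `h = f^n`, which map `W^s(O)` to itself. -/
def stableJacobian (f : M → M) (O : Set M) (h : M → M) (x : StableManifold f O) : ℝ :=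
  jacobian ((mfderiv (𝓡 m) (𝓡 m) h x.1).toLinearMap.domRestrict (stableTangent f O x))

/-- The stable manifold unbounded distortion property of a hyperbolic periodic orbit `O` of `f`. -/
def HasStableUnboundedDistortion (f : M ≃ₘ^1⟮𝓡 m, 𝓡 m⟯ M) (O : Set M) : Prop :=
  ∃ D : Set (StableManifold f O), Dense D ∧
    ∀ x ∈ D, ∀ y : StableManifold f O, y.1 ∉ O →
      (∀ i : ℤ, y.1 ≠ ((f.toEquiv : Equiv.Perm M) ^ i) x.1) →
      ∀ N : ℕ, 1 ≤ N → ∃ n : ℕ, 1 ≤ n ∧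
        (N : ℝ) < |Real.log (stableJacobian (m := m) f O f^[n] x) -
          Real.log (stableJacobian (m := m) f O f^[n] y)|

end Manifold

/-- `g` is a lipeomorphism: a homeomorphism such that `g` and `g⁻¹` are Lipschitz. -/
def IsLipeomorphism {M : Type*} [MetricSpace M] (g : M ≃ₜ M) : Prop :=
  (∃ K, LipschitzWith K g) ∧ ∃ K, LipschitzWith K g.symm

end

end StableDistortion

/-! A bi-Lipschitz map that commutes with `f` can change the stable Jacobians of the iterates of `f`
only by a bounded factor. Suppose first that `h` fixes `p ∈ O`, commutes with `f` and is locally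
bi-Lipschitz. In coordinates on the local stable manifold of `p`, `h` conjugates every iterate `u`
of the return map to itself. The map `h` need not be differentiable, but it changes volumes by a
factor at most `K ^ d`. Comparing the volume of a small ball `S` with those of `h S`, `u S` and `u
(h S) = h (u S)` shows that the determinants of `u` at a point and at its image differ by a factor
at most `K ^ (2 * d)`, whatever the iterate (`abs_det_le_of_conj`).

For the given `g`, some `f^j ∘ g` fixes `p`. Replacing a point of `W^s(O)` by an iterate that stays
near `p` under the return map alters the log-Jacobians by a bounded amount only, since these form an
additive cocycle. Hence `log Jac^s(f^n)(x) - log Jac^s(f^n)(g x)` is bounded in `n` for each `x`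
(`exists_logJac_sub_le`). Unbounded distortion then forces `g x` into the `f`-orbit of `x` for every
`x` of the dense set outside `O`.

It remains to make the exponent constant on components. The sets `{g = f^i}` are closed. They are
disjoint off `O`, because `W^s(O)` has no periodic point outside `O`, and they are locally finite
off `O`, because forward iterates approach `O` locally uniformly in the intrinsic topology. Such a
family covers everything once it covers a dense set, and its members are relatively clopen, so each
component lies in one of them (`exists_connectedComponentIn_subset`).

The coordinates come from a stable manifold theorem proved by the sequence-space method: bounded
orbits are the solutions of an equation in the Banach space of bounded sequences, solved by the
inverse function theorem (`exists_stable_orbits`). A whole orbit then depends continuously on its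
stable coordinate in the supremum norm, which is what the intrinsic topology requires. -/

namespace StableDistortion

/-! ### Linear algebra: the splitting of a hyperbolic automorphism -/

theorem tendsto_zero_of_norm_succ_le {V : Type*} [SeminormedAddCommGroup V] {x : ℕ → V} {b : ℕ → ℝ}
    {q : ℝ} (hq0 : 0 ≤ q) (hq : q < 1) (hb : Tendsto b atTop (𝓝 0))
    (h : ∀ n, ‖x (n + 1)‖ ≤ q * ‖x n‖ + b n) : Tendsto x atTop (𝓝 0) := by
  rw [tendsto_zero_iff_norm_tendsto_zero, Metric.tendsto_atTop]
  intro ε hε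
  have h1q : 0 < 1 - q := by linarith
  obtain ⟨n₀, hn₀⟩ := Metric.tendsto_atTop.1 hb ((1 - q) * (ε / 2)) (by positivity)
  have key : ∀ k, ‖x (n₀ + k)‖ ≤ q ^ k * ‖x n₀‖ + ε / 2 := by
    intro k
    induction k with
    | zero => simp; linarith
    | succ k ih =>
      have h1 := h (n₀ + k)
      have h2 := hn₀ (n₀ + k) (by omega)
      rw [Real.dist_eq, sub_zero] at h2
      have h3 := (le_abs_self _).trans h2.le
      have h4 := mul_le_mul_of_nonneg_left ih hq0
      rw [← add_assoc, pow_succ]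
      nlinarith
  have h5 : Tendsto (fun k : ℕ => q ^ k * ‖x n₀‖) atTop (𝓝 0) := by
    simpa using (tendsto_pow_atTop_nhds_zero_of_lt_one hq0 hq).mul_const ‖x n₀‖
  obtain ⟨k₀, hk₀⟩ := Metric.tendsto_atTop.1 h5 (ε / 2) (by positivity)
  refine ⟨n₀ + k₀, fun n hn => ?_⟩
  obtain ⟨k, rfl⟩ := Nat.exists_eq_add_of_le (show n₀ ≤ n by omega)
  have h6 := hk₀ k (by omega)
  rw [Real.dist_eq, sub_zero] at h6
  have := (le_abs_self _).trans_lt h6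
  rw [Real.dist_eq, sub_zero, abs_norm]
  linarith [key k]

section Complex

variable {V : Type*} [NormedAddCommGroup V] [NormedSpace ℂ V]

/-- Induction on the order of the generalized eigenvector: `B ^ (n + 1) v` is `z • B ^ n v` plus `B
^ n` applied to `(B - z) v`, a vector of lower order. The second term tends to `0` and the first
contracts. -/
theorem tendsto_pow_apply_of_norm_lt_one {B : Module.End ℂ V} {z : ℂ} (hz : ‖z‖ < 1) (k : ℕ) :
    ∀ v : V, ((B - algebraMap ℂ _ z) ^ k) v = 0 →
      Tendsto (fun n : ℕ => (B ^ n) v) atTop (𝓝 0) := by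
  induction k with
  | zero => intro v hv; simp at hv; simp [hv]
  | succ k ih =>
    intro v hv
    rw [pow_succ, Module.End.mul_apply] at hv
    have h1 := (ih _ hv).norm
    rw [norm_zero] at h1
    refine tendsto_zero_of_norm_succ_le (norm_nonneg z) hz h1 fun n => ?_
    have : (B ^ (n + 1)) v = z • (B ^ n) v + (B ^ n) ((B - algebraMap ℂ _ z) v) := by
      simp [pow_succ, Module.algebraMap_end_apply]
    rw [this]
    exact (norm_add_le _ _).trans (by rw [norm_smul])

/-- The same induction for the inverse, with contraction factor `‖z‖⁻¹`. The perturbation now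
carries the exponent `n + 1`, whence the shift of the induction hypothesis. -/
theorem tendsto_pow_inv_apply_of_one_lt_norm {B B' : Module.End ℂ V} (hB : B' * B = 1) {z : ℂ}
    (hz : 1 < ‖z‖) (k : ℕ) :
    ∀ v : V, ((B - algebraMap ℂ _ z) ^ k) v = 0 →
      Tendsto (fun n : ℕ => (B' ^ n) v) atTop (𝓝 0) := by
  have hz0 : z ≠ 0 := by rintro rfl; simp at hz; linarith
  induction k with
  | zero => intro v hv; simp at hv; simp [hv]
  | succ k ih =>
    intro v hv
    rw [pow_succ, Module.End.mul_apply] at hv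
    have h1 := (((ih _ hv).comp (tendsto_add_atTop_nat 1)).const_smul z⁻¹).norm
    rw [smul_zero, norm_zero] at h1
    refine tendsto_zero_of_norm_succ_le (q := ‖z‖⁻¹) (by positivity) (inv_lt_one_of_one_lt₀ hz) h1
      fun n => ?_
    have : (B' ^ (n + 1)) v = z⁻¹ • (B' ^ n) v
        - z⁻¹ • (B' ^ (n + 1)) ((B - algebraMap ℂ _ z) v) := by
      have h2 : (B' ^ (n + 1)) (B v) = (B' ^ n) v := by
        rw [← Module.End.mul_apply, pow_succ, mul_assoc, hB, mul_one]
      rw [LinearMap.sub_apply, map_sub, h2, Module.algebraMap_end_apply, map_smul, ← smul_sub,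
        sub_sub_cancel, inv_smul_smul₀ hz0]
    rw [this]
    refine (norm_sub_le _ _).trans ?_
    rw [norm_smul z⁻¹, norm_inv]; rfl

/-- Over `ℂ` the generalized eigenspaces span, and those with `‖z‖ = 1` vanish; each of the others
decays either forward or backward. -/
theorem exists_add_of_hyperbolic [FiniteDimensional ℂ V] {B B' : Module.End ℂ V} (hB : B' * B = 1)
    (h : ∀ z, B.HasEigenvalue z → ‖z‖ ≠ 1) (v : V) :
    ∃ s u, v = s + u ∧ Tendsto (fun n : ℕ => (B ^ n) s) atTop (𝓝 0) ∧
      Tendsto (fun n : ℕ => (B' ^ n) u) atTop (𝓝 0) := by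
  have hv : v ∈ ⨆ z : ℂ, B.maxGenEigenspace z := by
    rw [Module.End.iSup_maxGenEigenspace_eq_top]; trivial
  induction hv using Submodule.iSup_induction' with
  | mem z x hx =>
    obtain ⟨k, hk⟩ := (B.mem_maxGenEigenspace z x).1 hx
    have hk' : ((B - algebraMap ℂ _ z) ^ k) x = 0 := hk
    rcases lt_trichotomy ‖z‖ 1 with hz | hz | hz
    · exact ⟨x, 0, by simp, tendsto_pow_apply_of_norm_lt_one hz k x hk', by simp⟩
    · have hx0 : x = 0 := by
        by_contra hx0
        refine h z ?_ hz
        refine Module.End.hasEigenvalue_of_hasGenEigenvalue (k := k) ?_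
        rw [Module.End.HasGenEigenvalue, Module.End.HasUnifEigenvalue]
        intro hbot
        apply hx0
        have : x ∈ B.genEigenspace z k := by
          rw [Module.End.mem_genEigenspace_nat]; exact hk
        rw [hbot] at this
        simpa using this
      exact ⟨0, 0, by simp [hx0], by simp, by simp⟩
    · exact ⟨0, x, by simp, by simp, tendsto_pow_inv_apply_of_one_lt_norm hB hz k x hk'⟩
  | zero => exact ⟨0, 0, by simp, by simp, by simp⟩
  | add x y _ _ hx hy =>
    obtain ⟨s, u, rfl, hs, hu⟩ := hx
    obtain ⟨s', u', rfl, hs', hu'⟩ := hy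
    refine ⟨s + s', u + u', by abel, ?_, ?_⟩
    · simpa using hs.add hs'
    · simpa using hu.add hu'

end Complex

section Real

variable {E : Type*} [NormedAddCommGroup E] [NormedSpace ℝ E] [FiniteDimensional ℝ E]

/-- Multiplication by a real matrix commutes with taking real parts. -/
theorem re_toLin'_map_pow {d : ℕ} (A : Matrix (Fin d) (Fin d) ℝ) (n : ℕ) (w : Fin d → ℂ) :
    (fun i => ((Matrix.toLin' (A.map (algebraMap ℝ ℂ)) ^ n) w i).re)
      = (Matrix.toLin' A ^ n) (fun i => (w i).re) := by
  induction n with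
  | zero => simp
  | succ n ih =>
    rw [pow_succ', pow_succ', Module.End.mul_apply, Module.End.mul_apply, ← ih]
    ext i
    simp [Matrix.mulVec, dotProduct]

/-- The matrix of `A` is complexified, split there, and the real parts of the two components are
taken; real parts commute with real matrices. -/
theorem exists_add_of_hyperbolic_real (A : E ≃L[ℝ] E)
    (h : ∀ z : ℂ, Polynomial.aeval z (A : E →ₗ[ℝ] E).charpoly = 0 → ‖z‖ ≠ 1) (v : E) :
    ∃ s u, v = s + u ∧ Tendsto (fun n : ℕ => ((A : E →L[ℝ] E) ^ n) s) atTop (𝓝 0) ∧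
      Tendsto (fun n : ℕ => ((A.symm : E →L[ℝ] E) ^ n) u) atTop (𝓝 0) := by
  let b := Module.finBasis ℝ E
  let X := LinearMap.toMatrix b b (A : E →ₗ[ℝ] E)
  let Y := LinearMap.toMatrix b b (A.symm : E →ₗ[ℝ] E)
  have hYX : Y * X = 1 := by
    rw [← LinearMap.toMatrix_comp b b b, ← LinearMap.toMatrix_id b]
    congr 1
    ext x; simp
  let B : Module.End ℂ (Fin (Module.finrank ℝ E) → ℂ) := Matrix.toLin' (X.map (algebraMap ℝ ℂ))
  let B' : Module.End ℂ (Fin (Module.finrank ℝ E) → ℂ) := Matrix.toLin' (Y.map (algebraMap ℝ ℂ))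
  have hB : B' * B = 1 := by
    rw [Module.End.mul_eq_comp, ← Matrix.toLin'_mul, ← Matrix.map_mul, hYX]
    simp [Module.End.one_eq_id]
  have hev : ∀ z, B.HasEigenvalue z → ‖z‖ ≠ 1 := by
    intro z hz
    apply h
    have h1 : Polynomial.IsRoot B.charpoly z := Module.End.hasEigenvalue_iff_isRoot_charpoly B z |>.1 hz
    rw [show B.charpoly = (A : E →ₗ[ℝ] E).charpoly.map (algebraMap ℝ ℂ) by
      rw [Matrix.charpoly_toLin', Matrix.charpoly_map, LinearMap.charpoly_toMatrix]] at h1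
    rwa [Polynomial.IsRoot, Polynomial.eval_map_algebraMap] at h1
  have key : ∀ (L : E →L[ℝ] E) (w : Fin _ → ℂ),
      Tendsto (fun n : ℕ => (Matrix.toLin' ((LinearMap.toMatrix b b (L : E →ₗ[ℝ] E)).map
        (algebraMap ℝ ℂ)) ^ n) w) atTop (𝓝 0) →
      Tendsto (fun n : ℕ => (L ^ n) (b.equivFun.symm fun i => (w i).re)) atTop (𝓝 0) := by
    intro L w hw
    have h1 : Tendsto (fun n : ℕ => b.equivFunL.symm fun i => ((Matrix.toLin'
        ((LinearMap.toMatrix b b (L : E →ₗ[ℝ] E)).map (algebraMap ℝ ℂ)) ^ n) w i).re)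
        atTop (𝓝 0) := by
      have : Tendsto (fun n : ℕ => fun i => ((Matrix.toLin'
        ((LinearMap.toMatrix b b (L : E →ₗ[ℝ] E)).map (algebraMap ℝ ℂ)) ^ n) w i).re)
        atTop (𝓝 0) := by
        rw [tendsto_pi_nhds] at hw ⊢
        intro i
        simpa [Function.comp_def] using (Complex.continuous_re.tendsto _).comp (hw i)
      simpa [Function.comp_def] using (b.equivFunL.symm.continuous.tendsto 0).comp this
    refine h1.congr fun n => ?_
    rw [re_toLin'_map_pow]
    generalize (fun i => (w i).re) = x
    show b.equivFun.symm _ = _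
    induction n with
    | zero => simp
    | succ n ih =>
      rw [pow_succ', pow_succ', Module.End.mul_apply, mul_apply_eq_comp, ← ih]
      rw [LinearEquiv.symm_apply_eq]
      ext i
      rw [Matrix.toLin'_apply]
      have := LinearMap.toMatrix_mulVec_repr b b (L : E →ₗ[ℝ] E) (b.equivFun.symm ((Matrix.toLin'
        (LinearMap.toMatrix b b (L : E →ₗ[ℝ] E)) ^ n) x))
      have h3 : ∀ y : E, b.equivFun y = ⇑(b.repr y) := fun y => rfl
      rw [h3, ← ContinuousLinearMap.coe_coe, ← this, ← h3, LinearEquiv.apply_symm_apply]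
  obtain ⟨s, u, hv, hs, hu⟩ := exists_add_of_hyperbolic hB hev (fun i => ((b.equivFun v i : ℝ) : ℂ))
  refine ⟨_, _, ?_, key (A : E →L[ℝ] E) s hs, key (A.symm : E →L[ℝ] E) u hu⟩
  rw [← map_add, LinearEquiv.eq_symm_apply]
  ext i
  have := congrArg Complex.re (congrFun hv i)
  simpa using this

theorem tendsto_clm_zero_of_apply {T : ℕ → E →L[ℝ] E}
    (h : ∀ v, Tendsto (fun n => T n v) atTop (𝓝 0)) : Tendsto T atTop (𝓝 0) := by
  let b := Module.finBasis ℝ E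
  rw [tendsto_zero_iff_norm_tendsto_zero]
  have h1 : Tendsto (fun n => Fintype.card (Fin (Module.finrank ℝ E)) • ‖b.equivFunL.toContinuousLinearMap‖ *
      ∑ i, ‖T n (b i)‖) atTop (𝓝 0) := by
    have : Tendsto (fun n => ∑ i, ‖T n (b i)‖) atTop (𝓝 (∑ i : Fin (Module.finrank ℝ E), 0)) :=
      tendsto_finsetSum _ fun i _ => by simpa using (h (b i)).norm
    simpa using this.const_mul (Fintype.card (Fin (Module.finrank ℝ E)) • ‖b.equivFunL.toContinuousLinearMap‖)
  refine squeeze_zero (fun _ => norm_nonneg _) (fun n => ?_) h1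
  exact b.opNorm_le (by positivity) fun i =>
    Finset.single_le_sum (f := fun i => ‖T n (b i)‖) (fun _ _ => norm_nonneg _) (Finset.mem_univ i)

/-- The vectors whose forward orbit under `A` tends to `0`. -/
def decaying (A : E →L[ℝ] E) : Submodule ℝ E where
  carrier := {v | Tendsto (fun n : ℕ => (A ^ n) v) atTop (𝓝 0)}
  add_mem' := fun ha hb => by simpa using Tendsto.add ha hb
  zero_mem' := by simp
  smul_mem' := fun c x hx => by simpa only [mem_ofPred_eq, map_smul, smul_zero] using Tendsto.const_smul hx c

omit [FiniteDimensional ℝ E] in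
theorem apply_mem_decaying {A C : E →L[ℝ] E} (h : Commute C A) {v : E} (hv : v ∈ decaying A) :
    C v ∈ decaying A := by
  have h1 : Tendsto (fun n : ℕ => C ((A ^ n) v)) atTop (𝓝 0) := by
    have := (C.continuous.tendsto 0).comp hv
    rwa [map_zero] at this
  refine h1.congr fun n => ?_
  rw [← mul_apply_eq_comp, (h.pow_right n).eq, mul_apply_eq_comp]

/-- On the finite-dimensional space `U`, pointwise decay of the backward iterates is decay in
operator norm. So in `x = A⁻ⁿ (Aⁿ x)`, with `Aⁿ x ∈ U`, both factors tend to `0`. -/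
theorem disjoint_decaying (A : E ≃L[ℝ] E) :
    Disjoint (decaying (A : E →L[ℝ] E)) (decaying (A.symm : E →L[ℝ] E)) := by
  set U := decaying (A.symm : E →L[ℝ] E)
  rw [Submodule.disjoint_def]
  intro x hx hxU
  -- Composing with a linear retraction onto `U` gives operators on all of `E` that decay at every
  -- vector.
  have h1 : Tendsto (fun n : ℕ => ((A.symm : E →L[ℝ] E) ^ n).comp
      (U.subtypeL.comp (Submodule.subtypeL U).toLinearMap.leftInverse.toContinuousLinearMap))
      atTop (𝓝 0) := by
    apply tendsto_clm_zero_of_apply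
    intro v
    exact ((Submodule.subtypeL U).toLinearMap.leftInverse.toContinuousLinearMap v).2
  have hid : ∀ u ∈ U, U.subtypeL ((Submodule.subtypeL U).toLinearMap.leftInverse u) = u := by
    intro u hu
    have := LinearMap.leftInverse_apply_of_inj (f := (Submodule.subtypeL U).toLinearMap)
      (LinearMap.ker_eq_bot.2 Subtype.val_injective) ⟨u, hu⟩
    exact congrArg Subtype.val this
  have hAA : Commute (A : E →L[ℝ] E) (A.symm : E →L[ℝ] E) := by
    ext v; simp
  have h2 : ∀ n : ℕ, ((A : E →L[ℝ] E) ^ n) x ∈ U := fun n =>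
    apply_mem_decaying (hAA.pow_left n) hxU
  have h3 : ∀ n : ℕ, ((A.symm : E →L[ℝ] E) ^ n) (((A : E →L[ℝ] E) ^ n) x) = x := by
    intro n
    rw [← mul_apply_eq_comp, ← hAA.symm.mul_pow]
    have : (A.symm : E →L[ℝ] E) * (A : E →L[ℝ] E) = 1 := by ext v; simp
    rw [this]; simp
  have h4 := h1.norm.mul (show Tendsto (fun n : ℕ => ‖((A : E →L[ℝ] E) ^ n) x‖) atTop (𝓝 0) by
    simpa using hx.norm)
  rw [mul_zero] at h4
  have h5 : ‖x‖ ≤ 0 := by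
    refine ge_of_tendsto' h4 fun n => ?_
    refine le_trans (le_of_eq ?_) (ContinuousLinearMap.le_opNorm _ _)
    congr 1
    conv_lhs => rw [← h3 n]
    show _ = ((A.symm : E →L[ℝ] E) ^ n) (U.subtypeL ((Submodule.subtypeL U).toLinearMap.leftInverse _))
    rw [hid _ (h2 n)]
  simpa using h5

/-- A hyperbolic linear automorphism has a splitting that some power contracts and expands. -/
theorem exists_hyperbolic_splitting (A : E ≃L[ℝ] E)
    (h : ∀ z : ℂ, Polynomial.aeval z (A : E →ₗ[ℝ] E).charpoly = 0 → ‖z‖ ≠ 1) :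
    ∃ P : E →L[ℝ] E, P * P = P ∧ Commute P (A : E →L[ℝ] E) ∧ ∃ N : ℕ, 1 ≤ N ∧
      ‖(A : E →L[ℝ] E) ^ N * P‖ ≤ 1 / 4 ∧ ‖(A.symm : E →L[ℝ] E) ^ N * (1 - P)‖ ≤ 1 / 4 := by
  set S := decaying (A : E →L[ℝ] E)
  set U := decaying (A.symm : E →L[ℝ] E)
  have hSU : IsCompl S U := by
    refine ⟨disjoint_decaying A, ?_⟩
    rw [codisjoint_iff, eq_top_iff]
    intro v _
    obtain ⟨s, u, rfl, hs, hu⟩ := exists_add_of_hyperbolic_real A h v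
    exact Submodule.add_mem_sup hs hu
  let P : E →L[ℝ] E := (S.projection U hSU).toContinuousLinearMap
  have hPS : ∀ v, P v ∈ S := fun v => Submodule.projection_apply_mem hSU v
  have hQU : ∀ v, v - P v ∈ U := fun v => Submodule.sub_projection_mem hSU v
  have hP1 : ∀ v ∈ S, P v = v := fun v hv => Submodule.projection_apply_left hSU ⟨v, hv⟩
  have hP0 : ∀ v ∈ U, P v = 0 := fun v hv => Submodule.projection_apply_right hSU ⟨v, hv⟩
  have hAA : Commute (A : E →L[ℝ] E) (A.symm : E →L[ℝ] E) := by
    ext v; simp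
  have hPP : P * P = P := by
    ext v
    exact hP1 _ (hPS v)
  have hPA : Commute P (A : E →L[ℝ] E) := by
    ext v
    show P (A v) = A (P v)
    have h1 : A v = A (P v) + A (v - P v) := by rw [← map_add]; congr 1; abel
    have h2 : A (P v) ∈ S := apply_mem_decaying (Commute.refl _) (hPS v)
    have h3 : A (v - P v) ∈ U := apply_mem_decaying (A := (A.symm : E →L[ℝ] E)) hAA (hQU v)
    rw [h1, map_add, hP1 _ h2, hP0 _ h3, add_zero]
  have hs : Tendsto (fun n : ℕ => (A : E →L[ℝ] E) ^ n * P) atTop (𝓝 0) :=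
    tendsto_clm_zero_of_apply fun v => hPS v
  have hu : Tendsto (fun n : ℕ => (A.symm : E →L[ℝ] E) ^ n * (1 - P)) atTop (𝓝 0) :=
    tendsto_clm_zero_of_apply fun v => hQU v
  have hs' := hs.norm.eventually_le_const (u := 1 / 4) (by simp)
  have hu' := hu.norm.eventually_le_const (u := 1 / 4) (by simp)
  obtain ⟨N, ⟨h1, h2⟩, h3⟩ := ((hs'.and hu').and (eventually_ge_atTop 1)).exists
  exact ⟨P, hPP, hPA, N, h3, h1, h2⟩

end Real
end StableDistortion

/-! ### The stable manifold theorem through bounded sequences -/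

namespace StableDistortion
noncomputable section

open BoundedContinuousFunction in
/-- The continuous linear map on bounded sequences given by an explicit formula. -/
def seqCLM {V E : Type*} [NormedAddCommGroup V] [NormedSpace ℝ V] [NormedAddCommGroup E]
    [NormedSpace ℝ E] (T : V → ℕ → E) (C : ℝ) (hadd : ∀ v w n, T (v + w) n = T v n + T w n)
    (hsmul : ∀ (c : ℝ) v n, T (c • v) n = c • T v n) (hC : ∀ v n, ‖T v n‖ ≤ C * ‖v‖) :
    V →L[ℝ] (ℕ →ᵇ E) :=
  LinearMap.mkContinuous
    { toFun := fun v => ofNormedAddCommGroupDiscrete (T v) (C * ‖v‖) (hC v)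
      map_add' := fun v w => by ext n; exact hadd v w n
      map_smul' := fun c v => by ext n; exact hsmul c v n } C
    fun v => (norm_le ((norm_nonneg _).trans (hC v 0))).2 (hC v)

section

variable {V E : Type*} [NormedAddCommGroup V] [NormedSpace ℝ V] [NormedAddCommGroup E]
  [NormedSpace ℝ E]

theorem norm_seqCLM_le {T : V → ℕ → E} {C : ℝ} {hadd hsmul hC} (h0 : 0 ≤ C) :
    ‖seqCLM T C hadd hsmul hC‖ ≤ C :=
  LinearMap.mkContinuous_norm_le _ h0 _

@[simp] theorem seqCLM_apply {T : V → ℕ → E} {C : ℝ} {hadd hsmul hC} (v : V) (n : ℕ) :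
    seqCLM T C hadd hsmul hC v n = T v n := rfl

open BoundedContinuousFunction

/-- Composition of a bounded sequence with a bounded map. -/
def nemytskii (r : E → E) (C : ℝ) (hr : ∀ v, ‖r v‖ ≤ C) (w : ℕ →ᵇ E) : ℕ →ᵇ E :=
  ofNormedAddCommGroupDiscrete (fun n => r (w n)) C fun n => hr (w n)

/-- The derivative of the composition operator. -/
def nemytskiiDeriv (D : E → E →L[ℝ] E) (C : ℝ) (hD : ∀ v, ‖D v‖ ≤ C) (w : ℕ →ᵇ E) :
    (ℕ →ᵇ E) →L[ℝ] (ℕ →ᵇ E) :=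
  seqCLM (fun v n => D (w n) (v n)) C (by simp) (by simp) fun v n =>
    ((D (w n)).le_opNorm _).trans
      (mul_le_mul (hD _) (v.norm_coe_le_norm n) (norm_nonneg _) ((norm_nonneg _).trans (hD (w n))))

variable {r : E → E} {C : ℝ} {hr : ∀ v, ‖r v‖ ≤ C} {D : E → E →L[ℝ] E} {C' : ℝ}
  {hD : ∀ v, ‖D v‖ ≤ C'} {R : ℝ}

/-- The mean value estimate is applied to each term of the sequence; uniform continuity of `D` makes
it uniform in the index, as the supremum norm demands. -/
theorem hasFDerivAt_nemytskii (h : ∀ v ∈ Metric.ball (0 : E) R, HasFDerivAt r (D v) v)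
    (hu : UniformContinuousOn D (Metric.ball 0 R)) {w : ℕ →ᵇ E} (hw : ‖w‖ < R) :
    HasFDerivAt (nemytskii r C hr) (nemytskiiDeriv D C' hD w) w := by
  refine HasFDerivAt.of_isLittleO (Asymptotics.isLittleO_iff.2 fun c hc => ?_)
  obtain ⟨δ, hδ, hδc⟩ := Metric.uniformContinuousOn_iff.1 hu c hc
  have hm : 0 < min δ (R - ‖w‖) := lt_min hδ (by linarith)
  filter_upwards [Metric.ball_mem_nhds w hm] with w' hw'
  refine (norm_le (by positivity)).2 fun n => ?_
  have hsub : ∀ x ∈ Metric.ball (w n) (min δ (R - ‖w‖)), x ∈ Metric.ball (0 : E) R := by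
    intro x hx
    rw [mem_ball_zero_iff]
    rw [mem_ball_iff_norm] at hx
    have h1 := norm_le_norm_add_norm_sub' x (w n)
    have h2 := w.norm_coe_le_norm n
    have h3 := hx.trans_le (min_le_right _ _)
    linarith
  have hd : ‖w' n - w n‖ ≤ ‖w' - w‖ := (w' - w).norm_coe_le_norm n
  have hw'' : ‖w' - w‖ < min δ (R - ‖w‖) := by rwa [mem_ball_iff_norm] at hw'
  have key := (convex_ball (w n) (min δ (R - ‖w‖))).norm_image_sub_le_of_norm_hasFDerivWithin_le'
    (f := r) (f' := D) (φ := D (w n)) (C := c) (x := w n) (y := w' n)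
    (fun x hx => (h x (hsub x hx)).hasFDerivWithinAt)
    (fun x hx => by
      rw [← dist_eq_norm]
      exact (hδc x (hsub x hx) (w n) (hsub _ (Metric.mem_ball_self hm))
        (hx.trans_le (min_le_left _ _))).le)
    (Metric.mem_ball_self hm) (by rw [mem_ball_iff_norm]; exact hd.trans_lt hw'')
  exact key.trans (mul_le_mul_of_nonneg_left hd hc.le)

theorem contDiffAt_nemytskii (hR : 0 < R)
    (h : ∀ v ∈ Metric.ball (0 : E) R, HasFDerivAt r (D v) v)
    (hu : UniformContinuousOn D (Metric.ball 0 R)) (hD : ∀ v, ‖D v‖ ≤ C') :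
    ContDiffAt ℝ 1 (nemytskii r C hr) 0 := by
  refine contDiffAt_one_iff.2 ⟨nemytskiiDeriv D C' hD, Metric.ball 0 R,
    Metric.ball_mem_nhds _ hR, ?_, fun w hw =>
      hasFDerivAt_nemytskii h hu (by simpa using hw)⟩
  have hmem : ∀ w ∈ Metric.ball (0 : ℕ →ᵇ E) R, ∀ n, w n ∈ Metric.ball (0 : E) R := by
    intro w hw n
    rw [mem_ball_zero_iff] at hw ⊢
    exact (w.norm_coe_le_norm n).trans_lt hw
  rw [Metric.continuousOn_iff]
  intro w hw ε hε
  obtain ⟨δ, hδ, hδc⟩ := Metric.uniformContinuousOn_iff.1 hu (ε / 2) (by positivity)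
  refine ⟨δ, hδ, fun w' hw' hd => ?_⟩
  rw [dist_eq_norm]
  refine lt_of_le_of_lt (ContinuousLinearMap.opNorm_le_bound _ (by positivity) fun v => ?_)
    (half_lt_self hε)
  refine (norm_le (by positivity)).2 fun n => ?_
  show ‖D (w' n) (v n) - D (w n) (v n)‖ ≤ _
  rw [← _root_.sub_apply]
  refine ((D (w' n) - D (w n)).le_opNorm _).trans ?_
  refine mul_le_mul ?_ (v.norm_coe_le_norm n) (norm_nonneg _) (by positivity)
  rw [← dist_eq_norm]
  exact (hδc _ (hmem _ hw' n) _ (hmem _ hw n) ((dist_coe_le_dist n).trans_lt hd)).le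

/-- The sequence with a single nonzero term, at `0`. -/
def seqSingle : E →L[ℝ] (ℕ →ᵇ E) :=
  seqCLM (fun a n => if n = 0 then a else 0) 1
    (by intros; split_ifs <;> simp) (by intros; split_ifs <;> simp)
    (by intro v n; split_ifs <;> simp)

/-- `w ↦ (L w_{n+1})_n`. -/
def seqLeft (L : E →L[ℝ] E) : (ℕ →ᵇ E) →L[ℝ] (ℕ →ᵇ E) :=
  seqCLM (fun w n => L (w (n + 1))) ‖L‖ (by simp) (by simp)
    fun w n => L.le_opNorm_of_le (w.norm_coe_le_norm _)

/-- `w ↦ (L w_{n-1})_n`, with `0` at `n = 0`. -/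
def seqRight (L : E →L[ℝ] E) : (ℕ →ᵇ E) →L[ℝ] (ℕ →ᵇ E) :=
  seqCLM (fun w n => if n = 0 then 0 else L (w (n - 1))) ‖L‖
    (by intros; split_ifs <;> simp) (by intros; split_ifs <;> simp)
    fun w n => by
      split_ifs
      · simp only [norm_zero]; positivity
      · exact L.le_opNorm_of_le (w.norm_coe_le_norm _)

/-- `w ↦ (L w_n)_n`. -/
def seqMap (L : E →L[ℝ] E) : (ℕ →ᵇ E) →L[ℝ] (ℕ →ᵇ E) :=
  seqCLM (fun w n => L (w n)) ‖L‖ (by simp) (by simp)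
    fun w n => L.le_opNorm_of_le (w.norm_coe_le_norm _)

/-- The operator on bounded sequences whose level sets are the orbits of `A + r` in terms of the
stable components of their first points. -/
def orbitMap (A P B : E →L[ℝ] E) (r : E → E) (C : ℝ) (hr : ∀ v, ‖r v‖ ≤ C) (w : ℕ →ᵇ E) :
    ℕ →ᵇ E :=
  w - (seqRight (A * P) + seqLeft B) w - (seqRight P - seqMap B) (nemytskii r C hr w)

/-- The stable part of an orbit is read forward, `P w_{n+1} = A P w_n + P r(w_n)`, and the unstable
part backward, `(1 - P) w_n = B (w_{n+1} - r(w_n))`. Here `B` inverts `A` on the unstable space. The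
sum of the two relations is the equation encoded by `orbitMap`, and applying `P` and `A` to it
separates them again. -/
theorem orbitMap_eq_single_iff {A P B : E →L[ℝ] E} (hP : P * P = P) (hPA : Commute P A)
    (hBA : B * A = 1 - P) (hAB : A * B = 1 - P) (hPB : P * B = 0) {w : ℕ →ᵇ E} {a : E}
    (ha : P a = a) :
    orbitMap A P B r C hr w = seqSingle a ↔
      P (w 0) = a ∧ ∀ n, w (n + 1) = A (w n) + r (w n) := by
  have hP' : ∀ v, P (P v) = P v := fun v => congrArg (fun T : E →L[ℝ] E => T v) hP
  have hPA' : ∀ v, P (A v) = A (P v) := fun v => congrArg (fun T : E →L[ℝ] E => T v) hPA.eq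
  have hBA' : ∀ v, B (A v) = v - P v := fun v => congrArg (fun T : E →L[ℝ] E => T v) hBA
  have hAB' : ∀ v, A (B v) = v - P v := fun v => congrArg (fun T : E →L[ℝ] E => T v) hAB
  have hPB' : ∀ v, P (B v) = 0 := fun v => congrArg (fun T : E →L[ℝ] E => T v) hPB
  have h0 : orbitMap A P B r C hr w 0 = w 0 - B (w 1) + B (r (w 0)) := by
    simp [orbitMap, seqRight, seqLeft, seqMap, nemytskii]
  have h1 : ∀ n, orbitMap A P B r C hr w (n + 1)
      = w (n + 1) - (A (P (w n)) + B (w (n + 2))) - (P (r (w n)) - B (r (w (n + 1)))) := by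
    intro n
    simp [orbitMap, seqRight, seqLeft, seqMap, nemytskii]
  constructor
  · intro h
    have e0 : w 0 - B (w 1) + B (r (w 0)) = a := by rw [← h0, h]; rfl
    have e1 : ∀ n, w (n + 1) - (A (P (w n)) + B (w (n + 2)))
        - (P (r (w n)) - B (r (w (n + 1)))) = 0 := by
      intro n; rw [← h1, h]; rfl
    have p0 : P (w 0) = a := by
      have := congrArg P e0
      simpa [hPB', ha] using this
    have p1 : ∀ n, P (w (n + 1)) = P (A (w n) + r (w n)) := by
      intro n
      have := congrArg P (e1 n)
      rw [map_add P, hPA']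
      simpa [hPB', hP', hPA', sub_sub, sub_eq_zero] using this
    have q1 : ∀ n, w (n + 1) - P (w (n + 1)) = A (w n) + r (w n) - P (A (w n) + r (w n)) := by
      -- The unstable relation from index `n` to `n + 1` sits in the entry of index `n`, so the
      -- first one comes from `e0` and the others from `e1`.
      intro n
      rcases n with _ | n
      · have := congrArg A e0
        rw [← p0] at this
        simp only [map_add, map_sub, hAB', hPA'] at this ⊢
        rw [← sub_eq_zero] at this ⊢
        rw [← neg_eq_zero, ← this]
        simp only [zero_add]
        abel
      · have := congrArg A (e1 n)
        simp only [map_add, map_sub, hAB', map_zero] at this ⊢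
        have h2 := congrArg A (p1 n)
        simp only [map_add, hPA'] at h2 ⊢
        linear_combination (norm := module) h2 - this
    exact ⟨p0, fun n => by
      have := congrArg₂ (· + ·) (p1 n) (q1 n)
      simpa using this⟩
  · rintro ⟨p0, hw⟩
    ext n
    rcases n with _ | n
    · rw [h0, hw 0, map_add B, hBA', p0]
      simp only [seqSingle, seqCLM_apply, if_true]
      abel
    · rw [h1, hw (n + 1), map_add B, hBA', hw n]
      simp only [map_add P, hPA', seqSingle, seqCLM_apply, Nat.succ_ne_zero, if_false]
      abel


variable [CompleteSpace E]

theorem isUnit_id_sub {T : (ℕ →ᵇ E) →L[ℝ] (ℕ →ᵇ E)} (hT : ‖T‖ < 1) :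
    ∃ L : (ℕ →ᵇ E) ≃L[ℝ] (ℕ →ᵇ E), (L : (ℕ →ᵇ E) →L[ℝ] (ℕ →ᵇ E)) = 1 - T :=
  ⟨ContinuousLinearEquiv.unitsEquiv ℝ _ (Units.oneSub T hT), by ext; simp⟩

/-- The stable manifold theorem at a hyperbolic fixed point, in terms of orbits. -/
theorem exists_stable_orbits [ProperSpace E] {A P B : E →L[ℝ] E} (hP : P * P = P) (hPA : Commute P A)
    (hBA : B * A = 1 - P) (hAB : A * B = 1 - P) (hPB : P * B = 0) (hA : ‖A * P‖ ≤ 1 / 4)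
    (hB : ‖B‖ ≤ 1 / 4) {F : E → E} (hF0 : F 0 = 0) (hF : ContDiffAt ℝ 1 F 0)
    (hFA : HasFDerivAt F A 0) :
    ∃ (W : LinearMap.range P.toLinearMap → (ℕ →ᵇ E)) (ρ δ C : ℝ), 0 < ρ ∧ 0 < δ ∧ W 0 = 0 ∧
      (∀ a ∈ Metric.ball 0 ρ, ContDiffAt ℝ 1 W a ∧ P (W a 0) = a ∧ ∀ n, W a (n + 1) = F (W a n)) ∧
      ∀ z : ℕ → E, (∀ n, ‖z n‖ ≤ δ) → (∀ n, z (n + 1) = F (z n)) →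
        (⟨P (z 0), z 0, rfl⟩ : LinearMap.range P.toLinearMap) ∈ Metric.ball 0 ρ ∧
        z 0 = W ⟨P (z 0), z 0, rfl⟩ 0 ∧ ∀ n, ‖z n‖ ≤ C * (1 / 2) ^ n := by
  -- the nonlinear part, cut off outside of a small ball
  obtain ⟨R, hR, hFR⟩ : ∃ R > 0, ∀ v ∈ Metric.closedBall (0 : E) R, ContDiffAt ℝ 1 F v := by
    obtain ⟨R, hR, h⟩ := Metric.eventually_nhds_iff_ball.1 (hF.eventually (by simp))
    exact ⟨R / 2, by positivity, fun v hv => h v (Metric.closedBall_subset_ball (by linarith) hv)⟩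
  have hK : IsCompact (Metric.closedBall (0 : E) R) := isCompact_closedBall _ _
  classical
  let r : E → E := fun v => if v ∈ Metric.closedBall (0 : E) R then F v - A v else 0
  let D : E → E →L[ℝ] E := fun v => if v ∈ Metric.closedBall (0 : E) R then fderiv ℝ F v - A else 0
  have hDc : ContinuousOn (fun v => fderiv ℝ F v - A) (Metric.closedBall (0 : E) R) := by
    intro v hv
    exact (((hFR v hv).continuousAt_fderiv (by simp)).sub continuousAt_const).continuousWithinAt
  obtain ⟨C, hC⟩ : ∃ C, ∀ v, ‖r v‖ ≤ C := by
    obtain ⟨C, hC⟩ := hK.exists_bound_of_continuousOn (f := fun v => F v - A v)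
      fun v hv => ((hFR v hv).continuousAt.sub A.continuous.continuousAt).continuousWithinAt
    refine ⟨max C 0, fun v => ?_⟩
    by_cases hv : v ∈ Metric.closedBall (0 : E) R
    · simp only [r, if_pos hv]; exact (hC v hv).trans (le_max_left _ _)
    · simp only [r, if_neg hv, norm_zero]; exact le_max_right _ _
  obtain ⟨C', hC'⟩ : ∃ C, ∀ v, ‖D v‖ ≤ C := by
    obtain ⟨C, hC⟩ := hK.exists_bound_of_continuousOn hDc
    refine ⟨max C 0, fun v => ?_⟩
    by_cases hv : v ∈ Metric.closedBall (0 : E) R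
    · simp only [D, if_pos hv]; exact (hC v hv).trans (le_max_left _ _)
    · simp only [D, if_neg hv, norm_zero]; exact le_max_right _ _
  have hr : ∀ v ∈ Metric.ball (0 : E) R, HasFDerivAt r (D v) v := by
    intro v hv
    have h1 : HasFDerivAt (fun v => F v - A v) (fderiv ℝ F v - A) v :=
      ((hFR v (Metric.ball_subset_closedBall hv)).differentiableAt (by simp)).hasFDerivAt.sub
        A.hasFDerivAt
    have h2 : D v = fderiv ℝ F v - A := if_pos (Metric.ball_subset_closedBall hv)
    rw [h2]
    refine h1.congr_of_eventuallyEq ?_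
    filter_upwards [Metric.isOpen_ball.mem_nhds hv] with x hx
    exact if_pos (Metric.ball_subset_closedBall hx)
  have hDu : UniformContinuousOn D (Metric.ball 0 R) := by
    have h1 := (hK.uniformContinuousOn_of_continuous hDc).mono
      (Metric.ball_subset_closedBall (x := (0 : E)) (ε := R))
    refine h1.congr fun v hv => ?_
    exact (if_pos (Metric.ball_subset_closedBall hv)).symm
  have hD0 : D 0 = 0 := by
    have : D 0 = fderiv ℝ F 0 - A := if_pos (by simpa using hR.le)
    rw [this, hFA.fderiv, sub_self]
  have hr0 : r 0 = 0 := by simp [r, hF0]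
  have hAr : ∀ v ∈ Metric.closedBall (0 : E) R, A v + r v = F v := by
    intro v hv; simp only [r, if_pos hv]; abel
  -- the inverse function theorem
  let Φ := orbitMap A P B r C hC
  let T : (ℕ →ᵇ E) →L[ℝ] (ℕ →ᵇ E) := seqRight (A * P) + seqLeft B
  -- Both shift operators have norm at most `1 / 4`, so the derivative `1 - T` of `Φ` at `0` is
  -- invertible by a Neumann series.
  have hT : ‖T‖ < 1 := by
    refine (norm_add_le _ _).trans_lt ?_
    have h1 : ‖seqRight (A * P)‖ ≤ ‖A * P‖ := norm_seqCLM_le (norm_nonneg _)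
    have h2 : ‖seqLeft B‖ ≤ ‖B‖ := norm_seqCLM_le (norm_nonneg _)
    linarith
  obtain ⟨L, hL⟩ := isUnit_id_sub hT
  have hΦ0 : Φ 0 = 0 := by
    have : nemytskii r C hC 0 = 0 := by ext n; exact hr0
    simp [Φ, orbitMap, this]
  have hΦ : ContDiffAt ℝ 1 Φ 0 := by
    have h1 := contDiffAt_nemytskii (hr := hC) hR hr hDu hC'
    exact (contDiffAt_id.sub T.contDiff.contDiffAt).sub
      ((seqRight P - seqMap B).contDiff.contDiffAt.comp (0 : ℕ →ᵇ E) h1)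
  have hΦ' : HasFDerivAt Φ (L : (ℕ →ᵇ E) →L[ℝ] (ℕ →ᵇ E)) 0 := by
    have h1 := hasFDerivAt_nemytskii (hr := hC) (hD := hC') hr hDu (w := 0) (by simpa using hR)
    have h2 : nemytskiiDeriv D C' hC' (0 : ℕ →ᵇ E) = 0 := by
      ext v n
      show D 0 (v n) = 0
      rw [hD0]; rfl
    rw [h2] at h1
    have h3 := ((hasFDerivAt_id (𝕜 := ℝ) (0 : ℕ →ᵇ E)).sub T.hasFDerivAt).sub
      ((seqRight P - seqMap B).hasFDerivAt.comp (0 : ℕ →ᵇ E) h1)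
    rw [hL]
    convert! h3 using 1
    simp; rfl
  let e := hΦ.toOpenPartialHomeomorph Φ hΦ' (by simp)
  have heΦ : ∀ w, e w = Φ w := fun w => rfl
  have he0 : (0 : ℕ →ᵇ E) ∈ e.source := hΦ.mem_toOpenPartialHomeomorph_source hΦ' (by simp)
  have ht0 : (0 : ℕ →ᵇ E) ∈ e.target := by
    have := hΦ.image_mem_toOpenPartialHomeomorph_target hΦ' (by simp)
    rwa [hΦ0] at this
  have hes0 : e.symm 0 = 0 := by
    have := e.left_inv he0
    rwa [heΦ, hΦ0] at this
  have hesC : ContDiffAt ℝ 1 e.symm 0 := by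
    have := hΦ.to_localInverse hΦ' (by simp)
    rw [hΦ0] at this
    exact this
  obtain ⟨K, t, ht, hKt⟩ := hesC.exists_lipschitzOnWith
  let ι : LinearMap.range P.toLinearMap →L[ℝ] (ℕ →ᵇ E) :=
    seqSingle.comp (LinearMap.range P.toLinearMap).subtypeL
  let W : LinearMap.range P.toLinearMap → (ℕ →ᵇ E) := fun a => e.symm (ι a)
  have hW0 : W 0 = 0 := by simp [W, hes0]
  have hι0 : Tendsto ι (𝓝 0) (𝓝 0) := by simpa using ι.continuous.tendsto 0
  have hWc : ContinuousAt W 0 := by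
    refine ContinuousAt.comp (g := e.symm) ?_ ι.continuous.continuousAt
    rw [map_zero]; exact hesC.continuousAt
  obtain ⟨ρ, hρ, hρW⟩ : ∃ ρ > 0, ∀ a ∈ Metric.ball (0 : LinearMap.range P.toLinearMap) ρ,
      ContDiffAt ℝ 1 e.symm (ι a) ∧ ι a ∈ e.target ∧ ‖W a‖ < R := by
    refine Metric.eventually_nhds_iff_ball.1 ?_
    refine (hι0.eventually (hesC.eventually (by simp))).and
      ((hι0.eventually (e.open_target.mem_nhds ht0)).and ?_)
    have : Tendsto W (𝓝 0) (𝓝 0) := by simpa [ContinuousAt, hW0] using hWc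
    simpa using this.eventually (Metric.ball_mem_nhds _ hR)
  have hPr : ∀ a : LinearMap.range P.toLinearMap, P (a : E) = a := by
    rintro ⟨_, v, rfl⟩
    exact congrArg (fun T : E →L[ℝ] E => T v) hP
  have hPc : Continuous fun v : E => (⟨P v, v, rfl⟩ : LinearMap.range P.toLinearMap) :=
    P.continuous.subtype_mk _
  -- small orbits
  have hε : (0 : ℝ) < 1 / (4 * (K + 1) * (‖P‖ + 1)) := by positivity
  -- The constant is chosen so that `‖z‖ ≤ K * ‖P z‖` implies `‖P (r z)‖ ≤ ‖P z‖ / 4`.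
  have hrsmall : ∀ᶠ v in 𝓝 (0 : E), ‖r v‖ ≤ 1 / (4 * (K + 1) * (‖P‖ + 1)) * ‖v‖ := by
    have h1 := hr 0 (Metric.mem_ball_self hR)
    rw [hD0] at h1
    have h2 := Asymptotics.isLittleO_iff.1 h1.isLittleO hε
    simpa [hr0] using h2
  have hP0' : Tendsto (fun v : E => (⟨P v, v, rfl⟩ : LinearMap.range P.toLinearMap)) (𝓝 0) (𝓝 0) := by
    have h0 : (⟨P 0, 0, rfl⟩ : LinearMap.range P.toLinearMap) = 0 := Subtype.ext (map_zero P)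
    rw [← h0]
    exact hPc.tendsto 0
  obtain ⟨δ₁, hδ₁, hδ₁'⟩ := Metric.eventually_nhds_iff_ball.1 (hrsmall.and
    ((hP0'.eventually (Metric.ball_mem_nhds _ hρ)).and ((hι0.comp hP0').eventually ht)))
  obtain ⟨δ₂, hδ₂, hδ₂'⟩ := Metric.mem_nhds_iff.1 (e.open_source.mem_nhds he0)
  let δ := min R (min δ₁ δ₂) / 2
  have hδ : 0 < δ := by positivity
  have hδR : δ < R := (half_lt_self (by positivity)).trans_le (min_le_left _ _)
  have hδ1 : δ < δ₁ := (half_lt_self (by positivity)).trans_le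
    ((min_le_right _ _).trans (min_le_left _ _))
  have hδ2 : δ < δ₂ := (half_lt_self (by positivity)).trans_le
    ((min_le_right _ _).trans (min_le_right _ _))
  have hmain : ∀ z : ℕ → E, (hz : ∀ n, ‖z n‖ ≤ δ) → (∀ n, z (n + 1) = F (z n)) →
      W ⟨P (z 0), z 0, rfl⟩ = ofNormedAddCommGroupDiscrete z δ hz := by
    intro z hz hzF
    set w := ofNormedAddCommGroupDiscrete z δ hz with hw
    have hws : w ∈ e.source := by
      apply hδ₂'
      rw [mem_ball_zero_iff]
      exact ((norm_le hδ.le).2 hz).trans_lt hδ2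
    have h1 : Φ w = seqSingle (P (z 0)) := by
      refine (orbitMap_eq_single_iff hP hPA hBA hAB hPB (hPr ⟨P (z 0), z 0, rfl⟩)).2 ⟨rfl, fun n => ?_⟩
      rw [hAr]
      · exact hzF n
      · rw [mem_closedBall_zero_iff]; exact (hz n).trans hδR.le
    show e.symm (seqSingle (P (z 0))) = w
    rw [← h1, ← heΦ, e.left_inv hws]
  -- A small orbit is the local inverse of `Φ` at the sequence supported at `0` with value `P (z
  -- 0)`, and that inverse is `K`-Lipschitz near `0`.
  have hbd : ∀ z : ℕ → E, (∀ n, ‖z n‖ ≤ δ) → (∀ n, z (n + 1) = F (z n)) →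
      ‖z 0‖ ≤ K * ‖P (z 0)‖ := by
    intro z hz hzF
    have h1 := (hδ₁' (z 0) (by rw [mem_ball_zero_iff]; exact (hz 0).trans_lt hδ1)).2.2
    have h2 := hKt.norm_sub_le h1 (mem_of_mem_nhds ht)
    have h3 := hmain z hz hzF
    have h4 : ‖z 0‖ ≤ ‖W ⟨P (z 0), z 0, rfl⟩‖ := by
      rw [h3]; exact (ofNormedAddCommGroupDiscrete z δ hz).norm_coe_le_norm 0
    refine h4.trans ?_
    rw [hes0, sub_zero, sub_zero] at h2
    refine h2.trans (mul_le_mul_of_nonneg_left ?_ K.coe_nonneg)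
    refine (norm_le (norm_nonneg _)).2 fun n => ?_
    show ‖if n = 0 then P (z 0) else 0‖ ≤ _
    split_ifs <;> simp
  refine ⟨W, ρ, δ, K * (‖P‖ * δ), hρ, hδ, hW0, ?_, ?_⟩
  · intro a ha
    obtain ⟨h1, h2, h3⟩ := hρW a ha
    have h4 : Φ (W a) = seqSingle (a : E) := by
      rw [← heΦ]; exact e.right_inv h2
    obtain ⟨h5, h6⟩ := (orbitMap_eq_single_iff hP hPA hBA hAB hPB (hPr a)).1 h4
    refine ⟨h1.comp a ι.contDiff.contDiffAt, h5, fun n => ?_⟩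
    rw [h6, hAr]
    rw [mem_closedBall_zero_iff]
    exact ((W a).norm_coe_le_norm n).trans h3.le
  · intro z hz hzF
    refine ⟨(hδ₁' (z 0) (by rw [mem_ball_zero_iff]; exact (hz 0).trans_lt hδ1)).2.1, ?_, ?_⟩
    · rw [hmain z hz hzF]; rfl
    -- Every tail of a small orbit is again a small orbit.
    · have hk : ∀ k, ‖z k‖ ≤ K * ‖P (z k)‖ := fun k =>
        hbd (fun n => z (k + n)) (fun n => hz _) (fun n => hzF _)
      -- The rate `1 / 2` is `1 / 4` from the linear part `A * P` plus `1 / 4` from the remainder.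
      have hPk : ∀ k, ‖P (z k)‖ ≤ ‖P‖ * δ * (1 / 2) ^ k := by
        intro k
        induction k with
        | zero => simpa using P.le_opNorm_of_le (hz 0)
        | succ k ih =>
          have h1 : P (z (k + 1)) = (A * P) (P (z k)) + P (r (z k)) := by
            rw [hzF, ← hAr _ (by rw [mem_closedBall_zero_iff]; exact (hz k).trans hδR.le), map_add]
            congr 1
            show P (A (z k)) = A (P (P (z k)))
            rw [hPr ⟨P (z k), z k, rfl⟩]
            exact congrArg (fun T : E →L[ℝ] E => T (z k)) hPA.eq
          have h2 := (hδ₁' (z k) (by rw [mem_ball_zero_iff]; exact (hz k).trans_lt hδ1)).1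
          have h3 : ‖P (r (z k))‖ ≤ 1 / 4 * ‖P (z k)‖ := by
            refine (P.le_opNorm _).trans ((mul_le_mul_of_nonneg_left
              (h2.trans (mul_le_mul_of_nonneg_left (hk k) hε.le)) (norm_nonneg _)).trans ?_)
            have h5 : ‖P‖ * (1 / (4 * (K + 1) * (‖P‖ + 1)) * K) ≤ 1 / 4 := by
              have h6 : ‖P‖ * (1 / (4 * (K + 1) * (‖P‖ + 1)) * K)
                = (‖P‖ * K) / (4 * ((K + 1) * (‖P‖ + 1))) := by ring
              rw [h6, div_le_div_iff₀ (by positivity) (by positivity)]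
              have := K.coe_nonneg
              nlinarith [norm_nonneg P]
            calc _ = ‖P‖ * (1 / (4 * (K + 1) * (‖P‖ + 1)) * K) * ‖P (z k)‖ := by ring
              _ ≤ _ := mul_le_mul_of_nonneg_right h5 (norm_nonneg _)
          have h4 : ‖(A * P) (P (z k))‖ ≤ 1 / 4 * ‖P (z k)‖ :=
            ((A * P).le_opNorm _).trans (mul_le_mul_of_nonneg_right hA (norm_nonneg _))
          rw [h1, pow_succ]
          refine (norm_add_le _ _).trans ?_
          linarith
      intro k
      refine (hk k).trans ((mul_le_mul_of_nonneg_left (hPk k) K.coe_nonneg).trans_eq ?_)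
      ring

end
end
end StableDistortion

/-! ### Determinants under bi-Lipschitz conjugacy -/

namespace StableDistortion
noncomputable section

open MeasureTheory in
/-- If `h` is locally bi-Lipschitz and conjugates `u` near `a` to `u` near `h a`, then the Jacobian
determinants of `u` at `a` and `h a` are comparable, with a constant that depends only on the
Lipschitz constants. -/
theorem abs_det_le_of_conj {E : Type*} [NormedAddCommGroup E] [NormedSpace ℝ E]
    [FiniteDimensional ℝ E] {u h g : E → E} {A B : E →L[ℝ] E} {a : E}
    (hA : HasStrictFDerivAt u A a) (hB : HasStrictFDerivAt u B (h a)) (hc : ContinuousAt h a)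
    {K : NNReal} (hgh : ∀ᶠ x in 𝓝 a, g (h x) = x)
    {s : Set E} (hs : s ∈ 𝓝 (h a)) (hg : LipschitzOnWith K g s)
    {t : Set E} (ht : t ∈ 𝓝 (u a)) (hh : LipschitzOnWith K h t)
    (hu : ∀ᶠ x in 𝓝 a, h (u x) = u (h x)) :
    |B.det| ≤ (K : ℝ) ^ (2 * Module.finrank ℝ E) * |A.det| := by
  let _ : MeasurableSpace E := borel E
  have : BorelSpace E := ⟨rfl⟩
  set d := Module.finrank ℝ E with hd
  -- Hausdorff measure in the full dimension is a Haar measure, so determinants scale it, and a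
  -- `K`-Lipschitz map multiplies it by at most `K ^ d`.
  set μ : Measure E := Measure.hausdorffMeasure (d : ℝ) with hμ
  have : μ.IsAddHaarMeasure := isAddHaarMeasure_hausdorffMeasure
  by_contra! hlt
  obtain ⟨m₁, hm₁, hm₁'⟩ : ∃ m₁ : NNReal, |A.det| < m₁ ∧ (K : ℝ) ^ (2 * d) * m₁ < |B.det| := by
    have h1 : Tendsto (fun x : ℝ => (K : ℝ) ^ (2 * d) * x) (𝓝[>] |A.det|)
        (𝓝 ((K : ℝ) ^ (2 * d) * |A.det|)) :=
      ((continuous_const.mul continuous_id).tendsto _).mono_left nhdsWithin_le_nhds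
    obtain ⟨x, hx, hx'⟩ := ((h1.eventually_lt_const hlt).and self_mem_nhdsWithin).exists
    have hx0 : 0 ≤ x := (abs_nonneg _).trans (le_of_lt hx')
    exact ⟨⟨x, hx0⟩, hx', hx⟩
  obtain ⟨m₂, hm₂, hm₂'⟩ := exists_between hm₁'
  have hm₂0 : 0 ≤ m₂ := (by positivity : (0 : ℝ) ≤ (K : ℝ) ^ (2 * d) * m₁).trans hm₂.le
  lift m₂ to NNReal using hm₂0
  obtain ⟨δ₁, h₁, hδ₁⟩ := ((addHaar_image_le_mul_of_det_lt μ A (m := m₁)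
    ((ENNReal.ofReal_lt_coe_iff (abs_nonneg _)).2 hm₁)).and self_mem_nhdsWithin).exists
  obtain ⟨δ₂, h₂, hδ₂⟩ := ((mul_le_addHaar_image_of_lt_det μ B (m := m₂)
    (by
      rw [← ENNReal.ofReal_coe_nnreal]
      exact (ENNReal.ofReal_lt_ofReal_iff_of_nonneg m₂.coe_nonneg).2 hm₂')).and
      self_mem_nhdsWithin).exists
  obtain ⟨s₁, hs₁, hs₁'⟩ := hA.approximates_deriv_on_nhds (Or.inr hδ₁)
  obtain ⟨s₂, hs₂, hs₂'⟩ := hB.approximates_deriv_on_nhds (Or.inr hδ₂)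
  obtain ⟨ε, hε, hball⟩ := Metric.eventually_nhds_iff_ball.1 ((hgh.and hu).and
    ((hc.eventually (inter_mem hs hs₂)).and ((hA.continuousAt.eventually ht).and hs₁)))
  set S := Metric.ball a ε
  have hd0 : (0 : ℝ) ≤ d := Nat.cast_nonneg _
  -- The size of `S` depends on `u`, but the factors `K ^ d`, lost once through `g` and once through
  -- `h`, do not.
  have e1 : μ S ≤ (K : ENNReal) ^ d * μ (h '' S) := by
    have : S = g '' (h '' S) := by
      rw [image_image]
      conv_lhs => rw [← image_id S]
      exact image_congr fun x hx => ((hball x hx).1.1).symm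
    conv_lhs => rw [this]
    have hsub : h '' S ⊆ s := by rintro _ ⟨x, hx, rfl⟩; exact (hball x hx).2.1.1
    have := (hg.mono hsub).hausdorffMeasure_image_le hd0
    rwa [ENNReal.rpow_natCast] at this
  have e2 : (m₂ : ENNReal) * μ (h '' S) ≤ μ (u '' (h '' S)) := by
    refine h₂ _ _ (hs₂'.mono_set ?_)
    rintro _ ⟨x, hx, rfl⟩; exact (hball x hx).2.1.2
  have e3 : u '' (h '' S) = h '' (u '' S) := by
    rw [image_image, image_image]
    exact image_congr fun x hx => ((hball x hx).1.2).symm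
  have e4 : μ (h '' (u '' S)) ≤ (K : ENNReal) ^ d * μ (u '' S) := by
    have hsub : u '' S ⊆ t := by rintro _ ⟨x, hx, rfl⟩; exact (hball x hx).2.2.1
    have := (hh.mono hsub).hausdorffMeasure_image_le hd0
    rwa [ENNReal.rpow_natCast] at this
  have e5 : μ (u '' S) ≤ m₁ * μ S :=
    h₁ _ _ (hs₁'.mono_set fun x hx => (hball x hx).2.2.2)
  have hS0 : μ S ≠ 0 := (Metric.measure_ball_pos μ a hε).ne'
  have hStop : μ S ≠ ⊤ := measure_ball_lt_top.ne
  have e6 : (m₂ : ENNReal) * μ S ≤ ((K : ENNReal) ^ (2 * d) * m₁) * μ S := by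
    calc (m₂ : ENNReal) * μ S ≤ m₂ * ((K : ENNReal) ^ d * μ (h '' S)) := by gcongr
      _ = (K : ENNReal) ^ d * (m₂ * μ (h '' S)) := by ring
      _ ≤ (K : ENNReal) ^ d * ((K : ENNReal) ^ d * (m₁ * μ S)) := by
        refine mul_le_mul_right (e2.trans ?_) _
        rw [e3]
        exact e4.trans (mul_le_mul_right e5 _)
      _ = _ := by ring
  have e7 := (ENNReal.mul_le_mul_iff_left hS0 hStop).1 e6
  have e8 : m₂ ≤ K ^ (2 * d) * m₁ := by exact_mod_cast e7
  have e9 : (m₂ : ℝ) ≤ (K : ℝ) ^ (2 * d) * m₁ := by exact_mod_cast e8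
  linarith

/-! ### Jacobians of linear maps between inner product spaces -/

section Jacobian

variable {U V W : Type*} [NormedAddCommGroup U] [InnerProductSpace ℝ U] [FiniteDimensional ℝ U]
  [NormedAddCommGroup V] [InnerProductSpace ℝ V] [FiniteDimensional ℝ V]
  [NormedAddCommGroup W] [InnerProductSpace ℝ W] [FiniteDimensional ℝ W]

/-- An orthonormal eigenbasis of `A* A` has eigenvalues `‖A b_i‖ ^ 2`, the squared singular values.
-/
theorem exists_norm_jacobian_eq (A : V →ₗ[ℝ] W) : ∃ b : Fin (Module.finrank ℝ V) → V,
    (∀ i, ‖b i‖ = 1) ∧ LinearMap.det (LinearMap.adjoint A ∘ₗ A) = (∏ i, ‖A (b i)‖) ^ 2 := by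
  have hT : (LinearMap.adjoint A ∘ₗ A).IsSymmetric := fun x y => by
    simp [LinearMap.adjoint_inner_left, LinearMap.adjoint_inner_right]
  refine ⟨hT.eigenvectorBasis rfl, (hT.eigenvectorBasis rfl).orthonormal.1, ?_⟩
  have hev : ∀ i, hT.eigenvalues rfl i = ‖A (hT.eigenvectorBasis rfl i)‖ ^ 2 := by
    intro i
    have h1 := hT.apply_eigenvectorBasis rfl i
    have h2 : inner ℝ ((LinearMap.adjoint A ∘ₗ A) (hT.eigenvectorBasis rfl i))
        (hT.eigenvectorBasis rfl i) = ‖A (hT.eigenvectorBasis rfl i)‖ ^ 2 := by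
      rw [LinearMap.comp_apply, LinearMap.adjoint_inner_left, real_inner_self_eq_norm_sq]
    rw [← h2, h1]
    simp [inner_smul_left]
  rw [hT.det_eq_prod_eigenvalues rfl, ← Finset.prod_pow]
  exact Finset.prod_congr rfl fun i _ => by simp [hev]

theorem det_adjoint_comp_self_nonneg (A : V →ₗ[ℝ] W) :
    0 ≤ LinearMap.det (LinearMap.adjoint A ∘ₗ A) := by
  obtain ⟨b, -, h⟩ := exists_norm_jacobian_eq A
  rw [h]; positivity

theorem det_adjoint_eq (L : V →ₗ[ℝ] V) : LinearMap.det (LinearMap.adjoint L) = LinearMap.det L := by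
  let b := stdOrthonormalBasis ℝ V
  rw [← LinearMap.det_toMatrix b.toBasis, ← LinearMap.det_toMatrix b.toBasis,
    LinearMap.toMatrix_adjoint, Matrix.det_conjTranspose]
  simp

theorem jacobian_mem_Icc {A : V →ₗ[ℝ] W} {c C : ℝ} (hc : 0 ≤ c)
    (h : ∀ v, c * ‖v‖ ≤ ‖A v‖ ∧ ‖A v‖ ≤ C * ‖v‖) :
    jacobian A ∈ Icc (c ^ Module.finrank ℝ V) (C ^ Module.finrank ℝ V) := by
  obtain ⟨b, hb, hdet⟩ := exists_norm_jacobian_eq A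
  have hj : jacobian A = ∏ i, ‖A (b i)‖ := by
    rw [jacobian, hdet, Real.sqrt_sq]
    exact Finset.prod_nonneg fun _ _ => norm_nonneg _
  rw [hj]
  constructor
  · calc c ^ Module.finrank ℝ V = ∏ _i : Fin (Module.finrank ℝ V), c := by simp
      _ ≤ _ := Finset.prod_le_prod (fun _ _ => hc) fun i _ => by
        simpa [hb] using (h (b i)).1
  · calc _ ≤ ∏ _i : Fin (Module.finrank ℝ V), C :=
        Finset.prod_le_prod (fun _ _ => norm_nonneg _) fun i _ => by
          simpa [hb] using (h (b i)).2
      _ = _ := by simp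

/-- An isometry from the range of `A` onto `U` turns `A` into an endomorphism and leaves the
Jacobians unchanged; multiplicativity of determinants then applies. -/
theorem jacobian_comp {A : U →ₗ[ℝ] V} (hA : Function.Injective A) {S : Submodule ℝ V}
    (hS : LinearMap.range A = S) (B : V →ₗ[ℝ] W) :
    jacobian (B ∘ₗ A) = jacobian (B.domRestrict S) * jacobian A := by
  subst hS
  set S := LinearMap.range A
  let A0 : U →ₗ[ℝ] S := A.rangeRestrict
  have hfr : Module.finrank ℝ S = Module.finrank ℝ U := LinearMap.finrank_range_of_inj hA
  let e : S ≃ₗᵢ[ℝ] U := (stdOrthonormalBasis ℝ S).equiv (stdOrthonormalBasis ℝ U) (finCongr hfr)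
  let X : U →ₗ[ℝ] U := e.toLinearEquiv.toLinearMap ∘ₗ A0
  let Bs := B.domRestrict S
  have h1 : LinearMap.adjoint A ∘ₗ A = LinearMap.adjoint X ∘ₗ X := by
    refine LinearMap.ext fun x => ext_inner_right ℝ fun y => ?_
    simp only [LinearMap.comp_apply, LinearMap.adjoint_inner_left]
    show _ = inner ℝ (e (A0 x)) (e (A0 y))
    rw [e.inner_map_map]; rfl
  have h2 : LinearMap.adjoint (B ∘ₗ A) ∘ₗ (B ∘ₗ A) = LinearMap.adjoint X ∘ₗ
      ((e.toLinearEquiv.toLinearMap ∘ₗ (LinearMap.adjoint Bs ∘ₗ Bs) ∘ₗ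
        e.toLinearEquiv.symm.toLinearMap) ∘ₗ X) := by
    refine LinearMap.ext fun x => ext_inner_right ℝ fun y => ?_
    simp only [LinearMap.comp_apply, LinearMap.adjoint_inner_left]
    show _ = inner ℝ (e (LinearMap.adjoint Bs (Bs (e.symm (e (A0 x)))))) (e (A0 y))
    rw [e.inner_map_map, LinearMap.adjoint_inner_left, e.symm_apply_apply]; rfl
  have h3 : 0 ≤ LinearMap.det (LinearMap.adjoint Bs ∘ₗ Bs) :=
    det_adjoint_comp_self_nonneg Bs
  rw [jacobian, jacobian, jacobian, h1, h2, LinearMap.det_comp, LinearMap.det_comp,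
    LinearMap.det_conj, LinearMap.det_comp, ← Real.sqrt_mul h3]
  congr 1
  ring

theorem jacobian_comp_endo {L : U →ₗ[ℝ] U} (A : U →ₗ[ℝ] V) :
    jacobian (A ∘ₗ L) = jacobian A * |LinearMap.det L| := by
  have h1 : LinearMap.adjoint (A ∘ₗ L) ∘ₗ (A ∘ₗ L)
      = LinearMap.adjoint L ∘ₗ ((LinearMap.adjoint A ∘ₗ A) ∘ₗ L) := by
    rw [LinearMap.adjoint_comp]; rfl
  rw [jacobian, jacobian, h1, LinearMap.det_comp, LinearMap.det_comp, det_adjoint_eq,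
    ← Real.sqrt_sq_eq_abs, ← Real.sqrt_mul (det_adjoint_comp_self_nonneg A)]
  congr 1
  ring

end Jacobian
end
end StableDistortion

/-! ### `C^1` maps for a continuous Riemannian metric -/

namespace StableDistortion
noncomputable section

section Riemannian

variable {E : Type*} [NormedAddCommGroup E] [NormedSpace ℝ E]
  {H : Type*} [TopologicalSpace H] {I : ModelWithCorners ℝ E H} [I.Boundaryless]
  {M : Type*}
  {E' : Type*} [NormedAddCommGroup E'] [NormedSpace ℝ E']
  {H' : Type*} [TopologicalSpace H'] {I' : ModelWithCorners ℝ E' H'} [I'.Boundaryless]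
  {M' : Type*}

section Deriv

variable [TopologicalSpace M] [ChartedSpace H M] [IsManifold I 1 M]
  [RiemannianBundle (fun x : M => TangentSpace I x)]
  [IsContinuousRiemannianBundle E (fun x : M => TangentSpace I x)]
  [TopologicalSpace M'] [ChartedSpace H' M'] [IsManifold I' 1 M']
  [RiemannianBundle (fun x : M' => TangentSpace I' x)]
  [IsContinuousRiemannianBundle E' (fun x : M' => TangentSpace I' x)]


omit [I.Boundaryless] in
-- The derivative of the chart is the trivialization of the tangent bundle, which is locally bounded
-- because the metric is continuous.
theorem eventually_norm_mfderiv_extChartAt_le (x : M) : ∃ C > 0, ∀ᶠ y in 𝓝 x,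
    ∀ v : TangentSpace I y, norm (E := E) (mfderiv I 𝓘(ℝ, E) (extChartAt I x) y v) ≤ C * ‖v‖ := by
  obtain ⟨C, hC, h⟩ := eventually_norm_trivializationAt_lt E (fun x : M => TangentSpace I x) x
  refine ⟨C, hC, ?_⟩
  filter_upwards [h, chart_source_mem_nhds H x] with y hy hy' v
  have e := TangentBundle.continuousLinearMapAt_trivializationAt (I := I) hy'
  have e' := congrArg (fun T : TangentSpace I y →L[ℝ] E => T v) e
  have h1 := (((trivializationAt E (fun x : M => TangentSpace I x) x).continuousLinearMapAt ℝ
    y).le_opNorm v).trans (mul_le_mul_of_nonneg_right hy.le (norm_nonneg _))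
  exact (congrArg (norm (E := E)) e').ge.trans h1

theorem eventually_norm_mfderiv_extChartAt_symm_le (x : M) : ∃ C > 0, ∀ᶠ y in 𝓝 x,
    ∀ v : E, norm (E := TangentSpace I y) (mfderiv 𝓘(ℝ, E) I (extChartAt I x).symm
      (extChartAt I x y) v) ≤ C * ‖v‖ := by
  obtain ⟨C, hC, h⟩ := eventually_norm_symmL_trivializationAt_lt E (fun x : M => TangentSpace I x) x
  refine ⟨C, hC, ?_⟩
  filter_upwards [h, chart_source_mem_nhds H x] with y hy hy' v
  have e := TangentBundle.symmL_trivializationAt (I := I) hy'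
  rw [I.range_eq_univ, mfderivWithin_univ] at e
  have e' := congrArg (fun T : E →L[ℝ] TangentSpace I y => T v) e
  have h1 := (((trivializationAt E (fun x : M => TangentSpace I x) x).symmL ℝ
    y).le_opNorm v).trans (mul_le_mul_of_nonneg_right hy.le (norm_nonneg _))
  exact (congrArg (norm (E := TangentSpace I y)) e').ge.trans h1

omit [I.Boundaryless] in
/-- A `C^1` map between Riemannian manifolds has a locally bounded derivative. -/
theorem eventually_norm_mfderiv_le [I.Boundaryless] {f : M → M'} {x : M} (hf : ContMDiffAt I I' 1 f x) :
    ∃ C > 0, ∀ᶠ y in 𝓝 x, ∀ v : TangentSpace I y, ‖mfderiv I I' f y v‖ ≤ C * ‖v‖ := by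
  obtain ⟨C₁, hC₁, h₁⟩ := eventually_norm_mfderiv_extChartAt_le (I := I) x
  obtain ⟨C₃, hC₃, h₃⟩ := eventually_norm_mfderiv_extChartAt_symm_le (I := I') (f x)
  have hF := (contMDiffAt_iff.1 hf).2
  rw [I.range_eq_univ, contDiffWithinAt_univ] at hF
  set F : E → E' := extChartAt I' (f x) ∘ f ∘ (extChartAt I x).symm with hFdef
  set C₂ := ‖fderiv ℝ F (extChartAt I x x)‖ + 1 with hC₂'
  have hC₂ : 0 < C₂ := by positivity
  have h₂ := (hF.continuousAt_fderiv (by simp)).norm.eventually_lt_const (lt_add_one _)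
  refine ⟨C₃ * (C₂ * C₁), by positivity, ?_⟩
  have hs : ∀ᶠ y in 𝓝 x, y ∈ (chartAt H x).source := chart_source_mem_nhds H x
  have ht : ∀ᶠ y in 𝓝 x, f y ∈ (chartAt H' (f x)).source :=
    hf.continuousAt.eventually (chart_source_mem_nhds H' (f x))
  filter_upwards [h₁, hf.continuousAt.eventually h₃,
    (continuousAt_extChartAt (I := I) x).eventually h₂,
    (continuousAt_extChartAt (I := I) x).eventually (hF.eventually (by simp)),
    hs.eventually_nhds, ht.eventually_nhds] with y h₁ h₃ h₂ hF hs ht v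
  have heq : f =ᶠ[𝓝 y] (extChartAt I' (f x)).symm ∘ F ∘ extChartAt I x := by
    filter_upwards [hs, ht] with z hz hz'
    simp only [hFdef, Function.comp_apply]
    rw [(extChartAt I x).left_inv (by simpa using hz),
      (extChartAt I' (f x)).left_inv (by simpa using hz')]
  have hs' := hs.self_of_nhds
  have ht' := ht.self_of_nhds
  have hFy : F (extChartAt I x y) = extChartAt I' (f x) (f y) := by
    simp only [hFdef, Function.comp_apply]
    rw [(extChartAt I x).left_inv (by simpa using hs')]
  have d1 : HasMFDerivAt I 𝓘(ℝ, E) (extChartAt I x) y _ :=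
    (mdifferentiableAt_extChartAt hs').hasMFDerivAt
  have d2 : HasMFDerivAt 𝓘(ℝ, E) 𝓘(ℝ, E') F (extChartAt I x y) (fderiv ℝ F (extChartAt I x y)) :=
    (hF.differentiableAt (by simp)).hasFDerivAt.hasMFDerivAt
  have d3 : MDifferentiableAt 𝓘(ℝ, E') I' (extChartAt I' (f x)).symm (F (extChartAt I x y)) := by
    have := mdifferentiableWithinAt_extChartAt_symm (I := I') (x := f x) (z := F (extChartAt I x y))
      (by rw [hFy]; exact (extChartAt I' (f x)).map_source (by simpa using ht'))
    rwa [I'.range_eq_univ, mdifferentiableWithinAt_univ] at this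
  have d4 := (d3.hasMFDerivAt.comp y (d2.comp y d1)).congr_of_eventuallyEq heq
  have e1 : (mfderiv I I' f y v : E') =
      mfderiv 𝓘(ℝ, E') I' (extChartAt I' (f x)).symm (extChartAt I' (f x) (f y))
      (fderiv ℝ F (extChartAt I x y) (mfderiv I 𝓘(ℝ, E) (extChartAt I x) y v)) := by
    rw [d4.mfderiv, ← hFy]
    rfl
  have e2 := (h₃ (fderiv ℝ F (extChartAt I x y) (mfderiv I 𝓘(ℝ, E) (extChartAt I x) y v)))
  refine ((congrArg (norm (E := TangentSpace I' (f y))) e1).trans_le e2).trans ?_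
  have e3 := (fderiv ℝ F (extChartAt I x y)).le_opNorm (mfderiv I 𝓘(ℝ, E) (extChartAt I x) y v)
  rw [mul_assoc, mul_assoc]
  refine mul_le_mul_of_nonneg_left (e3.trans ?_) hC₃.le
  exact mul_le_mul h₂.le (h₁ v) (norm_nonneg _) hC₂.le

end Deriv

section Lipschitz

variable [PseudoMetricSpace M] [ChartedSpace H M] [IsManifold I 1 M]
  [RiemannianBundle (fun x : M => TangentSpace I x)]
  [IsContinuousRiemannianBundle E (fun x : M => TangentSpace I x)]
  [IsRiemannianManifold I M]
  [PseudoMetricSpace M'] [ChartedSpace H' M'] [IsManifold I' 1 M']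
  [RiemannianBundle (fun x : M' => TangentSpace I' x)]
  [IsContinuousRiemannianBundle E' (fun x : M' => TangentSpace I' x)]
  [IsRiemannianManifold I' M']

/-- A `C^1` map between Riemannian manifolds is locally Lipschitz. -/
theorem exists_lipschitzOnWith_of_contMDiffAt {f : M → M'} {x : M} (hf : ContMDiffAt I I' 1 f x) :
    ∃ K : NNReal, ∃ s ∈ 𝓝 x, LipschitzOnWith K f s := by
  obtain ⟨C, hC, h⟩ := eventually_norm_mfderiv_le hf
  lift C to NNReal using hC.le
  obtain ⟨ρ, hρ, hball⟩ := Metric.eventually_nhds_iff_ball.1 (h.and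
    ((contMDiffAt_iff_contMDiffAt_nhds (by simp)).1 hf))
  -- Two points of the ball of radius `ρ / 3` are less than `2 * ρ / 3` apart, so a nearly shortest
  -- curve joining them stays within `ρ` of `x`, where the derivative bound holds.
  refine ⟨C, Metric.ball x (ρ / 3), Metric.ball_mem_nhds _ (by positivity), ?_⟩
  intro y hy z hz
  rw [Metric.mem_ball] at hy hz
  have hyz : edist y z < ENNReal.ofReal (2 * ρ / 3) := by
    rw [edist_dist, ENNReal.ofReal_lt_ofReal_iff (by positivity)]
    linarith [dist_triangle_right y z x]
  -- The distance need not be attained by a curve: the bound is proved for each `r` slightly above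
  -- it, and then `r` decreases to the distance.
  have key : ∀ r, edist y z < r → r ≤ ENNReal.ofReal (2 * ρ / 3) → edist (f y) (f z) ≤ C * r := by
    intro r hr hr'
    rw [IsRiemannianManifold.out (I := I) y z] at hr
    obtain ⟨γ, hγ0, hγ1, hγ, hlen, -, -⟩ :=
      exists_lt_locally_constant_of_riemannianEDist_lt hr zero_lt_one
    have hmem : ∀ t ∈ Icc (0 : ℝ) 1, γ t ∈ Metric.ball x ρ := by
      intro t ht
      have h1 : edist y (γ t) < ENNReal.ofReal (2 * ρ / 3) := by
        rw [IsRiemannianManifold.out (I := I) y (γ t)]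
        refine (riemannianEDist_le_pathELength (hγ.contMDiffOn (s := Icc 0 t)) hγ0 rfl ht.1).trans_lt ?_
        exact ((pathELength_mono le_rfl ht.2).trans_lt hlen).trans_le hr'
      rw [edist_dist, ENNReal.ofReal_lt_ofReal_iff (by positivity)] at h1
      rw [Metric.mem_ball]
      linarith [dist_triangle_left (γ t) x y]
    rw [IsRiemannianManifold.out (I := I') (f y) (f z)]
    have h2 : ContMDiffOn 𝓘(ℝ, ℝ) I' 1 (f ∘ γ) (Icc 0 1) := fun t ht =>
      (((hball _ (hmem t ht)).2).comp t (hγ t)).contMDiffWithinAt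
    refine (riemannianEDist_le_pathELength h2 (by simp [hγ0]) (by simp [hγ1]) zero_le_one).trans ?_
    refine le_trans ?_ (mul_le_mul_right hlen.le _)
    rw [pathELength_eq_lintegral_mfderiv_Icc, pathELength_eq_lintegral_mfderiv_Icc,
      ← MeasureTheory.lintegral_const_mul' _ _ ENNReal.coe_ne_top]
    refine MeasureTheory.setLIntegral_mono' measurableSet_Icc fun t ht => ?_
    have h3 : mfderiv 𝓘(ℝ, ℝ) I' (f ∘ γ) t (1 : ℝ)
        = mfderiv I I' f (γ t) (mfderiv 𝓘(ℝ, ℝ) I γ t (1 : ℝ)) := by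
      rw [mfderiv_comp t (((hball _ (hmem t ht)).2).mdifferentiableAt (by simp))
        (hγ.mdifferentiable (by simp) t)]
      rfl
    have h4 := (hball _ (hmem t ht)).1 (mfderiv 𝓘(ℝ, ℝ) I γ t (1 : ℝ))
    rw [← h3] at h4
    simp only [enorm, nnnorm]
    exact_mod_cast h4
  have h5 : Tendsto (fun r : ENNReal => (C : ENNReal) * r) (𝓝[>] edist y z) (𝓝 (C * edist y z)) :=
    ((ENNReal.continuous_const_mul ENNReal.coe_ne_top).tendsto _).mono_left nhdsWithin_le_nhds
  have : (𝓝[>] edist y z).NeBot := nhdsGT_neBot_of_exists_gt ⟨_, hyz⟩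
  refine ge_of_tendsto h5 ?_
  filter_upwards [self_mem_nhdsWithin, nhdsWithin_le_nhds (Iic_mem_nhds hyz)] with r hr hr'
  exact key r hr hr'

end Lipschitz
end Riemannian
end
end StableDistortion

/-! ### The local stable manifold of a hyperbolic periodic point -/

namespace StableDistortion
noncomputable section

section Conj

variable {m : ℕ} {M : Type*} [TopologicalSpace M] [ChartedSpace (EuclideanSpace ℝ (Fin m)) M]

/-- A self-map of `M` read in the chart at `p`, centered at `p`. -/
def chartConj (m : ℕ) {M : Type*} [TopologicalSpace M] [ChartedSpace (EuclideanSpace ℝ (Fin m)) M]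
    (p : M) (S : M → M) (v : EuclideanSpace ℝ (Fin m)) : EuclideanSpace ℝ (Fin m) :=
  extChartAt (𝓡 m) p (S ((extChartAt (𝓡 m) p).symm (extChartAt (𝓡 m) p p + v)))
    - extChartAt (𝓡 m) p p

theorem tendsto_chart_symm (p : M) :
    Tendsto (fun v => (extChartAt (𝓡 m) p).symm (extChartAt (𝓡 m) p p + v)) (𝓝 0) (𝓝 p) := by
  have h1 : Tendsto (fun v => extChartAt (𝓡 m) p p + v) (𝓝 0) (𝓝 (extChartAt (𝓡 m) p p)) := by
    simpa using (continuous_const_add (extChartAt (𝓡 m) p p)).tendsto 0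
  have h2 := (continuousAt_extChartAt_symm (I := 𝓡 m) p).tendsto
  rw [extChartAt_to_inv] at h2
  exact h2.comp h1

theorem chartConj_zero {p : M} {S : M → M} (hS : S p = p) : chartConj m p S 0 = 0 := by
  simp only [chartConj, add_zero, extChartAt_to_inv, hS, sub_self]

theorem chartConj_id (p : M) : chartConj m p id =ᶠ[𝓝 0] id := by
  have h1 : Tendsto (fun v => extChartAt (𝓡 m) p p + v) (𝓝 0) (𝓝 (extChartAt (𝓡 m) p p)) := by
    simpa using (continuous_const_add (extChartAt (𝓡 m) p p)).tendsto 0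
  filter_upwards [h1.eventually (extChartAt_target_mem_nhds (I := 𝓡 m) p)] with v hv
  simp only [chartConj, id]
  rw [(extChartAt (𝓡 m) p).right_inv hv, add_sub_cancel_left]

theorem chartConj_comp {p : M} {S S' : M → M} (hS' : S' p = p) (hc : ContinuousAt S' p) :
    chartConj m p (S ∘ S') =ᶠ[𝓝 0] chartConj m p S ∘ chartConj m p S' := by
  have h2 : Tendsto (fun v => S' ((extChartAt (𝓡 m) p).symm (extChartAt (𝓡 m) p p + v)))
      (𝓝 0) (𝓝 p) := by
    have := hc.tendsto.comp (tendsto_chart_symm (m := m) p)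
    rwa [hS'] at this
  filter_upwards [h2.eventually (extChartAt_source_mem_nhds (I := 𝓡 m) p)] with v hv
  simp only [chartConj, Function.comp_apply]
  rw [add_sub_cancel, (extChartAt (𝓡 m) p).left_inv hv]

theorem chartConj_iterate {p : M} {S : M → M} (hS : S p = p) (hc : ContinuousAt S p) (n : ℕ) :
    chartConj m p S^[n] =ᶠ[𝓝 0] (chartConj m p S)^[n] := by
  induction n with
  | zero => exact chartConj_id p
  | succ n ih =>
    have hcc : Tendsto (chartConj m p S) (𝓝 0) (𝓝 0) := by
      have h2 : Tendsto (fun v => S ((extChartAt (𝓡 m) p).symm (extChartAt (𝓡 m) p p + v)))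
        (𝓝 0) (𝓝 p) := by
        have := hc.tendsto.comp (tendsto_chart_symm (m := m) p)
        rwa [hS] at this
      have := ((continuousAt_extChartAt (I := 𝓡 m) p).tendsto.comp h2).sub_const
        (extChartAt (𝓡 m) p p)
      rwa [sub_self] at this
    rw [Function.iterate_succ, Function.iterate_succ]
    refine (chartConj_comp hS hc).trans ?_
    filter_upwards [hcc.eventually ih] with v hv
    exact hv

theorem contDiffAt_chartConj {p : M} {S : M → M} (hS : S p = p)
    (h : ContMDiffAt (𝓡 m) (𝓡 m) 1 S p) : ContDiffAt ℝ 1 (chartConj m p S) 0 := by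
  have h1 := (contMDiffAt_iff.1 h).2
  rw [hS, ModelWithCorners.range_eq_univ, contDiffWithinAt_univ] at h1
  have h2 : ContDiffAt ℝ 1 (fun v => extChartAt (𝓡 m) p p + v) 0 :=
    contDiffAt_const.add contDiffAt_id
  have h3 : ContDiffAt ℝ 1 (extChartAt (𝓡 m) p ∘ S ∘ (extChartAt (𝓡 m) p).symm)
    (extChartAt (𝓡 m) p p + 0) := by rwa [add_zero]
  exact (h3.comp 0 h2).sub contDiffAt_const

theorem hasFDerivAt_chartConj {p : M} {S : M → M} (hS : S p = p)
    (h : ContMDiffAt (𝓡 m) (𝓡 m) 1 S p) :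
    HasFDerivAt (chartConj m p S) (mfderiv (𝓡 m) (𝓡 m) S p :
      EuclideanSpace ℝ (Fin m) →L[ℝ] EuclideanSpace ℝ (Fin m)) 0 := by
  have h1 := (h.mdifferentiableAt (by simp)).hasMFDerivAt.2
  simp only [writtenInExtChartAt, hS] at h1
  rw [ModelWithCorners.range_eq_univ] at h1
  have h2 : HasFDerivAt (fun v => extChartAt (𝓡 m) p p + v)
      (ContinuousLinearMap.id ℝ (EuclideanSpace ℝ (Fin m))) 0 :=
    (hasFDerivAt_id _).const_add _
  have h3 : HasFDerivAt (extChartAt (𝓡 m) p ∘ S ∘ (extChartAt (𝓡 m) p).symm)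
    (mfderiv (𝓡 m) (𝓡 m) S p :
      EuclideanSpace ℝ (Fin m) →L[ℝ] EuclideanSpace ℝ (Fin m)) (extChartAt (𝓡 m) p p + 0) := by
    rw [add_zero]; exact hasFDerivWithinAt_univ.1 h1
  exact (h3.comp 0 h2).sub_const _

end Conj

/-- A `C^1` parametrization of the local stable manifold of a fixed point `p` of `T`, with a `C^1`
left inverse defined on a neighbourhood of `p`. -/
structure StableParam (m : ℕ) {M : Type*} [MetricSpace M]
    [ChartedSpace (EuclideanSpace ℝ (Fin m)) M] (T : M → M) (p : M)
    (F : Type*) [NormedAddCommGroup F] [NormedSpace ℝ F] where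
  /-- the parametrization -/
  par : F → M
  /-- its left inverse -/
  coord : M → F
  /-- the radius of the ball of parameters -/
  rad : ℝ
  /-- the neighbourhood of `p` where `coord` is used -/
  nbhd : Set M
  rad_pos : 0 < rad
  isOpen_nbhd : IsOpen nbhd
  mem_nbhd : p ∈ nbhd
  par_zero : par 0 = p
  contMDiffAt_par : ∀ a ∈ Metric.ball 0 rad, ContMDiffAt 𝓘(ℝ, F) (𝓡 m) 1 par a
  contMDiffAt_coord : ∀ z ∈ nbhd, ContMDiffAt (𝓡 m) 𝓘(ℝ, F) 1 coord z
  coord_par : ∀ a ∈ Metric.ball 0 rad, coord (par a) = a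
  coord_mem : ∀ z, (∀ n, T^[n] z ∈ nbhd) → coord z ∈ Metric.ball 0 rad
  par_coord : ∀ z, (∀ n, T^[n] z ∈ nbhd) → par (coord z) = z
  uniform_tendsto : ∀ ε > 0, ∃ n₀, ∀ z, (∀ n, T^[n] z ∈ nbhd) → ∀ n ≥ n₀, dist (T^[n] z) p < ε
  equicontinuous : ∀ a ∈ Metric.ball 0 rad, ∀ ε > 0, ∀ᶠ b in 𝓝 a,
    ∀ n, dist (T^[n] (par b)) (T^[n] (par a)) < ε

/-- The sequence-space theorem is transported by the chart at `p`. The coordinate of a point is the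
stable projection of its chart image, and the parametrization returns the first point of the bounded
orbit with that projection. Uniform convergence to `p` comes from the exponential bound on small
orbits. -/
theorem exists_stableParam {m : ℕ} {M : Type*} [MetricSpace M]
    [ChartedSpace (EuclideanSpace ℝ (Fin m)) M] [IsManifold (𝓡 m) 1 M] {T : M → M} {p : M}
    (hT : ContMDiff (𝓡 m) (𝓡 m) 1 T) (hp : T p = p)
    {A P B : EuclideanSpace ℝ (Fin m) →L[ℝ] EuclideanSpace ℝ (Fin m)}
    (hP : P * P = P) (hPA : Commute P A)
    (hBA : B * A = 1 - P) (hAB : A * B = 1 - P) (hPB : P * B = 0) (hA : ‖A * P‖ ≤ 1 / 4)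
    (hB : ‖B‖ ≤ 1 / 4) (hFA : HasFDerivAt (chartConj m p T) A 0) :
    Nonempty (StableParam m T p (LinearMap.range P.toLinearMap)) := by
  obtain ⟨W, ρ, δ, C, hρ, hδ, hW0, hW, hz⟩ := exists_stable_orbits hP hPA hBA hAB hPB hA hB
    (chartConj_zero hp) (contDiffAt_chartConj hp hT.contMDiffAt) hFA
  set φ := extChartAt (𝓡 m) p with hφ
  have hadd : Tendsto (fun v => φ p + v) (𝓝 0) (𝓝 (φ p)) := by
    simpa using (continuous_const_add (φ p)).tendsto 0
  have hsymm : Tendsto (fun v => φ.symm (φ p + v)) (𝓝 0) (𝓝 p) := tendsto_chart_symm p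
  have hTs : Tendsto (fun v => T (φ.symm (φ p + v))) (𝓝 0) (𝓝 p) := by
    have := hT.continuous.continuousAt.tendsto.comp hsymm
    rwa [hp] at this
  -- In this ball the chart can be inverted, and the image under `T` is still in the chart, so
  -- orbits of `chartConj` lift to orbits of `T`.
  obtain ⟨R, hR, hRball⟩ : ∃ R > 0, ∀ v ∈ Metric.closedBall (0 : EuclideanSpace ℝ (Fin m)) R,
      φ p + v ∈ φ.target ∧ T (φ.symm (φ p + v)) ∈ φ.source := by
    obtain ⟨R, hR, h⟩ := Metric.eventually_nhds_iff_ball.1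
      ((hadd.eventually (extChartAt_target_mem_nhds (I := 𝓡 m) p)).and
        (hTs.eventually (extChartAt_source_mem_nhds (I := 𝓡 m) p)))
    exact ⟨R / 2, by positivity, fun v hv => h v (Metric.closedBall_subset_ball (by linarith) hv)⟩
  have hWc : Tendsto W (𝓝 0) (𝓝 0) := by
    have := (hW 0 (Metric.mem_ball_self hρ)).1.continuousAt.tendsto
    rwa [hW0] at this
  obtain ⟨r, hr, hrW⟩ : ∃ r > 0, ∀ a ∈ Metric.ball (0 : LinearMap.range P.toLinearMap) r,
      a ∈ Metric.ball (0 : LinearMap.range P.toLinearMap) ρ ∧ ‖W a‖ < R := by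
    have h1 : ∀ᶠ a in 𝓝 (0 : LinearMap.range P.toLinearMap), a ∈ Metric.ball 0 ρ :=
      Metric.ball_mem_nhds _ hρ
    refine Metric.eventually_nhds_iff_ball.1 (h1.and ?_)
    simpa using hWc.eventually (Metric.ball_mem_nhds _ hR)
  let coord : M → LinearMap.range P.toLinearMap := fun z => ⟨P (φ z - φ p), _, rfl⟩
  let par : LinearMap.range P.toLinearMap → M := fun a => φ.symm (φ p + W a 0)
  have hcoordp : coord p = 0 := Subtype.ext (by simp [coord])
  have hφs : ∀ z ∈ φ.source, ContMDiffAt (𝓡 m) 𝓘(ℝ, EuclideanSpace ℝ (Fin m)) 1 φ z :=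
    fun z hz => contMDiffAt_extChartAt' (by simpa [hφ] using hz)
  let Pr : EuclideanSpace ℝ (Fin m) →L[ℝ] LinearMap.range P.toLinearMap :=
    P.codRestrict _ fun v => ⟨v, rfl⟩
  have hcoord : ∀ z ∈ φ.source,
      ContMDiffAt (𝓡 m) 𝓘(ℝ, LinearMap.range P.toLinearMap) 1 coord z := by
    intro z hz
    have h1 : ContDiff ℝ 1 (fun v => Pr (v - φ p)) := Pr.contDiff.comp (contDiff_id.sub contDiff_const)
    exact (h1.contDiffAt.contMDiffAt).comp z (hφs z hz)
  have hcoordc : Tendsto coord (𝓝 p) (𝓝 0) := by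
    have := (hcoord p (mem_extChartAt_source p)).continuousAt.tendsto
    rwa [hcoordp] at this
  have hφc : Tendsto (fun z => φ z - φ p) (𝓝 p) (𝓝 0) := by
    have := ((continuousAt_extChartAt (I := 𝓡 m) p).tendsto).sub_const (φ p)
    rwa [sub_self] at this
  have hsrc : ∀ᶠ z in 𝓝 p, z ∈ φ.source := extChartAt_source_mem_nhds (I := 𝓡 m) p
  obtain ⟨V, hV, hVo, hpV⟩ := eventually_nhds_iff.1 (hsrc.and ((hφc.eventually (Metric.closedBall_mem_nhds _ hδ)).and
      (hcoordc.eventually (Metric.ball_mem_nhds _ hr))))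
  have hWr : ∀ a ∈ Metric.ball (0 : LinearMap.range P.toLinearMap) r, ∀ n,
      W a n ∈ Metric.closedBall (0 : EuclideanSpace ℝ (Fin m)) R := by
    intro a ha n
    rw [mem_closedBall_zero_iff]
    exact ((W a).norm_coe_le_norm n).trans (hrW a ha).2.le
  have horb : ∀ a ∈ Metric.ball (0 : LinearMap.range P.toLinearMap) r, ∀ n,
      T^[n] (par a) = φ.symm (φ p + W a n) := by
    intro a ha n
    induction n with
    | zero => rfl
    | succ n ih =>
      rw [Function.iterate_succ_apply', ih, (hW a (hrW a ha).1).2.2 n, chartConj, add_sub_cancel,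
        φ.left_inv (hRball _ (hWr a ha n)).2]
  have hseq : ∀ z, (∀ n, T^[n] z ∈ V) →
      (∀ n, ‖φ (T^[n] z) - φ p‖ ≤ δ) ∧
      (∀ n, φ (T^[n + 1] z) - φ p = chartConj m p T (φ (T^[n] z) - φ p)) := by
    intro z hz
    refine ⟨fun n => by simpa using (hV _ (hz n)).2.1, fun n => ?_⟩
    rw [chartConj, ← hφ, add_sub_cancel, φ.left_inv (hV _ (hz n)).1, Function.iterate_succ_apply']
  refine ⟨{
    par := par
    coord := coord
    rad := r
    nbhd := V
    rad_pos := hr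
    isOpen_nbhd := hVo
    mem_nbhd := hpV
    par_zero := by simp [par, hW0, hφ]
    contMDiffAt_par := ?_
    contMDiffAt_coord := fun z hz => hcoord z (hV z hz).1
    coord_par := ?_
    coord_mem := fun z hz => (hV z (hz 0)).2.2
    par_coord := ?_
    uniform_tendsto := ?_
    equicontinuous := ?_ }⟩
  · intro a ha
    have h1 : ContDiffAt ℝ 1 (fun a => φ p + W a 0) a := by
      have h2 := (BoundedContinuousFunction.evalCLM ℝ (β := EuclideanSpace ℝ (Fin m)) 0).contDiff
        (n := 1)
      exact contDiffAt_const.add (h2.contDiffAt.comp a (hW a (hrW a ha).1).1)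
    have h3 := (contMDiffOn_extChartAt_symm (I := 𝓡 m) (n := 1) p).contMDiffAt
      (x := φ p + W a 0) ((isOpen_extChartAt_target p).mem_nhds (hRball _ (hWr a ha 0)).1)
    exact h3.comp a h1.contMDiffAt
  · intro a ha
    apply Subtype.ext
    show P (φ (φ.symm (φ p + W a 0)) - φ p) = a
    rw [φ.right_inv (hRball _ (hWr a ha 0)).1, add_sub_cancel_left, (hW a (hrW a ha).1).2.1]
  · intro z hzV
    have h1 := (hz (fun n => φ (T^[n] z) - φ p) (hseq z hzV).1 (hseq z hzV).2).2.1
    show φ.symm (φ p + W (coord z) 0) = z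
    have h2 : φ z - φ p = W (coord z) 0 := h1
    rw [← h2, add_sub_cancel]
    exact φ.left_inv (hV _ (hzV 0)).1
  · intro ε hε
    have h2 := hsymm.eventually (Metric.ball_mem_nhds p hε)
    obtain ⟨η, hη, hηb⟩ := Metric.eventually_nhds_iff_ball.1 h2
    have h3 : Tendsto (fun n : ℕ => C * (1 / 2 : ℝ) ^ n) atTop (𝓝 0) := by
      simpa using (tendsto_pow_atTop_nhds_zero_of_lt_one (r := (1 / 2 : ℝ)) (by norm_num)
        (by norm_num)).const_mul C
    obtain ⟨n₀, hn₀⟩ := eventually_atTop.1 (h3.eventually_lt_const hη)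
    refine ⟨n₀, fun z hzV n hn => ?_⟩
    have h1 := (hz (fun n => φ (T^[n] z) - φ p) (hseq z hzV).1 (hseq z hzV).2).2.2 n
    have h4 := hηb (φ (T^[n] z) - φ p) (by rw [mem_ball_zero_iff]; exact h1.trans_lt (hn₀ n hn))
    rwa [add_sub_cancel, φ.left_inv (hV _ (hzV n)).1] at h4
  · intro a ha ε hε
    -- All terms of the orbits lie in one compact ball. There the chart inverse is uniformly
    -- continuous, so continuity of `W` in the supremum norm controls all times at once.
    have h1 : ContinuousOn (fun v => φ.symm (φ p + v))
        (Metric.closedBall (0 : EuclideanSpace ℝ (Fin m)) R) := by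
      refine (continuousOn_extChartAt_symm (I := 𝓡 m) p).comp (by fun_prop) fun v hv => ?_
      exact (hRball v hv).1
    obtain ⟨η, hη, hηu⟩ := Metric.uniformContinuousOn_iff.1
      ((isCompact_closedBall _ _).uniformContinuousOn_of_continuous h1) ε hε
    have h2 := (hW a (hrW a ha).1).1.continuousAt
    filter_upwards [h2.eventually (Metric.ball_mem_nhds _ hη), Metric.isOpen_ball.mem_nhds ha]
      with b hb hb' n
    rw [horb a ha, horb b hb']
    refine hηu _ (hWr b hb' n) _ (hWr a ha n) ?_
    exact (BoundedContinuousFunction.dist_coe_le_dist n).trans_lt hb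


theorem contMDiff_iterate {m : ℕ} {M : Type*} [TopologicalSpace M]
    [ChartedSpace (EuclideanSpace ℝ (Fin m)) M] {T : M → M} (hT : ContMDiff (𝓡 m) (𝓡 m) 1 T)
    (n : ℕ) : ContMDiff (𝓡 m) (𝓡 m) 1 T^[n] := by
  induction n with
  | zero => exact contMDiff_id
  | succ n ih => rw [Function.iterate_succ]; exact ih.comp hT

/-- A hyperbolic periodic point has a `C^1` local stable manifold. -/
theorem exists_stableParam_of_hyperbolic {m : ℕ} {M : Type*} [MetricSpace M]
    [ChartedSpace (EuclideanSpace ℝ (Fin m)) M] [IsManifold (𝓡 m) 1 M]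
    (f : M ≃ₘ^1⟮𝓡 m, 𝓡 m⟯ M) {p : M} {τ : ℕ} (hp : f^[τ] p = p)
    (h : ∀ z : ℂ, Polynomial.aeval z (returnDeriv (m := m) f p τ).charpoly = 0 → ‖z‖ ≠ 1) :
    ∃ (N : ℕ) (S : Submodule ℝ (EuclideanSpace ℝ (Fin m))), 1 ≤ N ∧
      Nonempty (StableParam m f^[τ * N] p S) := by
  have hfC := contMDiff_iterate f.contMDiff τ
  have hgC := contMDiff_iterate f.symm.contMDiff τ
  have hfg : Function.LeftInverse f f.symm := f.apply_symm_apply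
  have hgf : Function.LeftInverse f.symm f := f.symm_apply_apply
  have hp' : f.symm^[τ] p = p := by
    conv_lhs => rw [← hp]
    exact hgf.iterate τ p
  set A₀ : EuclideanSpace ℝ (Fin m) →L[ℝ] EuclideanSpace ℝ (Fin m) := mfderiv (𝓡 m) (𝓡 m) f^[τ] p
  set B₀ : EuclideanSpace ℝ (Fin m) →L[ℝ] EuclideanSpace ℝ (Fin m) :=
    mfderiv (𝓡 m) (𝓡 m) f.symm^[τ] p
  have hA₀ : HasFDerivAt (chartConj m p f^[τ]) A₀ 0 := hasFDerivAt_chartConj hp hfC.contMDiffAt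
  have hB₀ : HasFDerivAt (chartConj m p f.symm^[τ]) B₀ 0 :=
    hasFDerivAt_chartConj hp' hgC.contMDiffAt
  have key : ∀ {S S' : M → M} {L L' : EuclideanSpace ℝ (Fin m) →L[ℝ] EuclideanSpace ℝ (Fin m)},
      S' p = p → Continuous S' → S ∘ S' = id → HasFDerivAt (chartConj m p S) L 0 →
      HasFDerivAt (chartConj m p S') L' 0 → L.comp L' = ContinuousLinearMap.id ℝ _ := by
    intro S S' L L' hS' hc hcomp hL hL'
    have h1 := chartConj_comp (m := m) (S := S) hS' hc.continuousAt
    rw [hcomp] at h1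
    have h2 : HasFDerivAt (chartConj m p S ∘ chartConj m p S') (L.comp L') 0 := by
      refine HasFDerivAt.comp 0 ?_ hL'
      rwa [chartConj_zero hS']
    have h3 := (hasFDerivAt_id (𝕜 := ℝ) (0 : EuclideanSpace ℝ (Fin m))).congr_of_eventuallyEq
      (h1.symm.trans (chartConj_id p))
    exact h2.unique h3
  have hAB : A₀.comp B₀ = ContinuousLinearMap.id ℝ _ := key hp' hgC.continuous
    (funext fun x => hfg.iterate τ x) hA₀ hB₀
  have hBA : B₀.comp A₀ = ContinuousLinearMap.id ℝ _ := key hp hfC.continuous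
    (funext fun x => hgf.iterate τ x) hB₀ hA₀
  -- The derivative of the inverse iterate makes the return derivative an automorphism, as the
  -- splitting theorem requires.
  let A : EuclideanSpace ℝ (Fin m) ≃L[ℝ] EuclideanSpace ℝ (Fin m) :=
    ContinuousLinearEquiv.equivOfInverse A₀ B₀
      (fun x => congrArg (fun L : EuclideanSpace ℝ (Fin m) →L[ℝ] EuclideanSpace ℝ (Fin m) => L x) hBA)
      (fun x => congrArg (fun L : EuclideanSpace ℝ (Fin m) →L[ℝ] EuclideanSpace ℝ (Fin m) => L x) hAB)
  obtain ⟨P, hPP, hPA, N, hN, h1, h2⟩ := exists_hyperbolic_splitting A h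
  have hA : (A : EuclideanSpace ℝ (Fin m) →L[ℝ] EuclideanSpace ℝ (Fin m)) = A₀ := rfl
  have hB : (A.symm : EuclideanSpace ℝ (Fin m) →L[ℝ] EuclideanSpace ℝ (Fin m)) = B₀ := rfl
  rw [hA] at hPA h1
  rw [hB] at h2
  have hcomm : Commute A₀ B₀ := hAB.trans hBA.symm
  have hPB : Commute P B₀ := by
    show P * B₀ = B₀ * P
    have hBA' : B₀ * A₀ = 1 := hBA
    have hAB' : A₀ * B₀ = 1 := hAB
    calc P * B₀ = (B₀ * A₀) * P * B₀ := by rw [hBA', one_mul]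
      _ = B₀ * (P * A₀) * B₀ := by rw [hPA.eq]; simp only [mul_assoc]
      _ = B₀ * P * (A₀ * B₀) := by simp only [mul_assoc]
      _ = B₀ * P := by rw [hAB', mul_one]
  have hBAN : B₀ ^ N * A₀ ^ N = 1 := by
    rw [← hcomm.symm.mul_pow, show B₀ * A₀ = 1 from hBA, one_pow]
  have hABN : A₀ ^ N * B₀ ^ N = 1 := by
    rw [← hcomm.mul_pow, show A₀ * B₀ = 1 from hAB, one_pow]
  have hPAN : Commute P (A₀ ^ N) := hPA.pow_right N
  have hPBN : Commute P (B₀ ^ N) := hPB.pow_right N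
  have hder : HasFDerivAt (chartConj m p f^[τ * N]) (A₀ ^ N) 0 := by
    rw [Function.iterate_mul]
    exact (hA₀.iterate (chartConj_zero hp) N).congr_of_eventuallyEq
      (chartConj_iterate hp hfC.continuous.continuousAt N)
  refine ⟨N, _, hN, exists_stableParam (contMDiff_iterate f.contMDiff _)
    (by rw [Function.iterate_mul]; exact Function.iterate_fixed hp N) hPP hPAN
    (B := B₀ ^ N * (1 - P)) ?_ ?_ ?_ h1 h2 hder⟩
  · rw [mul_assoc, sub_mul, one_mul, hPAN.eq, mul_sub, ← mul_assoc, hBAN, one_mul]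
  · rw [← mul_assoc, hABN, one_mul]
  · rw [← mul_assoc, hPBN.eq, mul_assoc, mul_sub, mul_one, hPP, sub_self, mul_zero]

end
end StableDistortion

/-! ### Intrinsic topology, tangent spaces and the Jacobian cocycle -/

namespace StableDistortion
noncomputable section

section Topology

variable {M : Type*} [MetricSpace M] {f : M → M} {O : Set M}

/-- The local stable set is not open in general. The points that satisfy the bound with some `r < ε`
form an open subset of it, by the triangle inequality. -/
theorem localStable_mem_nhds (x : StableManifold f O) {ε : ℝ} (hε : 0 < ε) :
    localStable f O ε x ∈ 𝓝 x := by
  refine mem_nhds_iff.2 ⟨{y | ∃ r < ε, y ∈ localStable f O r x}, ?_, ?_, ⟨0, hε, fun n => by simp⟩⟩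
  · rintro y ⟨r, hr, hy⟩ n
    exact (hy n).trans hr.le
  · rintro y ⟨r, hr, hy⟩
    refine ⟨(ε - r) / 2, by linarith, fun z hz => ⟨r + (ε - r) / 2, by linarith, fun n => ?_⟩⟩
    exact (dist_triangle _ _ _).trans (add_le_add (hy n) (hz n))

theorem mem_nhds_stableManifold {x : StableManifold f O} {s : Set (StableManifold f O)} :
    s ∈ 𝓝 x ↔ ∃ ε > 0, localStable f O ε x ⊆ s := by
  refine ⟨fun h => ?_, fun ⟨ε, hε, h⟩ => mem_of_superset (localStable_mem_nhds x hε) h⟩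
  obtain ⟨t, hts, ht, hxt⟩ := mem_nhds_iff.1 h
  obtain ⟨ε, hε, h⟩ := ht x hxt
  exact ⟨ε, hε, h.trans hts⟩

theorem tendsto_stableManifold {α : Type*} {l : Filter α} {γ : α → StableManifold f O}
    {x : StableManifold f O} :
    Tendsto γ l (𝓝 x) ↔ ∀ ε > 0, ∀ᶠ t in l, ∀ n, dist (f^[n] x.1) (f^[n] (γ t).1) ≤ ε := by
  refine ⟨fun h ε hε => h (localStable_mem_nhds x hε), fun h s hs => ?_⟩
  obtain ⟨ε, hε, hs⟩ := mem_nhds_stableManifold.1 hs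
  exact mem_of_superset (h ε hε) fun t ht => hs ht

theorem continuous_stableManifold_val : Continuous fun x : StableManifold f O => x.1 := by
  refine continuous_iff_continuousAt.2 fun x => Metric.tendsto_nhds.2 fun ε hε => ?_
  filter_upwards [localStable_mem_nhds x (half_pos hε)] with y hy
  rw [dist_comm]
  exact (hy 0).trans_lt (half_lt_self hε)

variable [CompactSpace M]

theorem mem_stableSet_of_commute {h : M → M} (hc : Continuous h) (hf : ∀ x, h (f x) = f (h x))
    (hO : MapsTo h O O) (hne : O.Nonempty) {x : M} (hx : x ∈ stableSet f O) :
    h x ∈ stableSet f O := by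
  have hn : ∀ n x, f^[n] (h x) = h (f^[n] x) := fun n x =>
    ((Function.Commute.iterate_right (f := h) (g := f) hf n) x).symm
  have hu := CompactSpace.uniformContinuous_of_continuous hc
  have hx' : Tendsto (fun n : ℕ => Metric.infDist (f^[n] x) O) atTop (𝓝 0) := hx
  show Tendsto (fun n : ℕ => Metric.infDist (f^[n] (h x)) O) atTop (𝓝 0)
  refine tendsto_order.2 ⟨fun a ha => Eventually.of_forall fun n =>
    ha.trans_le Metric.infDist_nonneg, fun ε hε => ?_⟩
  obtain ⟨δ, hδ, hδε⟩ := Metric.uniformContinuous_iff.1 hu ε hε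
  filter_upwards [hx'.eventually_lt_const hδ] with n hn'
  obtain ⟨o, ho, hd⟩ := (Metric.infDist_lt_iff hne).1 hn'
  rw [hn]
  exact (Metric.infDist_le_dist_of_mem (hO ho)).trans_lt (hδε hd)

/-- The self-map of the stable manifold induced by a map that commutes with `f`. -/
def stableMap (h : M → M) (hc : Continuous h) (hf : ∀ x, h (f x) = f (h x)) (hO : MapsTo h O O)
    (hne : O.Nonempty) (x : StableManifold f O) : StableManifold f O :=
  ⟨h x.1, mem_stableSet_of_commute hc hf hO hne x.2⟩

/-- By uniform continuity, a map commuting with `f` preserves closeness of entire forward orbits. -/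
theorem continuous_stableMap {h : M → M} (hc : Continuous h) (hf : ∀ x, h (f x) = f (h x))
    (hO : MapsTo h O O) (hne : O.Nonempty) : Continuous (stableMap h hc hf hO hne) := by
  refine continuous_iff_continuousAt.2 fun x => tendsto_stableManifold.2 fun ε hε => ?_
  have hn : ∀ n x, f^[n] (h x) = h (f^[n] x) := fun n x =>
    ((Function.Commute.iterate_right (f := h) (g := f) hf n) x).symm
  obtain ⟨δ, hδ, hδε⟩ := Metric.uniformContinuous_iff.1
    (CompactSpace.uniformContinuous_of_continuous hc) ε hε
  filter_upwards [localStable_mem_nhds x (half_pos hδ)] with y hy n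
  show dist (f^[n] (h x.1)) (f^[n] (h y.1)) ≤ ε
  rw [hn, hn]
  exact (hδε ((hy n).trans_lt (half_lt_self hδ))).le

end Topology

section Tangent

variable {m : ℕ} {M : Type*} [MetricSpace M] [CompactSpace M]
  [ChartedSpace (EuclideanSpace ℝ (Fin m)) M] {f : M → M} {O : Set M}

theorem mfderiv_mem_stableTangent {h : M → M} (hC : ContMDiff (𝓡 m) (𝓡 m) 1 h)
    (hf : ∀ x, h (f x) = f (h x)) (hO : MapsTo h O O) (hne : O.Nonempty) {x : StableManifold f O}
    {v : TangentSpace (𝓡 m) x.1} (hv : v ∈ stableTangent f O x) :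
    mfderiv (𝓡 m) (𝓡 m) h x.1 v ∈ stableTangent f O (stableMap h hC.continuous hf hO hne x) := by
  induction hv using Submodule.span_induction with
  | mem v hv =>
    obtain ⟨γ, hγ, hγC, rfl, rfl⟩ := hv
    refine Submodule.subset_span ⟨fun t => stableMap h hC.continuous hf hO hne (γ t),
      (continuous_stableMap hC.continuous hf hO hne).comp hγ, hC.comp hγC, rfl, ?_⟩
    have := mfderiv_comp (I := 𝓘(ℝ, ℝ)) (I' := 𝓡 m) (I'' := 𝓡 m) (g := h)
      (f := fun t => (γ t).1) (0 : ℝ) (hC.mdifferentiable (by simp) _)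
      (hγC.mdifferentiable (by simp) _)
    exact (congrArg (fun L => L (1 : ℝ)) this).symm
  | zero => rw [map_zero]; exact Submodule.zero_mem _
  | add v w _ _ hv hw => rw [map_add]; exact Submodule.add_mem _ hv hw
  | smul c v _ hv => rw [map_smul]; exact Submodule.smul_mem _ c hv

end Tangent

theorem iterate_commute {M : Type*} (f : M → M) (n : ℕ) (x : M) : f^[n] (f x) = f (f^[n] x) :=
  Function.Commute.iterate_left (Function.Commute.refl f) n x

/-- The chain rule for a left inverse. -/
theorem mfderiv_leftInverse_apply {m : ℕ} {M : Type*} [TopologicalSpace M]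
    [ChartedSpace (EuclideanSpace ℝ (Fin m)) M] {g h : M → M}
    (hg : ContMDiff (𝓡 m) (𝓡 m) 1 g) (hh : ContMDiff (𝓡 m) (𝓡 m) 1 h)
    (hgh : Function.LeftInverse g h) {x y : M} (hxy : h x = y) (v : EuclideanSpace ℝ (Fin m)) :
    (mfderiv (𝓡 m) (𝓡 m) g y : EuclideanSpace ℝ (Fin m) →L[ℝ] EuclideanSpace ℝ (Fin m))
      ((mfderiv (𝓡 m) (𝓡 m) h x : EuclideanSpace ℝ (Fin m) →L[ℝ] EuclideanSpace ℝ (Fin m)) v)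
      = v := by
  subst hxy
  have h1 := mfderiv_comp x (hg.mdifferentiable (by simp) (h x)) (hh.mdifferentiable (by simp) x)
  rw [show g ∘ h = id from funext hgh, mfderiv_id] at h1
  exact (congrArg (fun L => L v) h1).symm

section Cocycle

variable {m : ℕ} {M : Type*} [MetricSpace M] [CompactSpace M]
  [ChartedSpace (EuclideanSpace ℝ (Fin m)) M]

variable (f : M ≃ₘ^1⟮𝓡 m, 𝓡 m⟯ M) {O : Set M} (hO : MapsTo f O O) (hO' : MapsTo f.symm O O)
  (hne : O.Nonempty)

/-- The action of the iterates of `f` on the stable manifold. -/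
def stableIter (hO : MapsTo f O O) (hne : O.Nonempty) (n : ℕ) (x : StableManifold f O) :
    StableManifold f O :=
  stableMap f^[n] (f.continuous.iterate n) (iterate_commute f n) (hO.iterate n) hne x

include hO' in
theorem range_mfderiv_iterate (n : ℕ) (x : StableManifold f O) :
    LinearMap.range ((mfderiv (𝓡 m) (𝓡 m) f^[n] x.1).toLinearMap.domRestrict (stableTangent f O x))
      = stableTangent f O (stableIter f hO hne n x) := by
  have hfg : Function.LeftInverse f f.symm := f.apply_symm_apply
  have hgf : Function.LeftInverse f.symm f := f.symm_apply_apply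
  have hc1 := contMDiff_iterate f.contMDiff n
  have hc2 := contMDiff_iterate f.symm.contMDiff n
  have hcomm : ∀ x, f.symm^[n] (f x) = f (f.symm^[n] x) :=
    Function.Commute.iterate_left (f := f.symm) (g := f) (fun x => by simp) n
  apply le_antisymm
  · rintro _ ⟨v, rfl⟩
    exact mfderiv_mem_stableTangent hc1 _ (hO.iterate n) hne v.2
  · intro w hw
    have h1 := mfderiv_mem_stableTangent (f := f) hc2 hcomm (hO'.iterate n) hne hw
    -- The inverse iterate returns to `x` only up to a propositional equality, along which
    -- membership in the tangent space is transported.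
    have h2 : ∀ y : StableManifold f O, y = x → ∀ v : EuclideanSpace ℝ (Fin m),
        (show TangentSpace (𝓡 m) y.1 from v) ∈ stableTangent f O y →
        (show TangentSpace (𝓡 m) x.1 from v) ∈ stableTangent f O x := by
      rintro y rfl v hv; exact hv
    have h3 := h2 _ (Subtype.ext (hgf.iterate n x.1)) _ h1
    exact ⟨⟨_, h3⟩, mfderiv_leftInverse_apply hc1 hc2 (hfg.iterate n) (hgf.iterate n x.1) w⟩

omit [CompactSpace M] in
theorem mfderiv_iterate_injective (n : ℕ) (x : M) :
    Function.Injective (mfderiv (𝓡 m) (𝓡 m) f^[n] x) := by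
  have hgf : Function.LeftInverse f.symm f := f.symm_apply_apply
  exact Function.LeftInverse.injective (mfderiv_leftInverse_apply
    (contMDiff_iterate f.symm.contMDiff n) (contMDiff_iterate f.contMDiff n) (hgf.iterate n) rfl)

variable [IsManifold (𝓡 m) 1 M] [RiemannianBundle (fun x : M => TangentSpace (𝓡 m) x)]

omit [IsManifold (𝓡 m) 1 M] in
include hO' in
theorem stableJacobian_iterate_add (n k : ℕ) (x : StableManifold f O) :
    stableJacobian (m := m) f O f^[n + k] x =
      stableJacobian (m := m) f O f^[n] (stableIter f hO hne k x)
        * stableJacobian (m := m) f O f^[k] x := by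
  have h1 := jacobian_comp (A := (mfderiv (𝓡 m) (𝓡 m) f^[k] x.1).toLinearMap.domRestrict
    (stableTangent f O x)) ((mfderiv_iterate_injective f k x.1).comp Subtype.val_injective)
    (range_mfderiv_iterate f hO hO' hne k x)
    (mfderiv (𝓡 m) (𝓡 m) f^[n] (stableIter f hO hne k x).1).toLinearMap
  have h2 := mfderiv_comp (I := 𝓡 m) (I' := 𝓡 m) (I'' := 𝓡 m) (g := f^[n]) (f := f^[k]) x.1
    ((contMDiff_iterate f.contMDiff n).mdifferentiable (by simp) _)
    ((contMDiff_iterate f.contMDiff k).mdifferentiable (by simp) _)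
  have h3 : ∀ g : M → M, g = f^[n] ∘ f^[k] → stableJacobian (m := m) f O g x =
      stableJacobian (m := m) f O (f^[n] ∘ f^[k]) x := by
    rintro g rfl; rfl
  rw [h3 _ (Function.iterate_add f n k)]
  refine Eq.trans ?_ h1
  unfold stableJacobian
  rw [h2]
  rfl

variable [IsContinuousRiemannianBundle (EuclideanSpace ℝ (Fin m))
  (fun x : M => TangentSpace (𝓡 m) x)]

omit f in
theorem exists_norm_mfderiv_le {h : M → M} (hh : ContMDiff (𝓡 m) (𝓡 m) 1 h) :
    ∃ C, ∀ (x : M) (v : TangentSpace (𝓡 m) x), ‖mfderiv (𝓡 m) (𝓡 m) h x v‖ ≤ C * ‖v‖ := by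
  have := isCompact_univ.induction_on (X := M) (p := fun s => ∃ C, ∀ x ∈ s,
    ∀ (v : TangentSpace (𝓡 m) x), ‖mfderiv (𝓡 m) (𝓡 m) h x v‖ ≤ C * ‖v‖) ⟨0, by simp⟩
    (fun s t hst ⟨C, hC⟩ => ⟨C, fun x hx => hC x (hst hx)⟩)
    (fun s t ⟨C, hC⟩ ⟨C', hC'⟩ => ⟨max C C', by
      rintro x (hx | hx) v
      · exact (hC x hx v).trans (mul_le_mul_of_nonneg_right (le_max_left _ _) (norm_nonneg _))
      · exact (hC' x hx v).trans (mul_le_mul_of_nonneg_right (le_max_right _ _) (norm_nonneg _))⟩)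
    (fun x _ => by
      obtain ⟨C, -, hC⟩ := eventually_norm_mfderiv_le (hh x)
      exact ⟨_, mem_nhdsWithin_of_mem_nhds hC, C, fun y hy => hy⟩)
  obtain ⟨C, hC⟩ := this
  exact ⟨C, fun x => hC x (mem_univ x)⟩

/-- The logarithm of the stable Jacobian of `f^n`. -/
def logJac (n : ℕ) (x : StableManifold f O) : ℝ :=
  Real.log (stableJacobian (m := m) f O f^[n] x)

theorem exists_stableJacobian_iterate_bound : ∃ C, 1 ≤ C ∧ ∀ (x : StableManifold f O),
    stableJacobian (m := m) f O f^[1] x ∈ Icc (C⁻¹) C := by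
  obtain ⟨C₁, h₁⟩ := exists_norm_mfderiv_le f.contMDiff
  obtain ⟨C₂, h₂⟩ := exists_norm_mfderiv_le f.symm.contMDiff
  set C := max 1 (max C₁ C₂)
  have hC1 : 1 ≤ C := le_max_left _ _
  have hC0 : 0 < C := by linarith
  -- The dimension of the stable tangent space is only known to be at most `m`; since `1 ≤ C`, the
  -- exponent `m` serves at every point.
  refine ⟨C ^ m, one_le_pow₀ hC1, fun x => ?_⟩
  have hb : ∀ v : stableTangent f O x, C⁻¹ * norm (E := TangentSpace (𝓡 m) x.1) v.1 ≤
      ‖(mfderiv (𝓡 m) (𝓡 m) f^[1] x.1).toLinearMap.domRestrict (stableTangent f O x) v‖ ∧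
      ‖(mfderiv (𝓡 m) (𝓡 m) f^[1] x.1).toLinearMap.domRestrict (stableTangent f O x) v‖
        ≤ C * norm (E := TangentSpace (𝓡 m) x.1) v.1 := by
    intro v
    constructor
    · have e1 := h₂ (f x.1) (mfderiv (𝓡 m) (𝓡 m) f x.1 v.1)
      have e2 : ∀ y : M, y = x.1 → ∀ w : EuclideanSpace ℝ (Fin m),
          norm (E := TangentSpace (𝓡 m) y) w = norm (E := TangentSpace (𝓡 m) x.1) w := by
        rintro y rfl w; rfl
      have e3 := mfderiv_leftInverse_apply f.symm.contMDiff f.contMDiff f.symm_apply_apply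
        (x := x.1) rfl v.1
      rw [inv_mul_le_iff₀ hC0]
      have e4 := e2 (f.symm (f x.1)) (f.symm_apply_apply x.1) v.1
      have e5 := (congrArg (norm (E := TangentSpace (𝓡 m) (f.symm (f x.1)))) e3).ge.trans e1
      refine (e4.ge.trans e5).trans ?_
      exact mul_le_mul_of_nonneg_right ((le_max_right _ _).trans (le_max_right _ _)) (norm_nonneg _)
    · exact (h₁ x.1 v.1).trans (mul_le_mul_of_nonneg_right
        ((le_max_left _ _).trans (le_max_right _ _)) (norm_nonneg _))
  obtain ⟨h3, h4⟩ := jacobian_mem_Icc (V := stableTangent f O x) (c := C⁻¹) (C := C) (by positivity)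
    fun v => hb v
  have hd : Module.finrank ℝ (stableTangent f O x) ≤ m :=
    (Submodule.finrank_le _).trans_eq (finrank_euclideanSpace_fin (𝕜 := ℝ) (n := m))
  refine ⟨le_trans ?_ h3, h4.trans (pow_le_pow_right₀ hC1 hd)⟩
  rw [← inv_pow]
  exact pow_le_pow_of_le_one (by positivity) (inv_le_one_of_one_le₀ hC1) hd

include hO hO' hne in
theorem stableJacobian_iterate_pos (n : ℕ) (x : StableManifold f O) :
    0 < stableJacobian (m := m) f O f^[n] x := by
  obtain ⟨C, hC, hb⟩ := exists_stableJacobian_iterate_bound (m := m) f (O := O)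
  induction n generalizing x with
  | zero =>
    have h1 : 0 < stableJacobian (m := m) f O f^[1] x :=
      (inv_pos.2 (by linarith)).trans_le (hb x).1
    have h2 := stableJacobian_iterate_add f hO hO' hne 1 0 x
    have h3 : stableIter f hO hne 0 x = x := rfl
    rw [h3, show 1 + 0 = 1 from rfl] at h2
    by_contra h4
    have h5 : 0 ≤ stableJacobian (m := m) f O f^[0] x := Real.sqrt_nonneg _
    have h6 : stableJacobian (m := m) f O f^[0] x = 0 := le_antisymm (not_lt.1 h4) h5
    rw [h6, mul_zero] at h2
    exact h1.ne' h2
  | succ n ih =>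
    rw [stableJacobian_iterate_add f hO hO' hne n 1 x]
    exact mul_pos (ih _) ((inv_pos.2 (by linarith)).trans_le (hb x).1)

include hO' in
theorem logJac_add (n k : ℕ) (x : StableManifold f O) :
    logJac (m := m) f (n + k) x = logJac f n (stableIter f hO hne k x) + logJac f k x := by
  rw [logJac, stableJacobian_iterate_add f hO hO' hne, Real.log_mul
    (stableJacobian_iterate_pos f hO hO' hne _ _).ne'
    (stableJacobian_iterate_pos f hO hO' hne _ _).ne']
  rfl

include hO hO' hne in
theorem exists_logJac_bound : ∃ c, 0 ≤ c ∧ ∀ n (x : StableManifold f O),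
    |logJac (m := m) f n x| ≤ n * c := by
  obtain ⟨C, hC, hb⟩ := exists_stableJacobian_iterate_bound (m := m) f (O := O)
  refine ⟨Real.log C, Real.log_nonneg hC, fun n => ?_⟩
  have h1 : ∀ x : StableManifold f O, |logJac (m := m) f 1 x| ≤ Real.log C := by
    intro x
    have h2 : 0 < C⁻¹ := inv_pos.2 (by linarith)
    rw [abs_le, ← Real.log_inv]
    exact ⟨Real.log_le_log h2 (hb x).1, Real.log_le_log (h2.trans_le (hb x).1) (hb x).2⟩
  induction n with
  | zero =>
    intro x
    have h2 := logJac_add f hO hO' hne 0 0 x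
    have h3 : stableIter f hO hne 0 x = x := rfl
    rw [h3, show 0 + 0 = 0 from rfl] at h2
    have h4 : logJac (m := m) f 0 x = 0 := by linarith
    simp [h4]
  | succ n ih =>
    intro x
    rw [logJac_add f hO hO' hne n 1 x]
    push_cast
    have := abs_add_le (logJac f n (stableIter f hO hne 1 x)) (logJac (m := m) f 1 x)
    linarith [ih (stableIter f hO hne 1 x), h1 x]

end Cocycle
end
end StableDistortion

/-! ### The tangent space of `W^s(O)` in local coordinates -/

namespace StableDistortion
noncomputable section

section Iterates

variable {M : Type*} [MetricSpace M] [CompactSpace M] {f : M → M}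

theorem exists_equicontinuous_iterates (hf : Continuous f) (q : ℕ) {ε : ℝ} (hε : 0 < ε) :
    ∃ δ > 0, ∀ r < q, ∀ x y, dist x y < δ → dist (f^[r] x) (f^[r] y) < ε := by
  induction q with
  | zero => exact ⟨1, one_pos, by simp⟩
  | succ q ih =>
    obtain ⟨δ, hδ, h⟩ := ih
    obtain ⟨δ', hδ', h'⟩ := Metric.uniformContinuous_iff.1
      (CompactSpace.uniformContinuous_of_continuous (hf.iterate q)) ε hε
    refine ⟨min δ δ', lt_min hδ hδ', fun r hr x y hxy => ?_⟩
    rcases Nat.lt_succ_iff_lt_or_eq.1 hr with hr | rfl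
    · exact h r hr x y (hxy.trans_le (min_le_left _ _))
    · exact h' (hxy.trans_le (min_le_right _ _))

omit [MetricSpace M] [CompactSpace M] in
theorem iterate_eq_mod_div (f : M → M) (q n : ℕ) (x : M) :
    f^[n] x = f^[n % q] ((f^[q])^[n / q] x) := by
  rw [← Function.iterate_mul, ← Function.iterate_add_apply, Nat.mod_add_div]

theorem exists_dist_iterate_lt (hf : Continuous f) {q : ℕ} (hq : 1 ≤ q) {ε : ℝ} (hε : 0 < ε) :
    ∃ δ > 0, ∀ x y, (∀ n, dist ((f^[q])^[n] x) ((f^[q])^[n] y) < δ) →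
      ∀ n, dist (f^[n] x) (f^[n] y) < ε := by
  obtain ⟨δ, hδ, h⟩ := exists_equicontinuous_iterates hf q hε
  refine ⟨δ, hδ, fun x y hxy n => ?_⟩
  rw [iterate_eq_mod_div f q n x, iterate_eq_mod_div f q n y]
  exact h _ (Nat.mod_lt _ hq) _ _ (hxy _)

end Iterates

section Param

variable {m : ℕ} {M : Type*} [MetricSpace M] [ChartedSpace (EuclideanSpace ℝ (Fin m)) M]
  {F : Type*} [NormedAddCommGroup F] [InnerProductSpace ℝ F]

/-- The derivative of the parametrization. -/
def StableParam.parDeriv {T : M → M} {p : M} (sp : StableParam m T p F) (b : F) :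
    F →ₗ[ℝ] TangentSpace (𝓡 m) (sp.par b) :=
  ContinuousLinearMap.toLinearMap (M := F) (mfderiv 𝓘(ℝ, F) (𝓡 m) sp.par b)

/-- The map induced by `h` in the coordinates of the local stable manifold. -/
def StableParam.conj {T : M → M} {p : M} (sp : StableParam m T p F) (h : M → M) : F → F :=
  sp.coord ∘ h ∘ sp.par

variable {T : M → M} {p : M} (sp : StableParam m T p F)

namespace StableParam

theorem coord_base : sp.coord p = 0 := by
  have := sp.coord_par 0 (Metric.mem_ball_self sp.rad_pos)
  rwa [sp.par_zero] at this

theorem tendsto_par : Tendsto sp.par (𝓝 0) (𝓝 p) := by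
  have := (sp.contMDiffAt_par 0 (Metric.mem_ball_self sp.rad_pos)).continuousAt.tendsto
  rwa [sp.par_zero] at this

theorem tendsto_coord : Tendsto sp.coord (𝓝 p) (𝓝 0) := by
  have := (sp.contMDiffAt_coord p sp.mem_nbhd).continuousAt.tendsto
  rwa [sp.coord_base] at this

/-- Makes "the whole orbit stays near `p`" stable under small changes of the parameter, at the cost
of a factor `2`, so that identities valid for such orbits can be differentiated. -/
theorem eventually_orbit_mem_ball {ε : ℝ} (hε : 0 < ε) {a : F} (ha : a ∈ Metric.ball 0 sp.rad)
    (horb : ∀ n, T^[n] (sp.par a) ∈ Metric.ball p (ε / 2)) :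
    ∀ᶠ b in 𝓝 a, b ∈ Metric.ball 0 sp.rad ∧ ∀ n, T^[n] (sp.par b) ∈ Metric.ball p ε := by
  filter_upwards [sp.equicontinuous a ha (ε / 2) (half_pos hε), Metric.isOpen_ball.mem_nhds ha]
    with b hb hb'
  refine ⟨hb', fun n => ?_⟩
  have h1 := hb n
  have h2 := horb n
  rw [Metric.mem_ball] at h2 ⊢
  linarith [dist_triangle (T^[n] (sp.par b)) (T^[n] (sp.par a)) p]

theorem mfderiv_coord_parDeriv {a : F} (ha : a ∈ Metric.ball 0 sp.rad) (hn : sp.par a ∈ sp.nbhd)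
    (v : F) : (mfderiv (𝓡 m) 𝓘(ℝ, F) sp.coord (sp.par a) (sp.parDeriv a v) : F) = v := by
  have h1 := mfderiv_comp a ((sp.contMDiffAt_coord _ hn).mdifferentiableAt (by simp))
    ((sp.contMDiffAt_par a ha).mdifferentiableAt (by simp))
  have h2 : sp.coord ∘ sp.par =ᶠ[𝓝 a] id := by
    filter_upwards [Metric.isOpen_ball.mem_nhds ha] with b hb
    exact sp.coord_par b hb
  rw [h2.mfderiv_eq, mfderiv_id] at h1
  exact (congrArg (fun L : F →L[ℝ] F => L v) h1).symm

theorem parDeriv_injective {a : F} (ha : a ∈ Metric.ball 0 sp.rad) (hn : sp.par a ∈ sp.nbhd) :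
    Function.Injective (sp.parDeriv a) :=
  Function.LeftInverse.injective (g := fun w => (mfderiv (𝓡 m) 𝓘(ℝ, F) sp.coord (sp.par a) w : F))
    (sp.mfderiv_coord_parDeriv ha hn)

theorem contDiffAt_conj {h : M → M} (hh : ContMDiff (𝓡 m) (𝓡 m) 1 h) {a : F}
    (ha : a ∈ Metric.ball 0 sp.rad) (hn : h (sp.par a) ∈ sp.nbhd) :
    ContDiffAt ℝ 1 (sp.conj h) a := by
  rw [← contMDiffAt_iff_contDiffAt]
  exact (sp.contMDiffAt_coord _ hn).comp a ((hh (sp.par a)).comp a (sp.contMDiffAt_par a ha))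

end StableParam
end Param

section Tangent

variable {m : ℕ} {M : Type*} [MetricSpace M] [CompactSpace M]
  [ChartedSpace (EuclideanSpace ℝ (Fin m)) M]
  {F : Type*} [NormedAddCommGroup F] [InnerProductSpace ℝ F] {f : M → M} {O : Set M}
  {q : ℕ} {p : M} (sp : StableParam m f^[q] p F)

namespace StableParam

theorem uniform_infDist (hf : Continuous f) (hq : 1 ≤ q) (hO : MapsTo f O O) (hp : p ∈ O) {ε : ℝ}
    (hε : 0 < ε) : ∃ n₀, ∀ z, (∀ n, (f^[q])^[n] z ∈ sp.nbhd) → ∀ n ≥ n₀,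
      Metric.infDist (f^[n] z) O < ε := by
  obtain ⟨δ, hδ, h⟩ := exists_equicontinuous_iterates hf q hε
  obtain ⟨k, hk⟩ := sp.uniform_tendsto δ hδ
  refine ⟨q * k, fun z hz n hn => ?_⟩
  have h1 := hk z hz (n / q) ((Nat.le_div_iff_mul_le hq).2 (by rwa [mul_comm]))
  rw [iterate_eq_mod_div f q n z]
  exact (Metric.infDist_le_dist_of_mem (hO.iterate _ hp)).trans_lt (h _ (Nat.mod_lt _ hq) _ _ h1)

theorem mem_stableSet (hf : Continuous f) (hq : 1 ≤ q) (hO : MapsTo f O O) (hp : p ∈ O) {z : M}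
    (hz : ∀ n, (f^[q])^[n] z ∈ sp.nbhd) : z ∈ stableSet f O := by
  show Tendsto (fun n : ℕ => Metric.infDist (f^[n] z) O) atTop (𝓝 0)
  refine tendsto_order.2 ⟨fun a ha => Eventually.of_forall fun n =>
    ha.trans_le Metric.infDist_nonneg, fun ε hε => ?_⟩
  obtain ⟨n₀, h⟩ := sp.uniform_infDist hf hq hO hp hε
  filter_upwards [eventually_ge_atTop n₀] with n hn
  exact h z hz n hn

/-- Continuity in the intrinsic topology forces a curve through the point to stay, for small times,
in the image of the parametrization, so its velocity is in the range of the derivative. Conversely,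
each vector of the range is the velocity of the image of a curve of parameters. -/
theorem stableTangent_eq (hf : Continuous f) (hq : 1 ≤ q) (hO : MapsTo f O O) (hp : p ∈ O)
    {ε : ℝ} (hε : 0 < ε) (hball : Metric.ball p ε ⊆ sp.nbhd) {a : F}
    (ha : a ∈ Metric.ball 0 sp.rad)
    (horb : ∀ n, (f^[q])^[n] (sp.par a) ∈ Metric.ball p (ε / 2)) (hx : sp.par a ∈ stableSet f O) :
    stableTangent f O ⟨sp.par a, hx⟩ = LinearMap.range (sp.parDeriv a) := by
  have hgood := sp.eventually_orbit_mem_ball hε ha horb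
  apply le_antisymm
  · refine Submodule.span_le.2 ?_
    rintro _ ⟨γ, hγ, hγC, hγ0, rfl⟩
    have h0 : (γ 0).1 = sp.par a := congrArg Subtype.val hγ0
    have h1 : ∀ᶠ t in 𝓝 (0 : ℝ), sp.par (sp.coord (γ t).1) = (γ t).1 := by
      have h2 := tendsto_stableManifold.1 (hγ.tendsto 0) (ε / 2) (half_pos hε)
      filter_upwards [h2] with t ht
      refine sp.par_coord _ fun n => hball ?_
      have h3 := ht (q * n)
      have h4 := horb n
      rw [h0, Function.iterate_mul] at h3
      rw [Metric.mem_ball] at h4 ⊢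
      rw [dist_comm] at h3
      linarith [dist_triangle ((f^[q])^[n] (γ t).1) ((f^[q])^[n] (sp.par a)) p]
    have hn : sp.par a ∈ sp.nbhd := hball (Metric.ball_subset_ball (by linarith) (horb 0))
    have h5 : (fun t => (γ t).1) =ᶠ[𝓝 0] sp.par ∘ (fun t => sp.coord (γ t).1) := by
      filter_upwards [h1] with t ht using ht.symm
    have h6 : HasMFDerivAt 𝓘(ℝ, F) (𝓡 m) sp.par (sp.coord (γ 0).1)
        (mfderiv 𝓘(ℝ, F) (𝓡 m) sp.par a : F →L[ℝ] EuclideanSpace ℝ (Fin m)) := by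
      rw [h0, sp.coord_par a ha]
      exact ((sp.contMDiffAt_par a ha).mdifferentiableAt (by simp)).hasMFDerivAt
    have h7 : MDifferentiableAt 𝓘(ℝ, ℝ) 𝓘(ℝ, F) (fun t => sp.coord (γ t).1) 0 := by
      have h8 : MDifferentiableAt (𝓡 m) 𝓘(ℝ, F) sp.coord (γ 0).1 := by
        rw [h0]; exact (sp.contMDiffAt_coord _ hn).mdifferentiableAt (by simp)
      exact h8.comp (0 : ℝ) (hγC.mdifferentiable (by simp) 0)
    have h9 := (h6.comp (0 : ℝ) h7.hasMFDerivAt).congr_of_eventuallyEq h5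
    rw [h9.mfderiv]
    exact ⟨_, rfl⟩
  · rintro _ ⟨v, rfl⟩
    obtain ⟨η, hη, hηb⟩ := Metric.eventually_nhds_iff_ball.1 hgood
    set δ := η / (‖v‖ + 1) with hδ
    have hδ0 : 0 < δ := by positivity
    -- Admissible curves are defined on all of `ℝ`. The sine keeps the parameter within `η` of `a`
    -- and still gives velocity `v` at `0`.
    let c : ℝ → F := fun t => a + (δ * Real.sin (t / δ)) • v
    have hc0 : c 0 = a := by simp [c]
    have hcη : ∀ t, c t ∈ Metric.ball a η := by
      intro t
      rw [mem_ball_iff_norm, add_sub_cancel_left, norm_smul, norm_mul, Real.norm_of_nonneg hδ0.le]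
      have h1 : ‖Real.sin (t / δ)‖ ≤ 1 := Real.abs_sin_le_one _
      calc δ * ‖Real.sin (t / δ)‖ * ‖v‖ ≤ δ * 1 * ‖v‖ := by gcongr
        _ = η * (‖v‖ / (‖v‖ + 1)) := by rw [hδ]; ring
        _ < η * 1 := by
          gcongr
          rw [div_lt_one (by positivity)]; linarith
        _ = η := mul_one η
    have hcC : ContDiff ℝ 1 c := by
      refine contDiff_const.add (ContDiff.smul ?_ contDiff_const)
      exact contDiff_const.mul (Real.contDiff_sin.comp (contDiff_id.div_const δ))
    have hcd : HasDerivAt c v 0 := by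
      have h1 : HasDerivAt (fun t : ℝ => δ * Real.sin (t / δ)) 1 0 := by
        have h2 : HasDerivAt (fun t : ℝ => t / δ) (1 / δ) 0 := (hasDerivAt_id 0).div_const δ
        have h3 := (h2.sin).const_mul δ
        simpa [hδ0.ne'] using h3
      have h4 := (h1.smul_const v).const_add a
      rwa [one_smul] at h4
    have hst : ∀ t, sp.par (c t) ∈ stableSet f O := fun t =>
      sp.mem_stableSet hf hq hO hp fun n => hball ((hηb _ (hcη t)).2 n)
    refine Submodule.subset_span ⟨fun t => ⟨sp.par (c t), hst t⟩, ?_, ?_, Subtype.ext ?_, ?_⟩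
    · refine continuous_iff_continuousAt.2 fun t => tendsto_stableManifold.2 fun ε' hε' => ?_
      obtain ⟨δ', hδ', h⟩ := exists_dist_iterate_lt hf hq hε'
      have h1 := sp.equicontinuous (c t) (hηb _ (hcη t)).1 δ' hδ'
      filter_upwards [hcC.continuous.continuousAt.eventually h1] with s hs n
      rw [dist_comm]
      exact (h _ _ hs n).le
    · intro t
      exact (sp.contMDiffAt_par _ (hηb _ (hcη t)).1).comp t hcC.contDiffAt.contMDiffAt
    · show sp.par (c 0) = sp.par a
      rw [hc0]
    · have h6 : HasMFDerivAt 𝓘(ℝ, F) (𝓡 m) sp.par (c 0)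
          (mfderiv 𝓘(ℝ, F) (𝓡 m) sp.par a : F →L[ℝ] EuclideanSpace ℝ (Fin m)) := by
        rw [hc0]
        exact ((sp.contMDiffAt_par a ha).mdifferentiableAt (by simp)).hasMFDerivAt
      have h9 := h6.comp (0 : ℝ) hcd.hasFDerivAt.hasMFDerivAt
      have h10 := h9.mfderiv
      have h11 := congrArg (fun L : ℝ →L[ℝ] EuclideanSpace ℝ (Fin m) => L 1) h10
      refine Eq.trans ?_ h11.symm
      show sp.parDeriv a v = (mfderiv 𝓘(ℝ, F) (𝓡 m) sp.par a : F →L[ℝ] EuclideanSpace ℝ (Fin m))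
        ((ContinuousLinearMap.toSpanSingleton ℝ v) 1)
      rw [ContinuousLinearMap.toSpanSingleton_apply, one_smul]
      rfl

end StableParam
end Tangent
end
end StableDistortion

/-! ### Stable Jacobians at points related by a conjugacy -/

namespace StableDistortion
noncomputable section

instance {F : Type*} [NormedAddCommGroup F] [InnerProductSpace ℝ F] :
    IsContinuousRiemannianBundle F (fun x : F => TangentSpace 𝓘(ℝ, F) x) := by
  obtain ⟨g, hg, h⟩ := IsContMDiffRiemannianBundle.exists_contMDiff (IB := 𝓘(ℝ, F)) (n := 1) (F := F)
    (E := fun x : F => TangentSpace 𝓘(ℝ, F) x)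
  exact ⟨g, hg.continuous, h⟩

variable {m : ℕ} {M : Type*} [MetricSpace M] [ChartedSpace (EuclideanSpace ℝ (Fin m)) M]
  [IsManifold (𝓡 m) 1 M] [RiemannianBundle (fun x : M => TangentSpace (𝓡 m) x)]
  [IsContinuousRiemannianBundle (EuclideanSpace ℝ (Fin m)) (fun x : M => TangentSpace (𝓡 m) x)]
  {F : Type*} [NormedAddCommGroup F] [InnerProductSpace ℝ F]

namespace StableParam

section

variable {T : M → M} {p : M} (sp : StableParam m T p F)

/-- The parametrization and its `C^1` left inverse both have locally bounded derivatives. -/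
theorem exists_jacobian_parDeriv_mem_Icc [FiniteDimensional ℝ F] :
    ∃ c > 0, ∃ C > 0, ∀ᶠ b in 𝓝 (0 : F), jacobian (sp.parDeriv b) ∈ Icc c C := by
  have h0 := Metric.mem_ball_self (x := (0 : F)) sp.rad_pos
  obtain ⟨C, hC, h1⟩ := eventually_norm_mfderiv_le (sp.contMDiffAt_par 0 h0)
  obtain ⟨c, hc, h2⟩ := eventually_norm_mfderiv_le (sp.contMDiffAt_coord p sp.mem_nbhd)
  refine ⟨c⁻¹ ^ Module.finrank ℝ F, by positivity, C ^ Module.finrank ℝ F, by positivity, ?_⟩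
  filter_upwards [h1, sp.tendsto_par.eventually h2, Metric.isOpen_ball.mem_nhds h0,
    sp.tendsto_par.eventually (sp.isOpen_nbhd.mem_nhds sp.mem_nbhd)] with b hb1 hb2 hb3 hb4
  refine jacobian_mem_Icc (A := sp.parDeriv b) (by positivity) fun v => ⟨?_, ?_⟩
  · have h3 := hb2 (sp.parDeriv b v)
    rw [norm_tangentSpace_vectorSpace] at h3
    have h4 := congrArg (norm (E := F)) (sp.mfderiv_coord_parDeriv hb3 hb4 v)
    rw [inv_mul_le_iff₀ hc]
    exact h4.ge.trans h3
  · have h3 := hb1 v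
    rw [norm_tangentSpace_vectorSpace (v := v)] at h3
    exact h3

theorem exists_lipschitzOnWith_conj [IsRiemannianManifold (𝓡 m) M] {h : M → M} (hp : h p = p)
    {K : NNReal} {s : Set M} (hs : s ∈ 𝓝 p) (hh : LipschitzOnWith K h s) :
    ∃ K' : NNReal, ∃ t ∈ 𝓝 (0 : F), LipschitzOnWith K' (sp.conj h) t := by
  have h0 := Metric.mem_ball_self (x := (0 : F)) sp.rad_pos
  obtain ⟨K₁, s₁, hs₁, h₁⟩ := exists_lipschitzOnWith_of_contMDiffAt (sp.contMDiffAt_par 0 h0)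
  obtain ⟨K₂, s₂, hs₂, h₂⟩ :=
    exists_lipschitzOnWith_of_contMDiffAt (sp.contMDiffAt_coord p sp.mem_nbhd)
  have hhc : Tendsto h (𝓝 p) (𝓝 p) := by
    have := (hh.continuousOn.continuousAt hs).tendsto
    rwa [hp] at this
  refine ⟨K₂ * (K * K₁), s₁ ∩ sp.par ⁻¹' (s ∩ h ⁻¹' s₂), inter_mem hs₁
    (sp.tendsto_par (inter_mem hs (hhc hs₂))), ?_⟩
  exact h₂.comp (hh.comp (h₁.mono inter_subset_left) fun b hb => hb.2.1) fun b hb => hb.2.2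

end

variable [CompactSpace M] [FiniteDimensional ℝ F] {f : M → M} {O : Set M}
  {q : ℕ} {p : M} (sp : StableParam m f^[q] p F)

omit [IsManifold (𝓡 m) 1 M]
  [IsContinuousRiemannianBundle (EuclideanSpace ℝ (Fin m)) (fun x : M => TangentSpace (𝓡 m) x)] in
-- Jacobians of both sides of `T^k ∘ par = par ∘ u` near `a`, where `T = f^q` and `u` is `T^k` in
-- coordinates.
theorem stableJacobian_mul_jacobian_parDeriv (hf : ContMDiff (𝓡 m) (𝓡 m) 1 f) (hq : 1 ≤ q)
    (hO : MapsTo f O O) (hp : p ∈ O) {ε : ℝ} (hε : 0 < ε) (hball : Metric.ball p ε ⊆ sp.nbhd)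
    {a : F} (ha : a ∈ Metric.ball 0 sp.rad)
    (horb : ∀ n, (f^[q])^[n] (sp.par a) ∈ Metric.ball p (ε / 2)) (hx : sp.par a ∈ stableSet f O)
    (k : ℕ) :
    stableJacobian (m := m) f O (f^[q])^[k] ⟨sp.par a, hx⟩ * jacobian (sp.parDeriv a) =
      jacobian (sp.parDeriv (sp.conj (f^[q])^[k] a)) *
        |(fderiv ℝ (sp.conj (f^[q])^[k]) a).det| := by
  have hTk := contMDiff_iterate (contMDiff_iterate hf q) k
  have hball' : Metric.ball p (ε / 2) ⊆ sp.nbhd :=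
    (Metric.ball_subset_ball (by linarith)).trans hball
  have hn : sp.par a ∈ sp.nbhd := hball' (horb 0)
  have horb' : ∀ b, (∀ n, (f^[q])^[n] (sp.par b) ∈ sp.nbhd) →
      ∀ n, (f^[q])^[n] ((f^[q])^[k] (sp.par b)) ∈ sp.nbhd := fun b hb n => by
    rw [← Function.iterate_add_apply]; exact hb _
  have hpar : ∀ b, (∀ n, (f^[q])^[n] (sp.par b) ∈ sp.nbhd) →
      sp.par (sp.conj (f^[q])^[k] b) = (f^[q])^[k] (sp.par b) := fun b hb =>
    sp.par_coord _ (horb' b hb)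
  have hua : sp.conj (f^[q])^[k] a ∈ Metric.ball 0 sp.rad :=
    sp.coord_mem _ (horb' a fun n => hball' (horb n))
  have hu : ContDiffAt ℝ 1 (sp.conj (f^[q])^[k]) a := sp.contDiffAt_conj hTk ha (hball' (horb k))
  have h1 := mfderiv_comp a (hTk.mdifferentiable (by simp) (sp.par a))
    ((sp.contMDiffAt_par a ha).mdifferentiableAt (by simp))
  have h2 := mfderiv_comp a ((sp.contMDiffAt_par _ hua).mdifferentiableAt (by simp))
    (hu.differentiableAt (by simp)).mdifferentiableAt
  have h3 : (f^[q])^[k] ∘ sp.par =ᶠ[𝓝 a] sp.par ∘ sp.conj (f^[q])^[k] := by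
    filter_upwards [sp.eventually_orbit_mem_ball hε ha horb] with b hb
    exact (hpar b fun n => hball (hb.2 n)).symm
  rw [mfderiv_eq_fderiv] at h2
  change _ = jacobian (sp.parDeriv (sp.conj (f^[q])^[k] a)) *
    |LinearMap.det (fderiv ℝ (sp.conj (f^[q])^[k]) a).toLinearMap|
  rw [← jacobian_comp_endo]
  have h4 := jacobian_comp (A := sp.parDeriv a) (sp.parDeriv_injective ha hn)
    (sp.stableTangent_eq hf.continuous hq hO hp hε hball ha horb hx).symm
    (mfderiv (𝓡 m) (𝓡 m) (f^[q])^[k] (sp.par a)).toLinearMap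
  refine h4.symm.trans ?_
  have h5 : ∀ y y' : M, y = y' → ∀ A : F →ₗ[ℝ] EuclideanSpace ℝ (Fin m),
      jacobian (W := TangentSpace (𝓡 m) y) A = jacobian (W := TangentSpace (𝓡 m) y') A := by
    rintro y _ rfl A; rfl
  refine Eq.trans ?_ (h5 _ _ (hpar a fun n => hball' (horb n)).symm _)
  congr 1
  have h6 := h1.symm.trans (h3.mfderiv_eq.trans h2)
  exact congrArg (fun L : F →L[ℝ] EuclideanSpace ℝ (Fin m) => L.toLinearMap) h6


variable [IsRiemannianManifold (𝓡 m) M]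

/-- The heart of the proof: `ε` and `C` are chosen before `k`. In coordinates `h` is bi-Lipschitz
and commutes with every iterate of the return map, so `abs_det_le_of_conj` bounds the determinants
uniformly; the parametrization contributes a bounded factor. -/
theorem exists_stableJacobian_le_of_conj (sp : StableParam m f^[q] p F)
    (hf : ContMDiff (𝓡 m) (𝓡 m) 1 f) (hq : 1 ≤ q)
    (hO : MapsTo f O O) (hp : p ∈ O) {h h' : M → M} (hh : ∀ z, h' (h z) = z)
    (hcomm : ∀ n z, (f^[q])^[n] (h z) = h ((f^[q])^[n] z)) (hhp : h p = p)
    {K : NNReal} {s : Set M} (hs : s ∈ 𝓝 p) (hL : LipschitzOnWith K h s)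
    {K' : NNReal} {s' : Set M} (hs' : s' ∈ 𝓝 p) (hL' : LipschitzOnWith K' h' s') :
    ∃ ε > 0, ∃ C > 0, ∀ x y : StableManifold f O, y.1 = h x.1 →
      (∀ n, (f^[q])^[n] x.1 ∈ Metric.ball p ε) → ∀ k,
      stableJacobian (m := m) f O (f^[q])^[k] y ≤ C * stableJacobian (m := m) f O (f^[q])^[k] x := by
  have hhc : Tendsto h (𝓝 p) (𝓝 p) := by
    have := (hL.continuousOn.continuousAt hs).tendsto
    rwa [hhp] at this
  have hhp' : h' p = p := by conv_lhs => rw [← hhp, hh]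
  obtain ⟨K₁, t₁, ht₁, hK₁⟩ := sp.exists_lipschitzOnWith_conj hhp hs hL
  obtain ⟨K₂, t₂, ht₂, hK₂⟩ := sp.exists_lipschitzOnWith_conj hhp' hs' hL'
  obtain ⟨c, hc, C, hC, hcC⟩ := sp.exists_jacobian_parDeriv_mem_Icc
  obtain ⟨r, hr, hball⟩ := Metric.eventually_nhds_iff_ball.1 ((hcC.and
    (eventually_mem_nhds_iff.2 ht₁)).and (eventually_mem_nhds_iff.2 ht₂))
  obtain ⟨ε₀, hε₀, hε₀b⟩ := Metric.nhds_basis_ball.mem_iff.1 (sp.isOpen_nbhd.mem_nhds sp.mem_nbhd)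
  obtain ⟨ε, hε, hεb⟩ := Metric.eventually_nhds_iff_ball.1
    (((hhc.eventually (Metric.ball_mem_nhds p (half_pos hε₀))).and
      (sp.tendsto_coord.eventually (Metric.ball_mem_nhds 0 hr))).and
      (((sp.tendsto_coord.comp hhc).eventually (Metric.ball_mem_nhds 0 hr)).and
      (Metric.ball_mem_nhds p hε₀)))
  have hn : Metric.ball p ε ⊆ sp.nbhd := fun z hz => hε₀b (hεb z hz).2.2
  have hn' : ∀ z ∈ Metric.ball p ε, h z ∈ sp.nbhd := fun z hz =>
    hε₀b (Metric.ball_subset_ball (by linarith) (hεb z hz).1.1)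
  set K₀ := max K₁ K₂
  set P : ℝ := (K₀ : ℝ) ^ (2 * Module.finrank ℝ F)
  have hP : 0 ≤ P := by positivity
  -- The factor `P` compares the determinants, and each of the two passages between determinants and
  -- stable Jacobians costs `C / c`. The `+ 1` makes the constant positive.
  refine ⟨ε / 2, half_pos hε, (C / c) ^ 2 * P + 1, by positivity, ?_⟩
  rintro ⟨x, hx⟩ ⟨y, hy⟩ hyx horb k
  change y = h x at hyx
  subst hyx
  change ∀ n, (f^[q])^[n] x ∈ Metric.ball p (ε / 2) at horb
  have hbb : Metric.ball p (ε / 2) ⊆ Metric.ball p ε := Metric.ball_subset_ball (by linarith)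
  obtain ⟨a, ha, rfl⟩ : ∃ a ∈ Metric.ball 0 sp.rad, sp.par a = x :=
    ⟨_, sp.coord_mem x fun n => hn (hbb (horb n)), sp.par_coord x fun n => hn (hbb (horb n))⟩
  have hcoord : sp.coord (sp.par a) = a := sp.coord_par a ha
  set u := sp.conj (f^[q])^[k] with hu
  set H := sp.conj h with hH
  have hgood := sp.eventually_orbit_mem_ball hε ha horb
  have hparu : ∀ b, (∀ n, (f^[q])^[n] (sp.par b) ∈ Metric.ball p ε) →
      sp.par (u b) = (f^[q])^[k] (sp.par b) := fun b hb => sp.par_coord _ fun n => by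
    rw [Function.comp_apply, ← Function.iterate_add_apply]; exact hn (hb _)
  have hparH : ∀ b, (∀ n, (f^[q])^[n] (sp.par b) ∈ Metric.ball p ε) →
      sp.par (H b) = h (sp.par b) := fun b hb => sp.par_coord _ fun n => by
    rw [Function.comp_apply, hcomm]; exact hn' _ (hb n)
  have hHu : ∀ b, (∀ n, (f^[q])^[n] (sp.par b) ∈ Metric.ball p ε) → H (u b) = u (H b) := by
    intro b hb
    show sp.coord (h (sp.par (u b))) = sp.coord ((f^[q])^[k] (sp.par (H b)))
    rw [hparu b hb, hparH b hb, hcomm]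
  have horb' : ∀ n, (f^[q])^[n] (sp.par a) ∈ Metric.ball p ε := fun n => hbb (horb n)
  have hHa : H a ∈ Metric.ball 0 sp.rad := sp.coord_mem _ fun n => by
    rw [Function.comp_apply, hcomm]; exact hn' _ (horb' n)
  have ham : a ∈ Metric.ball 0 r := by
    have := (hεb _ (horb' 0)).1.2
    rwa [show (f^[q])^[0] (sp.par a) = sp.par a from rfl, hcoord] at this
  have huam : u a ∈ Metric.ball 0 r := (hεb _ (horb' k)).1.2
  have hHam : H a ∈ Metric.ball 0 r := (hεb _ (horb' 0)).2.1
  have huHam : u (H a) ∈ Metric.ball 0 r := by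
    rw [← hHu a horb']
    show sp.coord (h (sp.par (u a))) ∈ _
    rw [hparu a horb']
    exact (hεb _ (horb' k)).2.1
  have hfk := contMDiff_iterate (contMDiff_iterate hf q) k
  have hdet := abs_det_le_of_conj (u := u) (h := H) (g := sp.conj h') (K := K₀) (a := a)
    ((sp.contDiffAt_conj hfk ha (hn (horb' k))).hasStrictFDerivAt (by simp))
    ((sp.contDiffAt_conj hfk hHa (by
      rw [hparH a horb', hcomm]; exact hn' _ (horb' k))).hasStrictFDerivAt (by simp))
    (hK₁.continuousOn.continuousAt (hball a ham).1.2)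
    (by
      filter_upwards [hgood] with b hb
      show sp.coord (h' (sp.par (H b))) = b
      rw [hparH b hb.2, hh, sp.coord_par b hb.1])
    (hball _ hHam).2 (hK₂.weaken (le_max_right _ _))
    (hball _ huam).1.2 (hK₁.weaken (le_max_left _ _))
    (by filter_upwards [hgood] with b hb using hHu b hb.2)
  have hx' := sp.stableJacobian_mul_jacobian_parDeriv hf hq hO hp hε hn ha horb hx k
  have hyh : sp.par (H a) = h (sp.par a) := hparH a horb'
  have hH0 := fun hy' => sp.stableJacobian_mul_jacobian_parDeriv (a := H a) hf hq hO hp hε₀ hε₀b hHa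
    (by
      rw [hyh]
      intro n
      rw [hcomm]
      exact (hεb _ (horb' n)).1.1) hy' k
  have h5 : ∀ (z : M) (hz : z ∈ stableSet f O), z = h (sp.par a) →
      stableJacobian (m := m) f O (f^[q])^[k] ⟨z, hz⟩ =
        stableJacobian (m := m) f O (f^[q])^[k] ⟨h (sp.par a), hy⟩ := by
    rintro z hz rfl; rfl
  have hyS : sp.par (H a) ∈ stableSet f O := by rw [hyh]; exact hy
  have hy' := hH0 hyS
  rw [h5 _ _ hyh] at hy'
  have b1 := (hball _ ham).1.1
  have b2 := (hball _ huam).1.1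
  have b3 := (hball _ hHam).1.1
  have b4 := (hball _ huHam).1.1
  set X := stableJacobian (m := m) f O (f^[q])^[k] ⟨sp.par a, hx⟩
  set Y := stableJacobian (m := m) f O (f^[q])^[k] ⟨h (sp.par a), hy⟩
  have hX : 0 ≤ X := Real.sqrt_nonneg _
  have hY : 0 ≤ Y := Real.sqrt_nonneg _
  have e1 : c * |(fderiv ℝ u a).det| ≤ X * C := by
    refine (mul_le_mul_of_nonneg_right b2.1 (abs_nonneg _)).trans ?_
    rw [← hx']
    exact mul_le_mul_of_nonneg_left b1.2 hX
  have e2 : Y * c ≤ C * |(fderiv ℝ u (H a)).det| := by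
    refine (mul_le_mul_of_nonneg_left b3.1 hY).trans ?_
    rw [hy']
    exact mul_le_mul_of_nonneg_right b4.2 (abs_nonneg _)
  have e3 : |(fderiv ℝ u a).det| ≤ X * C / c := by rw [le_div_iff₀ hc]; linarith
  have e4 : Y ≤ C * (P * (X * C / c)) / c := by
    rw [le_div_iff₀ hc]
    refine e2.trans (mul_le_mul_of_nonneg_left (hdet.trans ?_) hC.le)
    exact mul_le_mul_of_nonneg_left e3 hP
  calc Y ≤ C * (P * (X * C / c)) / c := e4
    _ = (C / c) ^ 2 * P * X := by field_simp
    _ ≤ ((C / c) ^ 2 * P + 1) * X := by linarith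

end StableParam
end
end StableDistortion

/-! ### From local estimates at `p` to the whole stable manifold -/

namespace StableDistortion
noncomputable section

section Phase

variable {M : Type*} [MetricSpace M] [CompactSpace M] {f : M → M} {O : Set M} {q : ℕ} {p : M}

omit [CompactSpace M] in
-- Along the multiples of `k` the distance to `O` is constant, yet it tends to `0`.
theorem mem_of_iterate_eq (hO : O.Finite) (hne : O.Nonempty) {z : M} (hz : z ∈ stableSet f O) {k : ℕ}
    (hk : 1 ≤ k) (hkz : f^[k] z = z) : z ∈ O := by
  have hz' : Tendsto (fun n : ℕ => Metric.infDist (f^[n] z) O) atTop (𝓝 0) := hz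
  have h1 := hz'.comp (tendsto_id.const_mul_atTop' (show 0 < k from hk))
  have h2 : (fun n : ℕ => Metric.infDist (f^[n] z) O) ∘ (fun n => k * id n) =
      fun _ => Metric.infDist z O := by
    funext n
    show Metric.infDist (f^[k * n] z) O = _
    rw [Function.iterate_mul, Function.iterate_fixed hkz]
  rw [h2] at h1
  have h3 := tendsto_nhds_unique h1 tendsto_const_nhds
  exact (hO.isClosed.mem_iff_infDist_zero hne).2 h3.symm

/-- The points of `O` are separated and fixed by `T`. By uniform continuity, an orbit close to `O`
cannot jump from one of them to another. -/
theorem exists_eventually_dist_lt {T : M → M} (hT : Continuous T) (hO : O.Finite) (hne : O.Nonempty)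
    (hTO : ∀ o ∈ O, T o = o) {x : M}
    (hx : Tendsto (fun n : ℕ => Metric.infDist (T^[n] x) O) atTop (𝓝 0)) {ε : ℝ} (hε : 0 < ε) :
    ∃ o ∈ O, ∃ N, ∀ n ≥ N, dist (T^[n] x) o < ε := by
  obtain ⟨δ, hδ, hsep⟩ : ∃ δ > 0, ∀ o ∈ O, ∀ o' ∈ O, dist o o' < δ → o = o' := by
    have h1 : ∀ᶠ δ in 𝓝[>] (0 : ℝ), ∀ o ∈ O, ∀ o' ∈ O, dist o o' < δ → o = o' := by
      rw [Filter.eventually_all_finite hO]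
      intro o ho
      rw [Filter.eventually_all_finite hO]
      intro o' ho'
      rcases eq_or_ne o o' with h | h
      · exact Eventually.of_forall fun _ _ => h
      · filter_upwards [nhdsWithin_le_nhds (Iio_mem_nhds (dist_pos.2 h))] with δ hδ hd
        exact absurd hd (not_lt.2 (le_of_lt hδ))
    obtain ⟨δ, h, h'⟩ := (h1.and self_mem_nhdsWithin).exists
    exact ⟨δ, h', h⟩
  obtain ⟨η, hη, huc⟩ := Metric.uniformContinuous_iff.1
    (CompactSpace.uniformContinuous_of_continuous hT) (δ / 2) (half_pos hδ)
  set r := min ε (min η (δ / 2)) with hr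
  have hr0 : 0 < r := lt_min hε (lt_min hη (half_pos hδ))
  obtain ⟨N, hN⟩ := eventually_atTop.1 (hx.eventually_lt_const hr0)
  obtain ⟨o, ho, hd⟩ := (Metric.infDist_lt_iff hne).1 (hN N le_rfl)
  refine ⟨o, ho, N, fun n hn => lt_of_lt_of_le (b := r) ?_ (min_le_left _ _)⟩
  induction n, hn using Nat.le_induction with
  | base => exact hd
  | succ n hn ih =>
    obtain ⟨o', ho', hd'⟩ := (Metric.infDist_lt_iff hne).1 (hN (n + 1) (by omega))
    have h1 := huc (ih.trans_le ((min_le_right _ _).trans (min_le_left _ _)))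
    rw [hTO o ho, ← Function.iterate_succ_apply' T n x] at h1
    have h2 := hd'.trans_le ((min_le_right _ _).trans (min_le_right _ _))
    have h3 : o = o' := hsep o ho o' ho' (by
      linarith [dist_triangle_left o o' (T^[n + 1] x)])
    rwa [h3]

/-- The orbit under `f^q` settles near one point `o` of `O`, and a further `j < q` iterates of `f`
carry `o` to `p`. -/
theorem exists_orbit_mem_ball (hf : Continuous f) (hq : 1 ≤ q) (hO : O.Finite)
    (hTO : ∀ o ∈ O, f^[q] o = o) (hOp : ∀ o ∈ O, ∃ j < q, f^[j] o = p) (hne : O.Nonempty) {x : M}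
    (hx : x ∈ stableSet f O) {ε : ℝ} (hε : 0 < ε) :
    ∃ N, ∀ n, (f^[q])^[n] (f^[N] x) ∈ Metric.ball p ε := by
  obtain ⟨δ, hδ, h⟩ := exists_equicontinuous_iterates hf q hε
  have hx' : Tendsto (fun n : ℕ => Metric.infDist (f^[n] x) O) atTop (𝓝 0) := hx
  have hx2 := hx'.comp (tendsto_id.const_mul_atTop' (show 0 < q from hq))
  obtain ⟨o, ho, N, hN⟩ := exists_eventually_dist_lt (T := f^[q]) (x := x) (hf.iterate q) hO hne hTO
    (by
      refine hx2.congr fun n => ?_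
      show Metric.infDist (f^[q * n] x) O = _
      rw [Function.iterate_mul]) hδ
  obtain ⟨j, hj, hjp⟩ := hOp o ho
  refine ⟨j + q * N, fun n => ?_⟩
  have h1 := h j hj _ _ (hN (n + N) (by omega))
  rw [hjp] at h1
  rw [Metric.mem_ball]
  convert h1 using 2
  rw [← Function.iterate_mul, ← Function.iterate_mul, ← Function.iterate_add_apply,
    ← Function.iterate_add_apply]
  congr 1
  ring

end Phase

section Uniform

variable {m : ℕ} {M : Type*} [MetricSpace M] [CompactSpace M]
  [ChartedSpace (EuclideanSpace ℝ (Fin m)) M]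
  {F : Type*} [NormedAddCommGroup F] [InnerProductSpace ℝ F] {f : M → M} {O : Set M}
  {q : ℕ} {p : M}

/-- Points close to `x` in the intrinsic topology follow its whole orbit. They are therefore near
`p` from the same time `N` on, after which convergence is uniform. -/
theorem StableParam.eventually_infDist_lt (sp : StableParam m f^[q] p F) (hf : Continuous f)
    (hq : 1 ≤ q) (hO : MapsTo f O O) (hfin : O.Finite) (hp : p ∈ O)
    (hTO : ∀ o ∈ O, f^[q] o = o) (hOp : ∀ o ∈ O, ∃ j < q, f^[j] o = p) (x : StableManifold f O)
    {ε : ℝ} (hε : 0 < ε) :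
    ∃ n₀, ∀ᶠ z in 𝓝 x, ∀ n ≥ n₀, Metric.infDist (f^[n] z.1) O < ε := by
  obtain ⟨η, hη, hball⟩ := Metric.nhds_basis_ball.mem_iff.1 (sp.isOpen_nbhd.mem_nhds sp.mem_nbhd)
  obtain ⟨N, hN⟩ := exists_orbit_mem_ball hf hq hfin hTO hOp ⟨p, hp⟩ x.2 (half_pos hη)
  obtain ⟨n₀, h⟩ := sp.uniform_infDist hf hq hO hp hε
  refine ⟨n₀ + N, ?_⟩
  filter_upwards [localStable_mem_nhds x (half_pos hη)] with z hz n hn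
  have h1 := h (f^[N] z.1) (fun k => hball ?_) (n - N) (by omega)
  · rwa [← Function.iterate_add_apply, Nat.sub_add_cancel (by omega)] at h1
  · have h2 := hN k
    rw [← Function.iterate_mul, ← Function.iterate_add_apply, Metric.mem_ball] at h2 ⊢
    have h3 := hz (q * k + N)
    rw [dist_comm] at h3
    linarith [dist_triangle (f^[q * k + N] z.1) (f^[q * k + N] x.1) p]

end Uniform

section Distortion

variable {m : ℕ} {M : Type*} [MetricSpace M] [CompactSpace M]
  [ChartedSpace (EuclideanSpace ℝ (Fin m)) M]
  [IsManifold (𝓡 m) 1 M] [RiemannianBundle (fun x : M => TangentSpace (𝓡 m) x)]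
  [IsContinuousRiemannianBundle (EuclideanSpace ℝ (Fin m)) (fun x : M => TangentSpace (𝓡 m) x)]
  [IsRiemannianManifold (𝓡 m) M]
  {F : Type*} [NormedAddCommGroup F] [InnerProductSpace ℝ F] [FiniteDimensional ℝ F]
  (f : M ≃ₘ^1⟮𝓡 m, 𝓡 m⟯ M) {O : Set M} {q : ℕ} {p : M}

theorem exists_logJac_sub_le_of_conj (sp : StableParam m f^[q] p F) (hq : 1 ≤ q)
    (hO : MapsTo f O O) (hO' : MapsTo f.symm O O) (hp : p ∈ O) {h h' : M → M}
    (hh : Function.LeftInverse h' h) (hh' : Function.LeftInverse h h')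
    (hc : ∀ z, h (f z) = f (h z)) (hhp : h p = p)
    {K : NNReal} {s : Set M} (hs : s ∈ 𝓝 p) (hL : LipschitzOnWith K h s)
    {K' : NNReal} {s' : Set M} (hs' : s' ∈ 𝓝 p) (hL' : LipschitzOnWith K' h' s') :
    ∃ ε > 0, ∃ C, ∀ x y : StableManifold f O, y.1 = h x.1 →
      (∀ n, (f^[q])^[n] x.1 ∈ Metric.ball p ε) → ∀ k,
      |logJac (m := m) f (q * k) x - logJac f (q * k) y| ≤ C := by
  have hne : O.Nonempty := ⟨p, hp⟩
  have hc' : ∀ z, h' (f z) = f (h' z) := fun z => by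
    conv_lhs => rw [← hh' z, ← hc, hh]
  have hcomm : ∀ n z, (f^[q])^[n] (h z) = h ((f^[q])^[n] z) := fun n z => by
    rw [← Function.iterate_mul]
    exact (Function.Commute.iterate_right (f := h) (g := f) hc _ z).symm
  have hcomm' : ∀ n z, (f^[q])^[n] (h' z) = h' ((f^[q])^[n] z) := fun n z => by
    rw [← Function.iterate_mul]
    exact (Function.Commute.iterate_right (f := h') (g := f) hc' _ z).symm
  have hhp' : h' p = p := by conv_lhs => rw [← hhp, hh]
  have hhc : Tendsto h (𝓝 p) (𝓝 p) := by
    have := (hL.continuousOn.continuousAt hs).tendsto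
    rwa [hhp] at this
  obtain ⟨ε₁, hε₁, C₁, hC₁, h₁⟩ := sp.exists_stableJacobian_le_of_conj f.contMDiff hq hO hp hh hcomm
    hhp hs hL hs' hL'
  obtain ⟨ε₂, hε₂, C₂, hC₂, h₂⟩ := sp.exists_stableJacobian_le_of_conj f.contMDiff hq hO hp hh'
    hcomm' hhp' hs' hL' hs hL
  obtain ⟨ε, hε, hεb⟩ := Metric.nhds_basis_ball.mem_iff.1
    (inter_mem (Metric.ball_mem_nhds p hε₁) (hhc (Metric.ball_mem_nhds p hε₂)))
  refine ⟨ε, hε, max (Real.log C₁) (Real.log C₂), fun x y hyx horb k => ?_⟩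
  have e1 := h₁ x y hyx (fun n => (hεb (horb n)).1) k
  have e2 := h₂ y x (by rw [hyx, hh]) (fun n => by
    rw [hyx, hcomm]; exact (hεb (horb n)).2) k
  rw [← Function.iterate_mul] at e1 e2
  have p1 := stableJacobian_iterate_pos (m := m) f hO hO' hne (q * k) x
  have p2 := stableJacobian_iterate_pos (m := m) f hO hO' hne (q * k) y
  have l1 := Real.log_le_log p2 e1
  have l2 := Real.log_le_log p1 e2
  rw [Real.log_mul hC₁.ne' p1.ne'] at l1
  rw [Real.log_mul hC₂.ne' p2.ne'] at l2
  rw [abs_le]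
  simp only [logJac]
  constructor
  · linarith [le_max_left (Real.log C₁) (Real.log C₂)]
  · linarith [le_max_right (Real.log C₁) (Real.log C₂)]

omit [IsRiemannianManifold (𝓡 m) M] in
-- Expanding the cocycle at `n + N` in both orders turns the difference into one between values of
-- the log-Jacobian of `f^N`, which is bounded.
theorem exists_logJac_sub_stableIter_le (hO : MapsTo f O O) (hO' : MapsTo f.symm O O)
    (hne : O.Nonempty) (N : ℕ) : ∃ C, ∀ n (x : StableManifold f O),
      |logJac (m := m) f n x - logJac f n (stableIter f hO hne N x)| ≤ C := by
  obtain ⟨c, hc, h⟩ := exists_logJac_bound (m := m) f hO hO' hne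
  refine ⟨N * c + N * c, fun n x => ?_⟩
  have h1 := logJac_add (m := m) f hO hO' hne n N x
  have h2 := logJac_add (m := m) f hO hO' hne N n x
  rw [add_comm N n] at h2
  have h3 := abs_le.1 (h N x)
  have h4 := abs_le.1 (h N (stableIter f hO hne n x))
  rw [abs_le]
  constructor <;> linarith

/-- With `f^j (g p) = p`, the map `f^j ∘ g` fixes `p` and is locally bi-Lipschitz there. It sends
`f^N x`, whose orbit under `f^q` stays near `p`, to `f^(j + N) (g x)`. -/
theorem exists_logJac_sub_le (sp : StableParam m f^[q] p F) (hq : 1 ≤ q)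
    (hO : MapsTo f O O) (hO' : MapsTo f.symm O O) (hfin : O.Finite) (hp : p ∈ O)
    (hTO : ∀ o ∈ O, f^[q] o = o) (hOp : ∀ o ∈ O, ∃ j < q, f^[j] o = p)
    {g : M ≃ₜ M} (hg : IsLipeomorphism g) (hgf : ∀ x, g (f x) = f (g x)) (hgO : MapsTo g O O)
    (x : StableManifold f O) :
    ∃ C, ∀ n, |logJac (m := m) f n x -
      logJac f n (stableMap g g.continuous hgf hgO ⟨p, hp⟩ x)| ≤ C := by
  have hne : O.Nonempty := ⟨p, hp⟩
  obtain ⟨⟨K, hK⟩, K', hK'⟩ := hg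
  obtain ⟨j, -, hj⟩ := hOp (g p) (hgO hp)
  have hfg : Function.LeftInverse f f.symm := f.apply_symm_apply
  have hgf' : Function.LeftInverse f.symm f := f.symm_apply_apply
  obtain ⟨K₁, s₁, hs₁, hL₁⟩ := exists_lipschitzOnWith_of_contMDiffAt (x := g p)
    (contMDiff_iterate f.contMDiff j).contMDiffAt
  obtain ⟨K₂, s₂, hs₂, hL₂⟩ := exists_lipschitzOnWith_of_contMDiffAt (x := p)
    (contMDiff_iterate f.symm.contMDiff j).contMDiffAt
  obtain ⟨ε, hε, C, hC⟩ := exists_logJac_sub_le_of_conj (m := m) (h := f^[j] ∘ g)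
    (h' := g.symm ∘ f.symm^[j]) f sp hq hO hO' hp
    (fun z => by simp [hgf'.iterate j (g z)]) (fun z => by simp [hfg.iterate j z])
    (fun z => by
      show f^[j] (g (f z)) = f (f^[j] (g z))
      rw [hgf, iterate_commute])
    hj (s := g ⁻¹' s₁) (g.continuous.continuousAt hs₁)
    (hL₁.comp (hK.lipschitzOnWith (s := g ⁻¹' s₁)) fun z hz => hz) hs₂
    ((hK'.lipschitzOnWith (s := univ)).comp hL₂ fun z _ => mem_univ _)
  obtain ⟨N, hN⟩ := exists_orbit_mem_ball f.continuous hq hfin hTO hOp hne x.2 hε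
  obtain ⟨c, hc, hb⟩ := exists_logJac_bound (m := m) f hO hO' hne
  set y := stableMap g g.continuous hgf hgO hne x with hy
  obtain ⟨C₁, h₁⟩ := exists_logJac_sub_stableIter_le (m := m) f hO hO' hne N
  obtain ⟨C₂, h₂⟩ := exists_logJac_sub_stableIter_le (m := m) f hO hO' hne (j + N)
  set x' := stableIter f hO hne N x
  set y' := stableIter f hO hne (j + N) y
  have hyx : y'.1 = (f^[j] ∘ g) x'.1 := by
    show f^[j + N] (g x.1) = f^[j] (g (f^[N] x.1))
    rw [Function.iterate_add_apply, (Function.Commute.iterate_right (f := g) (g := f) hgf N).eq]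
  -- `C₁` and `C₂` pay for the shifts by `N` and `j + N`, `C` for the conjugacy at times divisible
  -- by `q`, and `q * c` for the remainder of `n` modulo `q` at each of the two points.
  refine ⟨C₁ + C₂ + (C + 2 * (q * c)), fun n => ?_⟩
  have e1 := abs_le.1 (h₁ n x)
  have e2 := abs_le.1 (h₂ n y)
  have e3 := abs_le.1 (hC x' y' hyx hN (n / q))
  have hr : ∀ w : StableManifold f O, |logJac (m := m) f n w - logJac f (q * (n / q)) w| ≤ q * c := by
    intro w
    have h3 := logJac_add (m := m) f hO hO' hne (n % q) (q * (n / q)) w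
    rw [Nat.mod_add_div] at h3
    rw [h3, add_sub_cancel_right]
    refine (hb _ _).trans (mul_le_mul_of_nonneg_right ?_ hc)
    exact_mod_cast (Nat.mod_lt n hq).le
  have e4 := abs_le.1 (hr x')
  have e5 := abs_le.1 (hr y')
  rw [abs_le]
  constructor <;> linarith

end Distortion
end
end StableDistortion

/-! ### Constancy of the exponent on components, and conclusion -/

namespace StableDistortion
noncomputable section

/-- If a locally finite family of closed sets covers a dense subset of an open set `U`, and is
disjoint on `U`, then each component of `U` lies in one of these sets. -/
theorem exists_connectedComponentIn_subset {X ι : Type*} [TopologicalSpace X] {U D : Set X}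
    (hU : IsOpen U) (hD : Dense D) {S : ι → Set X} (hS : ∀ i, IsClosed (S i))
    (hcov : ∀ x ∈ D ∩ U, ∃ i, x ∈ S i) (hdisj : ∀ x ∈ U, ∀ i j, x ∈ S i → x ∈ S j → i = j)
    (hfin : ∀ x ∈ U, ∃ V ∈ 𝓝 x, {i | (S i ∩ V).Nonempty}.Finite) {x : X} (hx : x ∈ U) :
    ∃ i, connectedComponentIn U x ⊆ S i := by
  have hcov' : ∀ x ∈ U, ∃ i, x ∈ S i := by
    intro x hx
    obtain ⟨V, hV, hI⟩ := hfin x hx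
    have h1 : x ∈ closure (⋃ i ∈ {i | (S i ∩ V).Nonempty}, S i) := by
      -- Density puts `x` in the closure of the union of the finitely many members that meet `V`,
      -- and a finite union of closed sets is closed.
      refine mem_closure_iff_nhds.2 fun t ht => ?_
      obtain ⟨y, hy, hyD⟩ := hD.inter_nhds_nonempty (inter_mem (inter_mem ht hV) (hU.mem_nhds hx))
      obtain ⟨i, hi⟩ := hcov y ⟨hy, hyD.2⟩
      exact ⟨y, hyD.1.1, mem_biUnion (show (S i ∩ V).Nonempty from ⟨y, hi, hyD.1.2⟩) hi⟩
    rw [(hI.isClosed_biUnion fun i _ => hS i).closure_eq] at h1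
    obtain ⟨i, -, hi⟩ := mem_iUnion₂.1 h1
    exact ⟨i, hi⟩
  have hopen : ∀ x ∈ U, ∀ i, x ∈ S i → ∀ᶠ y in 𝓝 x, y ∈ S i := by
    intro x hx i hi
    obtain ⟨V, hV, hI⟩ := hfin x hx
    -- The other members that meet `V` have a closed union missing `x`, so near `x` only `S i`
    -- remains.
    have h1 : IsClosed (⋃ j ∈ {j | (S j ∩ V).Nonempty} \ {i}, S j) :=
      (hI.subset sdiff_subset).isClosed_biUnion fun j _ => hS j
    have h2 : x ∉ ⋃ j ∈ {j | (S j ∩ V).Nonempty} \ {i}, S j := by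
      intro h
      obtain ⟨j, hj, hxj⟩ := mem_iUnion₂.1 h
      exact hj.2 (hdisj x hx j i hxj hi)
    filter_upwards [h1.isOpen_compl.mem_nhds h2, hV, hU.mem_nhds hx] with y hy hyV hyU
    obtain ⟨j, hj⟩ := hcov' y hyU
    rcases eq_or_ne j i with rfl | hne
    · exact hj
    · exact absurd (mem_iUnion₂.2 ⟨j, ⟨⟨y, hj, hyV⟩, hne⟩, hj⟩) hy
  obtain ⟨i, hi⟩ := hcov' x hx
  refine ⟨i, fun y hy => ?_⟩
  have h1 : IsClopen (Subtype.val ⁻¹' S i : Set (connectedComponentIn U x)) := by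
    refine ⟨(hS i).preimage continuous_subtype_val, isOpen_iff_mem_nhds.2 fun z hz => ?_⟩
    exact continuous_subtype_val.continuousAt
      (hopen z.1 (connectedComponentIn_subset _ _ z.2) i hz)
  have : PreconnectedSpace (connectedComponentIn U x) :=
    Subtype.preconnectedSpace isPreconnected_connectedComponentIn
  have h2 := h1.eq_univ ⟨⟨x, mem_connectedComponentIn hx⟩, hi⟩
  exact (h2.ge (mem_univ (⟨y, hy⟩ : connectedComponentIn U x)) : _)

section Periodic

variable {m : ℕ} {M : Type*} [MetricSpace M] [ChartedSpace (EuclideanSpace ℝ (Fin m)) M]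

theorem iterate_eq_zpow (f : M ≃ₘ^1⟮𝓡 m, 𝓡 m⟯ M) (n : ℕ) (x : M) :
    ((f.toEquiv : Equiv.Perm M) ^ (n : ℤ)) x = f^[n] x := by
  rw [zpow_natCast, Equiv.Perm.iterate_eq_pow f.toEquiv n |>.symm]
  rfl

theorem continuous_zpow (f : M ≃ₘ^1⟮𝓡 m, 𝓡 m⟯ M) (i : ℤ) :
    Continuous ((f.toEquiv : Equiv.Perm M) ^ i) := by
  rcases i with n | n
  · have : ⇑((f.toEquiv : Equiv.Perm M) ^ (Int.ofNat n)) = f^[n] := funext (iterate_eq_zpow f n)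
    rw [this]
    exact f.continuous.iterate n
  · have : ⇑((f.toEquiv : Equiv.Perm M) ^ (Int.negSucc n)) = f.symm^[n + 1] := by
      rw [zpow_negSucc, ← inv_pow, ← Equiv.Perm.iterate_eq_pow]
      rfl
    rw [this]
    exact f.symm.continuous.iterate _

/-- The fixed data attached to a periodic orbit: some iterate fixes all its points. -/
theorem IsHyperbolicPeriodicOrbit.exists_stableParam [IsManifold (𝓡 m) 1 M]
    {f : M ≃ₘ^1⟮𝓡 m, 𝓡 m⟯ M} {O : Set M} (hO : IsHyperbolicPeriodicOrbit m f O) :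
    ∃ p ∈ O, ∃ q, 1 ≤ q ∧ ∃ S : Submodule ℝ (EuclideanSpace ℝ (Fin m)),
      Nonempty (StableParam m f^[q] p S) ∧ MapsTo f O O ∧ MapsTo f.symm O O ∧ O.Finite ∧
      (∀ o ∈ O, f^[q] o = o) ∧ ∀ o ∈ O, ∃ j < q, f^[j] o = p := by
  obtain ⟨p, τ, hτ, hp, rfl, heig⟩ := hO
  obtain ⟨N, S, hN, hS⟩ := exists_stableParam_of_hyperbolic f hp heig
  have hq : 1 ≤ τ * N := Nat.mul_pos hτ hN
  have hqp : f^[τ * N] p = p := by rw [Function.iterate_mul, Function.iterate_fixed hp]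
  set q := τ * N with hqdef
  clear_value q
  have hmod : ∀ n, f^[n] p = f^[n % q] p := fun n => by
    rw [iterate_eq_mod_div f q n p, Function.iterate_fixed hqp]
  refine ⟨p, ⟨0, rfl⟩, q, hq, S, hS, ?_, ?_, ?_, ?_, ?_⟩
  · rintro _ ⟨n, rfl⟩
    exact ⟨n + 1, Function.iterate_succ_apply' f n p⟩
  · rintro _ ⟨n, rfl⟩
    -- Since `f^q` fixes `p`, one step backward is `q - 1` steps forward.
    refine ⟨n + (q - 1), ?_⟩
    show f^[n + (q - 1)] p = f.symm (f^[n] p)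
    rw [← f.symm_apply_apply (f^[n + (q - 1)] p), ← Function.iterate_succ_apply' f,
      show (n + (q - 1)).succ = n + q by omega, Function.iterate_add_apply, hqp]
  · refine (finite_range fun n : Fin q => f^[(n : ℕ)] p).subset ?_
    rintro _ ⟨n, rfl⟩
    exact ⟨⟨n % q, Nat.mod_lt _ hq⟩, (hmod n).symm⟩
  · rintro _ ⟨n, rfl⟩
    show f^[q] (f^[n] p) = f^[n] p
    rw [← Function.iterate_add_apply, add_comm, Function.iterate_add_apply, hqp]
  · rintro _ ⟨n, rfl⟩
    have h1 : n % q < q := Nat.mod_lt _ hq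
    rcases Nat.eq_zero_or_pos (n % q) with h0 | h0
    · exact ⟨0, hq, by
        show f^[n] p = p
        rw [hmod, h0]; rfl⟩
    · refine ⟨q - n % q, by omega, ?_⟩
      show f^[q - n % q] (f^[n] p) = p
      rw [hmod n, ← Function.iterate_add_apply, Nat.sub_add_cancel h1.le, hqp]

end Periodic
end
end StableDistortion

theorem mainTheorem4 {m : ℕ} {M : Type*} [MetricSpace M] [CompactSpace M] [ConnectedSpace M]
    [ChartedSpace (EuclideanSpace ℝ (Fin m)) M] [IsManifold (𝓡 m) ∞ M]
    [RiemannianBundle (fun x : M => TangentSpace (𝓡 m) x)]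
    [IsContinuousRiemannianBundle (EuclideanSpace ℝ (Fin m)) (fun x : M => TangentSpace (𝓡 m) x)]
    [IsRiemannianManifold (𝓡 m) M]
    (f : M ≃ₘ^1⟮𝓡 m, 𝓡 m⟯ M) (O : Set M)
    (hO : StableDistortion.IsHyperbolicPeriodicOrbit m f O)
    (hD : StableDistortion.HasStableUnboundedDistortion f O)
    (g : M ≃ₜ M) (hg : StableDistortion.IsLipeomorphism g)
    (hgf : ∀ x, g (f x) = f (g x)) (hgO : g '' O = O)
    (x : StableDistortion.StableManifold f O) (hx : x.1 ∉ O) :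
    ∃ i : ℤ, ∀ y ∈ connectedComponentIn {z : StableDistortion.StableManifold f O | z.1 ∉ O} x,
      g y.1 = ((f.toEquiv : Equiv.Perm M) ^ i) y.1 := by
  open StableDistortion in
  have : IsManifold (𝓡 m) 1 M := IsManifold.of_le (n := ∞) (by simp)
  obtain ⟨p, hp, q, hq, S, ⟨sp⟩, hfO, hfO', hfin, hTO, hOp⟩ := hO.exists_stableParam
  obtain ⟨D, hDd, hD⟩ := hD
  have hne : O.Nonempty := ⟨p, hp⟩
  have hgM : MapsTo g O O := fun o ho => hgO.subset ⟨o, ho, rfl⟩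
  have hgN : ∀ z, z ∉ O → g z ∉ O := fun z hz h => by
    rw [← hgO] at h
    obtain ⟨o, ho, hoz⟩ := h
    exact hz (g.injective hoz ▸ ho)
  set P : Equiv.Perm M := f.toEquiv with hP
  set G := stableMap g g.continuous hgf hgM hne with hG
  have hpos : ∀ z, z ∉ O → 0 < Metric.infDist z O := fun z hz =>
    (hfin.isClosed.notMem_iff_infDist_pos hne).1 hz
  refine exists_connectedComponentIn_subset (D := D)
    (S := fun i : ℤ => {z : StableManifold f O | g z.1 = (P ^ i) z.1})
    (hfin.isClosed.isOpen_compl.preimage continuous_stableManifold_val) hDd (fun i => ?_) ?_ ?_ ?_ hx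
  · exact isClosed_eq (g.continuous.comp continuous_stableManifold_val)
      ((continuous_zpow f i).comp continuous_stableManifold_val)
  · rintro z ⟨hzD, hzO⟩
    by_contra! h
    obtain ⟨C, hC⟩ := exists_logJac_sub_le (m := m) f sp hq hfO hfO' hfin hp hTO hOp hg hgf hgM z
    obtain ⟨N, hN⟩ := exists_nat_ge (max C 1)
    obtain ⟨n, -, hn⟩ := hD z hzD (G z) (hgN _ hzO) h N (by
      exact_mod_cast (le_max_right C 1).trans hN)
    exact absurd (hC n) (not_le.2 (((le_max_left C 1).trans hN).trans_lt hn))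
  · have key : ∀ z : StableManifold f O, z.1 ∉ O → ∀ i j : ℤ, i < j → (P ^ i) z.1 ≠ (P ^ j) z.1 := by
      intro z hz i j hij h
      obtain ⟨k, rfl⟩ : ∃ k : ℕ, j = i + k := ⟨(j - i).toNat, by omega⟩
      rw [zpow_add, Equiv.Perm.mul_apply] at h
      have h1 := (P ^ i).injective h
      rw [hP, iterate_eq_zpow] at h1
      exact hz (mem_of_iterate_eq hfin hne z.2 (k := k) (by omega) h1.symm)
    intro z hz i j hi hj
    have h : (P ^ i) z.1 = (P ^ j) z.1 := hi.symm.trans hj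
    rcases lt_trichotomy i j with hij | hij | hij
    · exact absurd h (key z hz i j hij)
    · exact hij
    · exact absurd h.symm (key z hz j i hij)
  -- Local finiteness: near `z`, both `w` and `g w` keep a definite distance from `O`. An exponent
  -- `i ≥ n₁` would bring `g w = f^i w` too close to `O`, and `i ≤ -n₂` would do the same to `w =
  -- f^(-i) (g w)`.
  · intro z hz
    obtain ⟨n₁, h₁⟩ := sp.eventually_infDist_lt f.continuous hq hfO hfin hp hTO hOp z
      (half_pos (hpos _ (hgN _ hz)))
    obtain ⟨n₂, h₂⟩ := sp.eventually_infDist_lt f.continuous hq hfO hfin hp hTO hOp (G z)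
      (half_pos (hpos _ hz))
    have hGc : Continuous G := continuous_stableMap g.continuous hgf hgM hne
    have h₃ : ∀ᶠ w in 𝓝 z, Metric.infDist z.1 O / 2 < Metric.infDist w.1 O :=
      ((Metric.continuous_infDist_pt O).comp continuous_stableManifold_val).continuousAt.eventually
        (lt_mem_nhds (half_lt_self (hpos _ hz)))
    have h₄ : ∀ᶠ w in 𝓝 z, Metric.infDist (g z.1) O / 2 < Metric.infDist (g w.1) O :=
      ((Metric.continuous_infDist_pt O).comp
        (g.continuous.comp continuous_stableManifold_val)).continuousAt.eventually
        (lt_mem_nhds (half_lt_self (hpos _ (hgN _ hz))))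
    refine ⟨_, (h₁.and (hGc.continuousAt.eventually h₂)).and (h₃.and h₄),
      (finite_Ioo (-n₂ : ℤ) n₁).subset ?_⟩
    rintro i ⟨w, hi, ⟨hw₁, hw₂⟩, hw₃, hw₄⟩
    change g w.1 = (P ^ i) w.1 at hi
    constructor
    · by_contra! hle
      have h5 : w.1 = f^[(-i).toNat] (g w.1) := by
        rw [← iterate_eq_zpow, Int.toNat_of_nonneg (by omega), hi, zpow_neg]
        exact ((P ^ i).symm_apply_apply w.1).symm
      have h6 := hw₂ (-i).toNat (by omega)
      change Metric.infDist (f^[(-i).toNat] (g w.1)) O < _ at h6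
      rw [← h5] at h6
      exact lt_asymm h6 hw₃
    · by_contra! hle
      have h6 := hw₁ i.toNat (by omega)
      rw [← iterate_eq_zpow, Int.toNat_of_nonneg (by omega), ← hP, ← hi] at h6
      exact lt_asymm h6 hw₄
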